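/- **Problem and conventions.** An NFA $A=(Q,\Sigma,q_0,\delta,F)$ has states $Q=\{0,\dots,n-1\}$, one initial state $q_0$, final states $F\subseteq Q$, a non-empty alphabet $\Sigma=\{1,\dots,\sigma\}$, and a transition function $\delta:Q\times(\Sigma\cup\{\epsilon\})\to 2^Q$; it has $m$ transitions, i.e. $m=|\{(q,a,p): p\in\delta(q,a)\}|$. For its language $L=L(A)$ let $\Sigma_L$ be the set of letters that occur in words of $L$, i.e. the smallest alphabet with $L\subseteq\Sigma_L^*$. A word $w\in L$ is $k$-universal if the set of its subsequences of length $k$ is $\Sigma_L^k$. The problem $k$-ESU is: given an NFA $A$ and an integer $k\ge 0$, decide whether $L(A)$ contains a $k$-universal word. The model of computation is the unit-cost word RAM with word size $\omega$: a program (which does not depend on $\omega$) has a constant number of registers and of memory arrays, all holding $\omega$-bit words, with cells of the arrays addressed indirectly by words and initially $0$ except for the input; arithmetic (modulo $2^\omega$), bitwise operations, loads, stores and (conditional) jumps each take one step. The input is a list of words: $n$, $\sigma$, $q_0$, then for each state whether it is final and the list of the transitions leaving it, and then $k$, written in base $2^\omega$ and preceded by the number of its digits. Let $N$ be the number of words of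 the input; it is assumed that $\sigma\le N\le 2^\omega$ and that all the words of the input are smaller than $2^\omega$. **Theorem.** There are a word-RAM program and a constant $C$ such that, for every NFA $A$ with $n$ states and $m$ transitions over an alphabet of size $\sigma\ge 1$, every $k$, and every word size $\omega$ as above, the program halts with the correct answer to $k$-ESU after at most $$C\cdot 2^n\,n\,\bigl(m+n\sigma\sqrt n\bigr)$$ steps; that is, $k$-ESU can be solved in $O(2^n n(m+n\sigma\sqrt n))$ time. Moreover, $k$-ESU for NFAs is fixed-parameter tractable with respect to the number $n$ of states: there are a word-RAM program, a computable function $f:\mathbb N\to\mathbb N$ and a constant $c$ such that the program decides $k$-ESU on all these inputs within $f(n)\cdot N^c$ steps. -/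

import Mathlib

/-! ### The unit-cost word RAM -/

namespace WordRAM

/-- The binary operations on machine words. -/
inductive BinOp where
  | add | sub | mul | div | mod | and | or | xor | shl | shr

/-- The result of an operation with word size `w`; all arithmetic is modulo `2 ^ w`
(and division and remainder by `0` are those of `ℕ`). -/
def BinOp.eval (w : ℕ) : BinOp → ℕ → ℕ → ℕ
  | .add, a, b => (a + b) % 2 ^ w
  | .sub, a, b => (a + (2 ^ w - b % 2 ^ w)) % 2 ^ w
  | .mul, a, b => (a * b) % 2 ^ w
  | .div, a, b => (a / b) % 2 ^ w
  | .mod, a, b => (a % b) % 2 ^ w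
  | .and, a, b => (a &&& b) % 2 ^ w
  | .or, a, b => (a ||| b) % 2 ^ w
  | .xor, a, b => (a ^^^ b) % 2 ^ w
  | .shl, a, b => (a <<< b) % 2 ^ w
  | .shr, a, b => (a >>> b) % 2 ^ w

/-- Instructions. Registers `d`, `a`, `b`, `s` and memory arrays `j` are named by literals in the
program, so that a program has a constant number of registers and of arrays; the cells of an array
are addressed indirectly, by the word that register `a` holds. `l` is a jump target. -/
inductive Instr where
  | const (d v : ℕ)
  | op (o : BinOp) (d a b : ℕ)
  | load (d j a : ℕ)
  | store (j a s : ℕ)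
  | jump (l : ℕ)
  | jumpEq (a b l : ℕ)
  | jumpLt (a b l : ℕ)
  | halt (answer : Bool)

/-- A program is a finite list of instructions; it does not depend on the word size. -/
abbrev Program := List Instr

/-- A configuration: program counter, registers, and memory (`mem j i` is cell `i` of array `j`).
All registers and cells hold words, and so only the cells `i < 2 ^ w` can be accessed. -/
structure Config where
  pc : ℕ
  reg : ℕ → ℕ
  mem : ℕ → ℕ → ℕ

/-- The start: the input stands in array `0`, everything else is `0`. -/
def start (input : List ℕ) : Config where
  pc := 0
  reg := fun _ => 0
  mem := fun j i => if j = 0 then input.getD i 0 else 0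

/-- Execution of one instruction with word size `w`. -/
def Instr.exec (w : ℕ) (c : Config) : Instr → Config
  | .const d v => { c with pc := c.pc + 1, reg := Function.update c.reg d (v % 2 ^ w) }
  | .op o d a b =>
      { c with pc := c.pc + 1, reg := Function.update c.reg d (o.eval w (c.reg a) (c.reg b)) }
  | .load d j a => { c with pc := c.pc + 1, reg := Function.update c.reg d (c.mem j (c.reg a)) }
  | .store j a s =>
      { c with
        pc := c.pc + 1
        mem := Function.update c.mem j (Function.update (c.mem j) (c.reg a) (c.reg s)) }
  | .jump l => { c with pc := l }
  | .jumpEq a b l => { c with pc := if c.reg a = c.reg b then l else c.pc + 1 }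
  | .jumpLt a b l => { c with pc := if c.reg a < c.reg b then l else c.pc + 1 }
  | .halt _ => c

/-- One step of a program; a configuration whose program counter points at `halt`, or outside of
the program, is left unchanged. -/
def step (P : Program) (w : ℕ) (c : Config) : Config :=
  match P[c.pc]? with
  | some i => i.exec w c
  | none => c

/-- On word size `w` and the given input, `P` reaches the instruction `halt answer` after
`t` executed instructions. -/
def HaltsAfter (P : Program) (w : ℕ) (input : List ℕ) (t : ℕ) (answer : Bool) : Prop :=
  P[((step P w)^[t] (start input)).pc]? = some (.halt answer)

/-- A decision problem for the word RAM. `input w x` is the instance `x` written as a list of words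
of `w` bits, and `valid w x` says that `x` is an instance that is posed to a machine of word
size `w`. -/
structure Problem (I : Type) where
  input : ℕ → I → List ℕ
  valid : ℕ → I → Prop
  yes : I → Prop

/-- `P` halts with the correct answer on every instance, for every word size, after at most
`T w x` steps. -/
def Problem.DecidedBy {I : Type} (X : Problem I) (P : Program) (T : ℕ → I → ℝ) : Prop :=
  ∀ (w : ℕ) (x : I), X.valid w x →
    ∃ (t : ℕ) (answer : Bool),
      HaltsAfter P w (X.input w x) t answer ∧ (answer = true ↔ X.yes x) ∧ (t : ℝ) ≤ T w x

/-- Fixed-parameter tractability with respect to the parameter `κ`: some program decides the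
problem in time `f (κ x) * N ^ c`, where `f` is computable, `c` is a constant, and `N` is the
input size. -/
def Problem.IsFPT {I : Type} (X : Problem I) (κ : I → ℕ) : Prop :=
  ∃ (P : Program) (f : ℕ → ℕ) (c : ℕ), Computable f ∧
    X.DecidedBy P fun w x => (f (κ x) : ℝ) * ((X.input w x).length : ℝ) ^ c

end WordRAM

/-! ### Subsequence universality -/

namespace ESU

/-- The set of letters that occur in the words of `L`, that is, the smallest set `S` of letters
such that `L` is a language over `S`. -/
def minAlphabet {α : Type} (L : Language α) : Set α :=
  {a | ∃ w ∈ L, a ∈ w}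

/-- `w` is `k`-subsequence universal with respect to the alphabet `S`: its subsequences of
length `k` are exactly the words of length `k` over `S`. -/
def IsUniversal {α : Type} (S : Set α) (k : ℕ) (w : List α) : Prop :=
  {u : List α | u.Sublist w ∧ u.length = k} = {u : List α | (∀ a ∈ u, a ∈ S) ∧ u.length = k}

/-- `L` contains a word that is `k`-subsequence universal with respect to the smallest alphabet
of `L`. -/
def IsExistsUniversal {α : Type} (k : ℕ) (L : Language α) : Prop :=
  ∃ w ∈ L, IsUniversal (minAlphabet L) k w

/-- An NFA with `ε`-transitions over a finite integer alphabet, as input data: `n` states, `σ`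
letters, one initial state, the marked final states, and for each state the list (in any order,
without repetitions) of the transitions that leave it. The label `none` is `ε`. -/
structure NFAData where
  n : ℕ
  σ : ℕ
  initial : Fin n
  final : Fin n → Bool
  trans : Fin n → List (Option (Fin σ) × Fin n)
  nodup : ∀ q, (trans q).Nodup

namespace NFAData

/-- The automaton that the data describe. -/
def toεNFA (A : NFAData) : εNFA (Fin A.σ) (Fin A.n) where
  step q a := {p | (a, p) ∈ A.trans q}
  start := {A.initial}
  accept := {q | A.final q = true}

/-- The number of transitions. -/
def m (A : NFAData) : ℕ := ∑ q, (A.trans q).length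

theorem m_eq_ncard (A : NFAData) :
    A.m = {e : Fin A.n × Option (Fin A.σ) × Fin A.n |
      e.2.2 ∈ A.toεNFA.step e.1 e.2.1}.ncard := by
  classical
  have h : {e : Fin A.n × Option (Fin A.σ) × Fin A.n | e.2.2 ∈ A.toεNFA.step e.1 e.2.1} =
      ((Finset.univ.sigma fun q => (A.trans q).toFinset).map
        (Equiv.sigmaEquivProd (Fin A.n) (Option (Fin A.σ) × Fin A.n)).toEmbedding :
        Finset (Fin A.n × Option (Fin A.σ) × Fin A.n)) := by
    ext ⟨q, a, p⟩
    simp [toεNFA]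
  rw [h, Set.ncard_coe_finset, Finset.card_map, Finset.card_sigma, m]
  exact Finset.sum_congr rfl fun q _ => (List.toFinset_card_of_nodup (A.nodup q)).symm

/-- The letters are written as `1, …, σ`, and `ε` is written as `0`. -/
def encodeLabel {s : ℕ} : Option (Fin s) → ℕ
  | none => 0
  | some a => a.val + 1

/-- The description of a state: final or not, number of outgoing transitions, and for each of
these its label and its target. The states are written as `0, …, n - 1`. -/
def encodeState (A : NFAData) (q : Fin A.n) : List ℕ :=
  (A.final q).toNat :: (A.trans q).length ::
    (A.trans q).flatMap fun e => [encodeLabel e.1, e.2.val]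

/-- The automaton as a list of numbers. -/
def encode (A : NFAData) : List ℕ :=
  A.n :: A.σ :: A.initial.val :: (List.finRange A.n).flatMap A.encodeState

end NFAData

/-- An instance of the problem: an NFA and a number. -/
structure Instance where
  A : NFAData
  k : ℕ

/-- The automaton, followed by the number of words that it takes to write `k`, and these words
(the digits of `k` to the base `2 ^ w`, the least significant one first). -/
def Instance.input (w : ℕ) (x : Instance) : List ℕ :=
  x.A.encode ++ (Nat.digits (2 ^ w) x.k).length :: Nat.digits (2 ^ w) x.k

/-- The existence subsequence universality problem for NFAs. The alphabet is not empty and at most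
as large as the input, the input size is at most `2 ^ w`, and the input consists of words. -/
def problem : WordRAM.Problem Instance where
  input := Instance.input
  valid w x :=
    1 ≤ x.A.σ ∧ x.A.σ ≤ (x.input w).length ∧ (x.input w).length ≤ 2 ^ w ∧
      ∀ v ∈ x.input w, v < 2 ^ w
  yes x := IsExistsUniversal x.k x.A.toεNFA.accepts

end ESU

set_option linter.constructorNameAsVariable false
set_option linter.unusedSimpArgs false

/-! ### Structured programs and their compilation -/

namespace WordRAM

variable {R A : Type}

/-- A state of a structured program: the values of its variables and of its arrays. -/
@[ext] structure St (R A : Type) where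
  reg : R → ℕ
  mem : A → ℕ → ℕ

/-- Expressions of structured programs. -/
inductive Exp (R A : Type) where
  | lit (v : ℕ)
  | reg (r : R)
  | op (o : BinOp) (a b : Exp R A)
  | arr (a : A) (i : Exp R A)

namespace Exp

def eval (w : ℕ) (s : St R A) : Exp R A → ℕ
  | lit v => v % 2 ^ w
  | reg r => s.reg r
  | op o a b => o.eval w (a.eval w s) (b.eval w s)
  | arr a i => s.mem a (i.eval w s)

/-- The code that evaluates an expression, using the odd registers from `2 * k + 1` on, and the
register that holds the result. -/
def code (er : R → ℕ) (ea : A → ℕ) : Exp R A → ℕ → List Instr × ℕ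
  | lit v, k => ([.const (2 * k + 1) v], 2 * k + 1)
  | reg r, _ => ([], 2 * er r)
  | op o a b, k =>
      ((a.code er ea k).1 ++ ((b.code er ea (k + 1)).1 ++
        [.op o (2 * k + 1) (a.code er ea k).2 (b.code er ea (k + 1)).2]), 2 * k + 1)
  | arr a i, k => ((i.code er ea k).1 ++ [.load (2 * k + 1) (ea a) (i.code er ea k).2], 2 * k + 1)

/-- The number of instructions of the code of an expression. -/
def cost : Exp R A → ℕ
  | lit _ => 1
  | reg _ => 0
  | op _ a b => a.cost + b.cost + 1
  | arr _ i => i.cost + 1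

theorem length_code (er : R → ℕ) (ea : A → ℕ) (e : Exp R A) (k : ℕ) :
    (e.code er ea k).1.length = e.cost := by
  induction e generalizing k with
  | lit v => rfl
  | reg r => rfl
  | op o a b iha ihb => simp [code, cost, iha, ihb]; omega
  | arr a i ih => simp [code, cost, ih]

end Exp

/-- Conditions of structured programs. -/
inductive Cond (R A : Type) where
  | lt (a b : Exp R A)
  | eq (a b : Exp R A)

namespace Cond

def holds (w : ℕ) (s : St R A) : Cond R A → Prop
  | lt a b => a.eval w s < b.eval w s
  | eq a b => a.eval w s = b.eval w s

instance (w : ℕ) (s : St R A) : (b : Cond R A) → Decidable (b.holds w s)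
  | lt a b => inferInstanceAs (Decidable (a.eval w s < b.eval w s))
  | eq a b => inferInstanceAs (Decidable (a.eval w s = b.eval w s))

def cost : Cond R A → ℕ
  | lt a b => a.cost + b.cost
  | eq a b => a.cost + b.cost

/-- The code that evaluates the condition, continues behind itself if the condition holds, and
jumps to `l` otherwise; the code starts at the address `p`. -/
def code (er : R → ℕ) (ea : A → ℕ) (p l : ℕ) : Cond R A → List Instr
  | lt a b => (a.code er ea 0).1 ++ ((b.code er ea 1).1 ++
      [.jumpLt (a.code er ea 0).2 (b.code er ea 1).2 (p + a.cost + b.cost + 2), .jump l])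
  | eq a b => (a.code er ea 0).1 ++ ((b.code er ea 1).1 ++
      [.jumpEq (a.code er ea 0).2 (b.code er ea 1).2 (p + a.cost + b.cost + 2), .jump l])

end Cond

/-- Structured programs. -/
inductive Cmd (R A : Type) where
  | skip
  | set (r : R) (e : Exp R A)
  | store (a : A) (i e : Exp R A)
  | seq (c d : Cmd R A)
  | ite (b : Cond R A) (c d : Cmd R A)
  | loopWhile (b : Cond R A) (c : Cmd R A)

infixr:60 " ;; " => Cmd.seq

namespace Cmd

def len : Cmd R A → ℕ
  | skip => 0
  | set _ e => e.cost + 2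
  | store _ i e => i.cost + e.cost + 1
  | seq c d => c.len + d.len
  | ite b c d => b.cost + 2 + c.len + 1 + d.len
  | .loopWhile b c => b.cost + 2 + c.len + 1

/-- The code of a structured program, starting at the address `p`. -/
def code (er : R → ℕ) (ea : A → ℕ) : Cmd R A → ℕ → List Instr
  | skip, _ => []
  | set r e, _ => (e.code er ea 0).1 ++ [.const 3 0, .op .add (2 * er r) (e.code er ea 0).2 3]
  | store a i e, _ => (i.code er ea 0).1 ++ ((e.code er ea 1).1 ++
      [.store (ea a) (i.code er ea 0).2 (e.code er ea 1).2])
  | seq c d, p => c.code er ea p ++ d.code er ea (p + c.len)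
  | ite b c d, p => b.code er ea p (p + b.cost + 2 + c.len + 1) ++ (c.code er ea (p + b.cost + 2) ++
      ([.jump (p + b.cost + 2 + c.len + 1 + d.len)] ++ d.code er ea (p + b.cost + 2 + c.len + 1)))
  | .loopWhile b c, p => b.code er ea p (p + b.cost + 2 + c.len + 1) ++
      (c.code er ea (p + b.cost + 2) ++ [.jump p])

/-- A bound for the number of instructions that are executed in one step of a structured
program. -/
def unit : Cmd R A → ℕ
  | skip => 0
  | set _ e => e.cost + 2
  | store _ i e => i.cost + e.cost + 1
  | seq c d => max c.unit d.unit
  | ite b c d => max (b.cost + 3) (max c.unit d.unit)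
  | .loopWhile b c => max (b.cost + 3) c.unit

end Cmd

theorem Cond.length_code (er : R → ℕ) (ea : A → ℕ) (p l : ℕ) (b : Cond R A) :
    (b.code er ea p l).length = b.cost + 2 := by
  cases b <;> simp [Cond.code, Cond.cost, Exp.length_code] <;> omega

theorem Cmd.length_code (er : R → ℕ) (ea : A → ℕ) (c : Cmd R A) (p : ℕ) :
    (c.code er ea p).length = c.len := by
  induction c generalizing p with
  | skip => rfl
  | set r e => simp [Cmd.code, Cmd.len, Exp.length_code]
  | store a i e => simp [Cmd.code, Cmd.len, Exp.length_code]; omega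
  | seq c d ihc ihd => simp [Cmd.code, Cmd.len, ihc, ihd]
  | ite b c d ihc ihd => simp [Cmd.code, Cmd.len, ihc, ihd, Cond.length_code]; omega
  | loopWhile b c ih => simp [Cmd.code, Cmd.len, ih, Cond.length_code]; omega

/-- The list of instructions `l` stands in the program `P` at the address `p`. -/
def At (P : Program) (p : ℕ) (l : List Instr) : Prop :=
  ∃ pre post, P = pre ++ l ++ post ∧ pre.length = p

theorem At.left {P : Program} {p : ℕ} {l l' : List Instr} (h : At P p (l ++ l')) : At P p l := by
  obtain ⟨pre, post, rfl, rfl⟩ := h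
  exact ⟨pre, l' ++ post, by simp, rfl⟩

theorem At.right {P : Program} {p : ℕ} {l l' : List Instr} (h : At P p (l ++ l')) :
    At P (p + l.length) l' := by
  obtain ⟨pre, post, rfl, rfl⟩ := h
  exact ⟨pre ++ l, post, by simp, by simp⟩

theorem At.step {P : Program} {p : ℕ} {i : Instr} {l : List Instr} (h : At P p (i :: l)) (w : ℕ)
    {c : Config} (hc : c.pc = p) : WordRAM.step P w c = i.exec w c := by
  obtain ⟨pre, post, rfl, rfl⟩ := h
  simp [WordRAM.step, hc]

theorem At.tail {P : Program} {p : ℕ} {i : Instr} {l : List Instr} (h : At P p (i :: l)) :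
    At P (p + 1) l := At.right (l := [i]) h

/-- A configuration represents a state of a structured program. -/
def Rep (er : R → ℕ) (ea : A → ℕ) (s : St R A) (c : Config) : Prop :=
  (∀ r, c.reg (2 * er r) = s.reg r) ∧ ∀ a, c.mem (ea a) = s.mem a

theorem Exp.correct {er : R → ℕ} {ea : A → ℕ} {P : Program} {w : ℕ} {s : St R A} (e : Exp R A)
    {k p : ℕ} (hP : At P p (e.code er ea k).1) {c : Config} (hc : c.pc = p) (hs : Rep er ea s c) :
    ∃ c', (step P w)^[e.cost] c = c' ∧ c'.pc = p + e.cost ∧ Rep er ea s c' ∧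
      c'.reg (e.code er ea k).2 = e.eval w s ∧ ∀ j < k, c'.reg (2 * j + 1) = c.reg (2 * j + 1) := by
  induction e generalizing k p c with
  | lit v =>
    refine ⟨_, hP.step w hc, ?_⟩
    simp only [Instr.exec, Exp.code, Exp.eval, Exp.cost, hc, true_and, Function.update_self]
    refine ⟨⟨fun r => ?_, hs.2⟩, fun j hj => ?_⟩
    · exact (Function.update_of_ne (by omega) _ _).trans (hs.1 r)
    · rw [Function.update_of_ne (by omega)]
  | reg r => exact ⟨c, rfl, by simp [hc, Exp.cost], hs, hs.1 r, fun _ _ => rfl⟩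
  | arr a i ih =>
    obtain ⟨c₁, h₁, hp₁, hs₁, hv₁, hk₁⟩ := ih hP.left hc hs
    have h := hP.right.step w (by rw [hp₁, Exp.length_code])
    refine ⟨_, by rw [Exp.cost, Function.iterate_succ_apply', h₁, h], ?_⟩
    simp only [Instr.exec, Exp.code, Exp.eval, Exp.cost, hp₁, Function.update_self, hv₁, hs₁.2]
    refine ⟨by omega, ⟨fun r => ?_, hs₁.2⟩, trivial, fun j hj => ?_⟩
    · exact (Function.update_of_ne (by omega) _ _).trans (hs₁.1 r)
    · rw [Function.update_of_ne (by omega), hk₁ j hj]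
  | op o a b iha ihb =>
    obtain ⟨c₁, h₁, hp₁, hs₁, hv₁, hk₁⟩ := iha hP.left hc hs
    obtain ⟨c₂, h₂, hp₂, hs₂, hv₂, hk₂⟩ := ihb hP.right.left
      (by rw [hp₁, Exp.length_code]) hs₁
    have h := hP.right.right.step w (by rw [hp₂, Exp.length_code, Exp.length_code])
    have hv : c₂.reg (a.code er ea k).2 = a.eval w s := by
      cases a with
      | reg r => exact hs₂.1 r
      | _ => rw [← hv₁]; exact hk₂ k (by omega)
    refine ⟨_, by rw [Exp.cost, Function.iterate_succ_apply', Nat.add_comm a.cost,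
      Function.iterate_add_apply, h₁, h₂, h], ?_⟩
    simp only [Instr.exec, Exp.code, Exp.eval, Exp.cost, hp₂, Function.update_self, hv₂, hv,
      Exp.length_code]
    refine ⟨by omega, ⟨fun r => ?_, hs₂.2⟩, trivial, fun j hj => ?_⟩
    · exact (Function.update_of_ne (by omega) _ _).trans (hs₂.1 r)
    · rw [Function.update_of_ne (by omega), hk₂ j (by omega), hk₁ j hj]

theorem Exp.correct_pair {er : R → ℕ} {ea : A → ℕ} {P : Program} {w : ℕ} {s : St R A}
    (a b : Exp R A) {l : List Instr}
    {p : ℕ} (hP : At P p ((a.code er ea 0).1 ++ ((b.code er ea 1).1 ++ l)))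
    {c : Config} (hc : c.pc = p) (hs : Rep er ea s c) :
    ∃ c', (step P w)^[a.cost + b.cost] c = c' ∧ c'.pc = p + a.cost + b.cost ∧ Rep er ea s c' ∧
      c'.reg (a.code er ea 0).2 = a.eval w s ∧ c'.reg (b.code er ea 1).2 = b.eval w s ∧
      At P (p + a.cost + b.cost) l := by
  obtain ⟨c₁, h₁, hp₁, hs₁, hv₁, hk₁⟩ := a.correct (w := w) hP.left hc hs
  obtain ⟨c₂, h₂, hp₂, hs₂, hv₂, hk₂⟩ := b.correct (w := w) hP.right.left
    (by rw [hp₁, Exp.length_code]) hs₁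
  refine ⟨c₂, by rw [Nat.add_comm, Function.iterate_add_apply, h₁, h₂], ?_, hs₂, ?_, hv₂, ?_⟩
  · rw [hp₂, Exp.length_code]
  · cases a with
    | reg r => exact hs₂.1 r
    | _ => rw [← hv₁]; exact hk₂ 0 (by omega)
  · have := hP.right.right
    rwa [Exp.length_code, Exp.length_code] at this

theorem Cond.correct {er : R → ℕ} {ea : A → ℕ} {P : Program} {w : ℕ} {s : St R A} (b : Cond R A)
    {p l : ℕ} (hP : At P p (b.code er ea p l)) {c : Config} (hc : c.pc = p) (hs : Rep er ea s c) :
    ∃ t ≤ b.cost + 2, ∃ c', (step P w)^[t] c = c' ∧ Rep er ea s c' ∧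
      c'.pc = if b.holds w s then p + (b.cost + 2) else l := by
  cases b with
  | lt a b =>
    obtain ⟨c₁, h₁, hp₁, hs₁, hv₁, hv₂, hl⟩ := Exp.correct_pair (w := w) a b hP hc hs
    have h2 := hl.step w hp₁
    by_cases h : a.eval w s < b.eval w s
    · refine ⟨a.cost + b.cost + 1, by simp [Cond.cost], _, rfl, ?_⟩
      rw [Function.iterate_succ_apply', h₁, h2]
      simp [Instr.exec, hv₁, hv₂, h, Cond.holds, Cond.cost, Rep, hs₁.1, hs₁.2]; omega
    · have h3 := hl.tail.step w (c := { c₁ with pc := p + a.cost + b.cost + 1 }) rfl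
      refine ⟨a.cost + b.cost + 2, by simp [Cond.cost], _, rfl, ?_⟩
      rw [Function.iterate_succ_apply', Function.iterate_succ_apply', h₁, h2]
      simp only [Instr.exec, hv₁, hv₂, h, if_false, hp₁, Cond.holds]
      rw [h3]
      simp [Instr.exec, Rep, hs₁.1, hs₁.2]
  | eq a b =>
    obtain ⟨c₁, h₁, hp₁, hs₁, hv₁, hv₂, hl⟩ := Exp.correct_pair (w := w) a b hP hc hs
    have h2 := hl.step w hp₁
    by_cases h : a.eval w s = b.eval w s
    · refine ⟨a.cost + b.cost + 1, by simp [Cond.cost], _, rfl, ?_⟩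
      rw [Function.iterate_succ_apply', h₁, h2]
      simp [Instr.exec, hv₁, hv₂, h, Cond.holds, Cond.cost, Rep, hs₁.1, hs₁.2]; omega
    · have h3 := hl.tail.step w (c := { c₁ with pc := p + a.cost + b.cost + 1 }) rfl
      refine ⟨a.cost + b.cost + 2, by simp [Cond.cost], _, rfl, ?_⟩
      rw [Function.iterate_succ_apply', Function.iterate_succ_apply', h₁, h2]
      simp only [Instr.exec, hv₁, hv₂, h, if_false, hp₁, Cond.holds]
      rw [h3]
      simp [Instr.exec, Rep, hs₁.1, hs₁.2]

def St.setReg [DecidableEq R] (s : St R A) (r : R) (v : ℕ) : St R A :=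
  { s with reg := Function.update s.reg r v }

def St.setMem [DecidableEq A] (s : St R A) (a : A) (i v : ℕ) : St R A :=
  { s with mem := Function.update s.mem a (Function.update (s.mem a) i v) }

@[simp] theorem St.setReg_reg [DecidableEq R] (s : St R A) (r r' : R) (v : ℕ) :
    (s.setReg r v).reg r' = if r' = r then v else s.reg r' := by
  simp [St.setReg, Function.update_apply]

@[simp] theorem St.setReg_mem [DecidableEq R] (s : St R A) (r : R) (v : ℕ) :
    (s.setReg r v).mem = s.mem := rfl

@[simp] theorem St.setMem_reg [DecidableEq A] (s : St R A) (a : A) (i v : ℕ) :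
    (s.setMem a i v).reg = s.reg := rfl

@[simp] theorem St.setMem_mem [DecidableEq A] (s : St R A) (a a' : A) (i v : ℕ) :
    (s.setMem a i v).mem a' = if a' = a then Function.update (s.mem a) i v else s.mem a' := by
  simp only [St.setMem, Function.update_apply]

variable [DecidableEq R] [DecidableEq A]

/-- `Exec w c s t s'`: on word size `w`, the structured program `c` transforms the state `s` into
`s'` in `t` steps. -/
inductive Exec (w : ℕ) : Cmd R A → St R A → ℕ → St R A → Prop
  | skip (s) : Exec w .skip s 0 s
  | set (s r e) : Exec w (.set r e) s 1 (s.setReg r (e.eval w s % 2 ^ w))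
  | store (s a i e) : Exec w (.store a i e) s 1 (s.setMem a (i.eval w s) (e.eval w s))
  | seq {c d s t s' t' s''} : Exec w c s t s' → Exec w d s' t' s'' →
      Exec w (c ;; d) s (t + t') s''
  | ite_pos {b : Cond R A} {c d s t s'} : b.holds w s → Exec w c s t s' →
      Exec w (.ite b c d) s (t + 1) s'
  | ite_neg {b : Cond R A} {c d s t s'} : ¬ b.holds w s → Exec w d s t s' →
      Exec w (.ite b c d) s (t + 1) s'
  | while_pos {b : Cond R A} {c s t s' t' s''} : b.holds w s → Exec w c s t s' →
      Exec w (.loopWhile b c) s' t' s'' → Exec w (.loopWhile b c) s (t + t' + 1) s''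
  | while_neg {b : Cond R A} {c s} : ¬ b.holds w s → Exec w (.loopWhile b c) s 1 s

/-- The code of a structured program is correct. -/
theorem Exec.correct {er : R → ℕ} {ea : A → ℕ} (her : er.Injective) (hea : ea.Injective)
    {P : Program} {w : ℕ} {u : ℕ} {c : Cmd R A} {s s' : St R A} {t : ℕ} (h : Exec w c s t s')
    (hu : c.unit ≤ u) {p : ℕ} (hP : At P p (c.code er ea p)) {x : Config} (hx : x.pc = p)
    (hs : Rep er ea s x) :
    ∃ t' ≤ u * t, ∃ x', (step P w)^[t'] x = x' ∧ x'.pc = p + c.len ∧ Rep er ea s' x' := by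
  induction h generalizing p x with
  | skip s => exact ⟨0, by simp, x, rfl, by simpa [Cmd.len] using hx, hs⟩
  | set s r e =>
    obtain ⟨c₁, h₁, hp₁, hs₁, hv₁, hk₁⟩ := e.correct (w := w) hP.left hx hs
    have hl := hP.right
    rw [Exp.length_code] at hl
    have h2 := hl.step w hp₁
    have h3 := hl.tail.step w (c := Instr.exec w c₁ (.const 3 0)) (by simp [Instr.exec, hp₁])
    simp only [Cmd.unit] at hu
    refine ⟨e.cost + 2, by omega, _, rfl, ?_⟩
    rw [Function.iterate_succ_apply', Function.iterate_succ_apply', h₁, h2, h3]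
    have he : Function.update c₁.reg 3 (0 % 2 ^ w) (e.code er ea 0).2 = e.eval w s := by
      cases e with
      | reg r => rw [← hv₁, Function.update_of_ne]; simp only [Exp.code]; omega
      | _ => rw [← hv₁]; simp [Exp.code]
    refine ⟨by simp [Instr.exec, hp₁, Cmd.len]; omega, fun r' => ?_, fun a => ?_⟩
    · simp only [Instr.exec, he, BinOp.eval, St.setReg_reg]
      split_ifs with hr
      · subst hr; simp
      · rw [Function.update_of_ne (fun h => hr (her (by omega))), Function.update_of_ne (by omega)]
        exact hs₁.1 r'
    · exact hs₁.2 a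
  | store s a i e =>
    obtain ⟨c₁, h₁, hp₁, hs₁, hv₁, hv₂, hl⟩ := Exp.correct_pair (w := w) i e hP hx hs
    have h2 := hl.step w hp₁
    simp only [Cmd.unit] at hu
    refine ⟨i.cost + e.cost + 1, by omega, _, rfl, ?_⟩
    rw [Function.iterate_succ_apply', h₁, h2]
    refine ⟨by simp [Instr.exec, hp₁, Cmd.len]; omega, fun r => hs₁.1 r, fun a' => ?_⟩
    simp only [Instr.exec, St.setMem_mem, hv₁, hv₂, hs₁.2, Function.update_apply, hea.eq_iff]
  | @seq c d s t s' t' s'' h h' ih ih' =>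
    simp only [Cmd.unit, max_le_iff] at hu
    obtain ⟨t₁, ht₁, x₁, hx₁, hp₁, hs₁⟩ := ih hu.1 hP.left hx hs
    have hr := hP.right
    rw [Cmd.length_code] at hr
    obtain ⟨t₂, ht₂, x₂, hx₂, hp₂, hs₂⟩ := ih' hu.2 hr hp₁ hs₁
    exact ⟨t₂ + t₁, by rw [Nat.mul_add]; omega, x₂,
      by rw [Function.iterate_add_apply, hx₁, hx₂], by rw [hp₂, Cmd.len]; omega, hs₂⟩
  | @ite_pos b c d s t s' hb h ih =>
    simp only [Cmd.unit, max_le_iff] at hu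
    obtain ⟨t₀, ht₀, x₀, hx₀, hs₀, hp₀⟩ := b.correct (w := w) hP.left hx hs
    rw [if_pos hb] at hp₀
    have hr := hP.right
    rw [Cond.length_code] at hr
    obtain ⟨t₁, ht₁, x₁, hx₁, hp₁, hs₁⟩ := ih hu.2.1 hr.left (by omega) hs₀
    have hr' := hr.right.left
    rw [Cmd.length_code] at hr'
    have h2 := hr'.step w hp₁
    refine ⟨1 + (t₁ + t₀), by rw [Nat.mul_add]; omega, _, rfl, ?_⟩
    rw [Nat.add_comm 1, Function.iterate_succ_apply', Function.iterate_add_apply, hx₀, hx₁, h2]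
    exact ⟨by simp [Instr.exec, Cmd.len]; omega, hs₁⟩
  | @ite_neg b c d s t s' hb h ih =>
    simp only [Cmd.unit, max_le_iff] at hu
    obtain ⟨t₀, ht₀, x₀, hx₀, hs₀, hp₀⟩ := b.correct (w := w) hP.left hx hs
    rw [if_neg hb] at hp₀
    have hr := hP.right.right.right
    simp only [Cond.length_code, Cmd.length_code, List.length_singleton] at hr
    obtain ⟨t₁, ht₁, x₁, hx₁, hp₁, hs₁⟩ := ih hu.2.2 hr hp₀ hs₀
    refine ⟨t₁ + t₀, by rw [Nat.mul_add]; omega, x₁,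
      by rw [Function.iterate_add_apply, hx₀, hx₁], by rw [hp₁, Cmd.len]; omega, hs₁⟩
  | @while_pos b c s t s' t' s'' hb h h' ih ih' =>
    have hu' := hu
    simp only [Cmd.unit, max_le_iff] at hu
    obtain ⟨t₀, ht₀, x₀, hx₀, hs₀, hp₀⟩ := b.correct (w := w) hP.left hx hs
    rw [if_pos hb] at hp₀
    have hr := hP.right
    rw [Cond.length_code] at hr
    obtain ⟨t₁, ht₁, x₁, hx₁, hp₁, hs₁⟩ := ih hu.2 hr.left hp₀ hs₀
    have hr' := hr.right
    rw [Cmd.length_code] at hr'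
    have h2 := hr'.step w hp₁
    obtain ⟨t₂, ht₂, x₂, hx₂, hp₂, hs₂⟩ := ih' hu' hP (x := Instr.exec w x₁ (.jump p))
      (by simp [Instr.exec]) hs₁
    refine ⟨t₂ + (1 + (t₁ + t₀)), by simp only [Nat.mul_add]; omega, x₂, ?_, hp₂, hs₂⟩
    rw [Function.iterate_add_apply, Nat.add_comm 1, Function.iterate_succ_apply',
      Function.iterate_add_apply, hx₀, hx₁, h2, hx₂]
  | @while_neg b c s hb =>
    simp only [Cmd.unit, max_le_iff] at hu
    obtain ⟨t₀, ht₀, x₀, hx₀, hs₀, hp₀⟩ := b.correct (w := w) hP.left hx hs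
    rw [if_neg hb] at hp₀
    exact ⟨t₀, by omega, x₀, hx₀, by rw [hp₀, Cmd.len]; omega, hs₀⟩

/-- A structured program as a program of the word RAM; the answer is whether the variable `r` is
`0`. -/
def Cmd.toProgram (er : R → ℕ) (ea : A → ℕ) (r : R) (c : Cmd R A) : Program :=
  c.code er ea 0 ++ [.const 3 0, .jumpEq (2 * er r) 3 (c.len + 3), .halt false, .halt true]

theorem Exec.haltsAfter {er : R → ℕ} {ea : A → ℕ} (her : er.Injective) (hea : ea.Injective)
    {w : ℕ} {c : Cmd R A} {input : List ℕ} {s s' : St R A} {t : ℕ} (h : Exec w c s t s') (r : R)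
    (hs : Rep er ea s (start input)) :
    ∃ t' ≤ c.unit * t + 2, HaltsAfter (c.toProgram er ea r) w input t' (s'.reg r = 0) := by
  have hP : At (c.toProgram er ea r) 0 (c.code er ea 0 ++ ([.const 3 0,
    .jumpEq (2 * er r) 3 (c.len + 3), .halt false, .halt true])) := ⟨[], [], by simp [Cmd.toProgram]⟩
  obtain ⟨t', ht', x, hx, hp, hs'⟩ := h.correct her hea le_rfl hP.left rfl hs
  have hl := hP.right
  rw [Cmd.length_code, Nat.zero_add] at hl
  rw [Nat.zero_add] at hp
  have h2 := hl.step w hp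
  have h3 := hl.tail.step w (c := Instr.exec w x (.const 3 0)) (by simp [Instr.exec, hp])
  refine ⟨t' + 2, by omega, ?_⟩
  rw [HaltsAfter, Function.iterate_succ_apply', Function.iterate_succ_apply', hx, h2, h3]
  have hr : Function.update x.reg 3 0 (2 * er r) = s'.reg r := by
    rw [Function.update_of_ne (by omega), hs'.1]
  simp only [Instr.exec, Function.update_self, hp, Nat.zero_mod, hr]
  have hlen := Cmd.length_code er ea c 0
  split_ifs with h
  · simp [h, Cmd.toProgram, hlen]
  · have h2 : c.len + 1 + 1 - c.len = 2 := by omega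
    rw [Cmd.toProgram, List.getElem?_append_right (by omega), hlen, h2]
    simp [h]

end WordRAM

/-! ### Total correctness with time bounds -/

namespace WordRAM

variable {R A : Type} [DecidableEq R] [DecidableEq A]

namespace Cmd

/-- Whether a program may write the variable `x`. -/
def wr (x : R) : Cmd R A → Bool
  | skip => false
  | set r _ => decide (x = r)
  | store _ _ _ => false
  | seq c d => c.wr x || d.wr x
  | ite _ c d => c.wr x || d.wr x
  | .loopWhile _ c => c.wr x

/-- Whether a program may write the array `x`. -/
def wm (x : A) : Cmd R A → Bool
  | skip => false
  | set _ _ => false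
  | store a _ _ => decide (x = a)
  | seq c d => c.wm x || d.wm x
  | ite _ c d => c.wm x || d.wm x
  | .loopWhile _ c => c.wm x

/-- Whether a program has no loops. -/
def straight : Cmd R A → Bool
  | seq c d => c.straight && d.straight
  | ite _ c d => c.straight && d.straight
  | .loopWhile _ _ => false
  | _ => true

/-- The number of steps of a program without loops. -/
def size : Cmd R A → ℕ
  | skip => 0
  | set _ _ => 1
  | store _ _ _ => 1
  | seq c d => c.size + d.size
  | ite _ c d => max c.size d.size + 1
  | .loopWhile _ _ => 0

/-- The state after a program without loops. -/
def denote (w : ℕ) : Cmd R A → St R A → St R A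
  | skip, s => s
  | set r e, s => s.setReg r (e.eval w s % 2 ^ w)
  | store a i e, s => s.setMem a (i.eval w s) (e.eval w s)
  | seq c d, s => d.denote w (c.denote w s)
  | ite b c d, s => if b.holds w s then c.denote w s else d.denote w s
  | .loopWhile _ _, s => s

/-- The loop for `i` from `lo` to `hi - 1`. -/
def loop (i : R) (lo hi : Exp R A) (c : Cmd R A) : Cmd R A :=
  .set i lo ;; .loopWhile (.lt (.reg i) hi) (c ;; .set i (.op .add (.reg i) (.lit 1)))

end Cmd

/-- The states agree on everything that the program does not write. -/
def Agree (c : Cmd R A) (s s' : St R A) : Prop :=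
  (∀ r, c.wr r = false → s'.reg r = s.reg r) ∧ ∀ a, c.wm a = false → s'.mem a = s.mem a

theorem Agree.refl (c : Cmd R A) (s : St R A) : Agree c s s := ⟨fun _ _ => rfl, fun _ _ => rfl⟩

theorem Agree.trans {c : Cmd R A} {s s' s'' : St R A} (h : Agree c s s') (h' : Agree c s' s'') :
    Agree c s s'' :=
  ⟨fun r hr => (h'.1 r hr).trans (h.1 r hr), fun a ha => (h'.2 a ha).trans (h.2 a ha)⟩

theorem Agree.mono {c d : Cmd R A} {s s' : St R A} (h : Agree c s s')
    (hr : ∀ r, d.wr r = false → c.wr r = false) (ha : ∀ a, d.wm a = false → c.wm a = false) :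
    Agree d s s' :=
  ⟨fun r h' => h.1 r (hr r h'), fun a h' => h.2 a (ha a h')⟩

theorem Exec.agree {w : ℕ} {c : Cmd R A} {s s' : St R A} {t : ℕ} (h : Exec w c s t s') :
    Agree c s s' := by
  induction h with
  | skip s => exact Agree.refl _ _
  | set s r e =>
    refine ⟨fun r' hr => ?_, fun _ _ => rfl⟩
    simp only [Cmd.wr, decide_eq_false_iff_not] at hr
    simp [hr]
  | store s a i e =>
    refine ⟨fun _ _ => rfl, fun a' ha => ?_⟩
    simp only [Cmd.wm, decide_eq_false_iff_not] at ha
    simp [ha]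
  | seq _ _ ih ih' =>
    refine Agree.trans (ih.mono ?_ ?_) (ih'.mono ?_ ?_) <;> intro r <;>
      simp +contextual [Cmd.wr, Cmd.wm]
  | ite_pos _ _ ih => refine ih.mono ?_ ?_ <;> intro r <;> simp +contextual [Cmd.wr, Cmd.wm]
  | ite_neg _ _ ih => refine ih.mono ?_ ?_ <;> intro r <;> simp +contextual [Cmd.wr, Cmd.wm]
  | while_pos _ _ _ ih ih' => exact Agree.trans (ih.mono (fun _ h => h) fun _ h => h) ih'
  | while_neg _ => exact Agree.refl _ _

/-- Started in `s`, the program terminates within `T` steps in a state that satisfies `Q`. -/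
def Does (w : ℕ) (c : Cmd R A) (s : St R A) (T : ℕ) (Q : St R A → Prop) : Prop :=
  ∃ t s', Exec w c s t s' ∧ t ≤ T ∧ Q s'

namespace Does

variable {w : ℕ} {c d : Cmd R A} {s : St R A} {T T₁ T₂ : ℕ} {Q Q₁ : St R A → Prop}

theorem mono (h : Does w c s T₁ Q₁) (hT : T₁ ≤ T) (hQ : ∀ s', Agree c s s' → Q₁ s' → Q s') :
    Does w c s T Q := by
  obtain ⟨t, s', he, ht, hq⟩ := h
  exact ⟨t, s', he, ht.trans hT, hQ s' he.agree hq⟩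

theorem seq (h : Does w c s T₁ Q₁) (h' : ∀ s', Agree c s s' → Q₁ s' → Does w d s' T₂ Q)
    (hT : T₁ + T₂ ≤ T) : Does w (c ;; d) s T Q := by
  obtain ⟨t, s', he, ht, hq⟩ := h
  obtain ⟨t', s'', he', ht', hq'⟩ := h' s' he.agree hq
  exact ⟨t + t', s'', he.seq he', by omega, hq'⟩

theorem ite {b : Cond R A} (h : b.holds w s → Does w c s T₁ Q)
    (h' : ¬ b.holds w s → Does w d s T₁ Q) (hT : T₁ + 1 ≤ T) : Does w (.ite b c d) s T Q := by
  by_cases hb : b.holds w s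
  · obtain ⟨t, s', he, ht, hq⟩ := h hb
    exact ⟨t + 1, s', he.ite_pos hb, by omega, hq⟩
  · obtain ⟨t, s', he, ht, hq⟩ := h' hb
    exact ⟨t + 1, s', he.ite_neg hb, by omega, hq⟩

theorem straight (hc : c.straight = true) (hT : c.size ≤ T) (hQ : Q (c.denote w s)) :
    Does w c s T Q := by
  suffices h : ∃ t ≤ c.size, Exec w c s t (c.denote w s) by
    obtain ⟨t, ht, he⟩ := h
    exact ⟨t, _, he, ht.trans hT, hQ⟩
  clear hT hQ
  induction c generalizing s with
  | skip => exact ⟨0, le_rfl, .skip s⟩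
  | set r e => exact ⟨1, le_rfl, .set s r e⟩
  | store a i e => exact ⟨1, le_rfl, .store s a i e⟩
  | seq c d ihc ihd =>
    simp only [Cmd.straight, Bool.and_eq_true] at hc
    obtain ⟨t, ht, he⟩ := ihc (s := s) hc.1
    obtain ⟨t', ht', he'⟩ := ihd (s := c.denote w s) hc.2
    exact ⟨t + t', by simp only [Cmd.size]; omega, he.seq he'⟩
  | ite b c d ihc ihd =>
    simp only [Cmd.straight, Bool.and_eq_true] at hc
    by_cases hb : b.holds w s
    · obtain ⟨t, ht, he⟩ := ihc (s := s) hc.1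
      refine ⟨t + 1, by simp only [Cmd.size]; omega, ?_⟩
      simpa [Cmd.denote, hb] using he.ite_pos hb
    · obtain ⟨t, ht, he⟩ := ihd (s := s) hc.2
      refine ⟨t + 1, by simp only [Cmd.size]; omega, ?_⟩
      simpa [Cmd.denote, hb] using he.ite_neg hb
  | loopWhile b c => simp [Cmd.straight] at hc

theorem while_ {b : Cond R A} (I : St R A → Prop) (Φ : St R A → ℕ) (h0 : I s)
    (step : ∀ s', Agree c s s' → I s' → b.holds w s' →
      ∃ T', Does w c s' T' fun s'' => I s'' ∧ Φ s'' + T' + 1 ≤ Φ s')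
    (hT : Φ s + 1 ≤ T) :
    Does w (.loopWhile b c) s T fun s' => I s' ∧ ¬ b.holds w s' := by
  suffices h : ∀ N s', Φ s' ≤ N → Agree c s s' → I s' →
      Does w (.loopWhile b c) s' (Φ s' + 1) fun s' => I s' ∧ ¬ b.holds w s' from
    (h _ s le_rfl (Agree.refl _ _) h0).mono hT fun _ _ h => h
  intro N
  induction N using Nat.strong_induction_on with
  | _ N ih =>
    intro s' hN ha hI
    by_cases hb : b.holds w s'
    · obtain ⟨T', t, s'', he, ht, hI', hΦ⟩ := step s' ha hI hb
      obtain ⟨t', s₃, he', ht', hq⟩ := ih (Φ s'') (by omega) s'' le_rfl (ha.trans he.agree) hI'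
      exact ⟨_, s₃, he.while_pos hb he', by omega, hq⟩
    · exact ⟨1, s', .while_neg hb, by omega, hI, hb⟩

/-- The rule for loops with an invariant that depends on the loop variable. -/
theorem loop {i : R} {lo hi : Exp R A} (I : ℕ → St R A → Prop) (a b : ℕ) (τ : ℕ → ℕ)
    (hlo : lo.eval w s = a) (hab : a ≤ b) (hb : b < 2 ^ w) (h0 : I a (s.setReg i a))
    (hhi : ∀ s', Agree (.loop i lo hi c) s s' → hi.eval w s' = b) (hi' : c.wr i = false)
    (step : ∀ j s', a ≤ j → j < b → s'.reg i = j → Agree (.loop i lo hi c) s s' → I j s' →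
      Does w c s' (τ j) fun s'' => I (j + 1) (s''.setReg i (j + 1)))
    (hT : ∑ j ∈ Finset.Ico a b, (τ j + 2) + 2 ≤ T) :
    Does w (.loop i lo hi c) s T fun s' => I b s' ∧ s'.reg i = b := by
  have hset : ∀ s' : St R A, Agree (.loop i lo hi c) s (s'.setReg i a) ↔
      Agree (.loop i lo hi c) s s' := by
    intro s'
    refine and_congr (forall_congr' fun r => ?_) Iff.rfl
    by_cases hr : r = i
    · simp [hr, Cmd.loop, Cmd.wr]
    · simp [hr]
  have hmono : ∀ s' s'' : St R A,
      Agree (c ;; .set i (.op .add (.reg i) (.lit 1))) s' s'' → Agree (.loop i lo hi c) s' s'' := by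
    refine fun s' s'' h => h.mono ?_ ?_ <;> intro r <;> simp +contextual [Cmd.loop, Cmd.wr, Cmd.wm]
  have hst := (hset s).2 (Agree.refl _ _)
  refine seq (Q₁ := fun s' => s' = s.setReg i a) (T₁ := 1)
    (T₂ := ∑ j ∈ Finset.Ico a b, (τ j + 2) + 1) (straight rfl le_rfl ?_) ?_ (by omega)
  · simp [Cmd.denote, hlo, Nat.mod_eq_of_lt (hab.trans_lt hb)]
  rintro _ - rfl
  refine (while_ (fun s' => I (s'.reg i) s' ∧ s'.reg i ≤ b ∧ a ≤ s'.reg i)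
    (fun s' => ∑ j ∈ Finset.Ico (s'.reg i) b, (τ j + 2)) ?_ ?_ (by simp)).mono le_rfl ?_
  · simpa [hab] using h0
  · rintro s' ha ⟨hI, hle, hge⟩ hlt
    have ha' := hst.trans (hmono _ _ ha)
    simp only [Cond.holds, Exp.eval, hhi s' ha'] at hlt
    refine ⟨τ (s'.reg i) + 1, seq (T₁ := τ (s'.reg i)) (T₂ := 1)
      (step (s'.reg i) s' hge hlt rfl ha' hI) ?_ le_rfl⟩
    intro s'' ha'' hI''
    have hi'' := ha''.1 i hi'
    refine straight rfl le_rfl ?_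
    have hv : (Cmd.denote w (.set i (.op .add (.reg i) (.lit 1))) s'') =
        s''.setReg i (s'.reg i + 1) := by
      simp [Cmd.denote, Exp.eval, BinOp.eval, hi'',
        Nat.mod_eq_of_lt (show s'.reg i + 1 < 2 ^ w by omega)]
    rw [hv]
    refine ⟨by simpa using ⟨hI'', hlt, by omega⟩, ?_⟩
    simp only [St.setReg_reg, if_true]
    rw [Finset.sum_eq_sum_Ico_succ_bot hlt]
    omega
  · rintro s' ha ⟨⟨hI, hle, -⟩, hn⟩
    have ha' : Agree (c ;; .set i (.op .add (.reg i) (.lit 1))) (s.setReg i a) s' := ha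
    simp only [Cond.holds, Exp.eval, hhi s' (hst.trans (hmono _ _ ha'))] at hn
    have : s'.reg i = b := by omega
    exact ⟨this ▸ hI, this⟩

/-- The rule for loops whose body takes constant time. -/
theorem loop_const {i : R} {lo hi : Exp R A} (I : ℕ → St R A → Prop) (a b τ : ℕ)
    (hlo : lo.eval w s = a) (hab : a ≤ b) (hb : b < 2 ^ w) (h0 : I a (s.setReg i a))
    (hhi : ∀ s', Agree (.loop i lo hi c) s s' → hi.eval w s' = b) (hi' : c.wr i = false)
    (step : ∀ j s', a ≤ j → j < b → s'.reg i = j → Agree (.loop i lo hi c) s s' → I j s' →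
      Does w c s' τ fun s'' => I (j + 1) (s''.setReg i (j + 1)))
    (hT : (b - a) * (τ + 2) + 2 ≤ T) :
    Does w (.loop i lo hi c) s T fun s' => I b s' ∧ s'.reg i = b :=
  loop I a b (fun _ => τ) hlo hab hb h0 hhi hi' step (by simpa using hT)

end Does
end WordRAM

/-! ### The program -/

namespace ESU

open WordRAM

/-- The variables of the program. -/
inductive Var where
  | n | sg | q0 | m | nd | kk | pos | q | e | j | len | v | r | cnt | st | g | i | hi | a | s | d
  | t | u | c | b | ok | fl | x | run | lose
  deriving DecidableEq

/-- The arrays of the program. -/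
inductive Mem where
  | inp | fin | src | lab | dst | mark | size | co | ids | off | sl | sv | need | ms | ch | stt
  | ct | price | own | lv | ptr
  deriving DecidableEq

abbrev V (x : Var) : Exp Var Mem := .reg x
abbrev M (a : Mem) (x : Var) : Exp Var Mem := .arr a (.reg x)
abbrev L (v : ℕ) : Exp Var Mem := .lit v
abbrev plus (e f : Exp Var Mem) : Exp Var Mem := .op .add e f
abbrev incr (x : Var) : Cmd Var Mem := .set x (plus (V x) (L 1))

/-- Reads the input into the arrays `fin`, `src`, `lab`, `dst`. -/
def parse : Cmd Var Mem :=
  .set .n (.arr .inp (L 0)) ;; .set .sg (.arr .inp (L 1)) ;; .set .q0 (.arr .inp (L 2)) ;;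
  .set .pos (L 3) ;; .set .e (L 0) ;;
  .loop .q (L 0) (V .n) (
    (.store .fin (V .q) (M .inp .pos) ;; incr .pos ;; .set .len (M .inp .pos) ;; incr .pos) ;;
    .loop .j (L 0) (V .len) (
      .store .src (V .e) (V .q) ;; .store .lab (V .e) (M .inp .pos) ;; incr .pos ;;
      .store .dst (V .e) (M .inp .pos) ;; incr .pos ;; incr .e)) ;;
  .set .m (V .e) ;; .set .nd (M .inp .pos) ;; .set .kk (L 0) ;;
  .ite (.lt (L 0) (V .nd)) (incr .pos ;; .set .kk (M .inp .pos)) .skip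

/-- Marks the states that can be reached from the state `v`. -/
def reach : Cmd Var Mem :=
  .loop .q (L 0) (V .n) (.store .mark (V .q) (L 0)) ;;
  .store .mark (V .v) (L 1) ;;
  .loop .r (L 0) (V .n) (
    .loop .e (L 0) (V .m) (
      .ite (.eq (.arr .mark (M .src .e)) (L 1)) (.store .mark (M .dst .e) (L 1)) .skip))

/-- Computes for every state the number of states that can be reached from it, and whether a final
state is among them. -/
def sizes : Cmd Var Mem :=
  .loop .v (L 0) (V .n) (
    reach ;; (.set .cnt (L 0) ;; .set .fl (L 0)) ;;
    .loop .q (L 0) (V .n) (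
      .ite (.eq (M .mark .q) (L 1))
        (incr .cnt ;; .ite (.eq (M .fin .q) (L 1)) (.set .fl (L 1)) .skip) .skip) ;;
    .store .size (V .v) (V .cnt) ;; .store .co (V .v) (V .fl))

/-- Numbers the strongly connected components in topological order. -/
def ranks : Cmd Var Mem :=
  .loop .v (L 0) (V .n) (
    reach ;; (.set .cnt (L 0) ;; .set .st (L 0)) ;;
    .loop .q (L 0) (V .n) (
      .ite (.lt (M .size .v) (M .size .q)) (incr .cnt)
        (.ite (.eq (M .size .q) (M .size .v))
          (.ite (.eq (M .mark .q) (L 1)) (.set .st (L 1)) .skip ;;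
            .ite (.eq (V .st) (L 0)) (incr .cnt) .skip) .skip)) ;;
    .store .ids (V .v) (V .cnt))

/-- Gives the number `n` to the states that occur on no accepting path. -/
def trim : Cmd Var Mem :=
  .set .v (V .q0) ;; reach ;;
  .loop .q (L 0) (V .n) (
    .ite (.eq (M .mark .q) (L 1))
      (.ite (.eq (M .co .q) (L 1)) .skip (.store .ids (V .q) (V .n)))
      (.store .ids (V .q) (V .n)))

/-- Sorts the useful transitions by the components of their sources. -/
def group : Cmd Var Mem :=
  .set .g (L 0) ;;
  .loop .i (L 0) (V .n) (
    .store .off (V .i) (V .g) ;;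
    .loop .e (L 0) (V .m) (
      .ite (.eq (.arr .ids (M .src .e)) (V .i))
        (.ite (.lt (.arr .ids (M .dst .e)) (V .n))
          (.store .sl (V .g) (M .lab .e) ;; .store .sv (V .g) (.arr .ids (M .dst .e)) ;; incr .g)
          .skip) .skip)) ;;
  .store .off (V .n) (V .g)

/-- Marks the letters that occur in words of the language. -/
def needed : Cmd Var Mem :=
  .loop .a (L 0) (V .sg) (.store .need (plus (V .a) (L 1)) (L 0)) ;;
  .loop .x (L 0) (V .g) (.store .need (M .sl .x) (L 1)) ;;
  .store .need (L 0) (L 0)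

/-- Finds the needed letters that occur in none of the components `ch s, …, ch d`, and initializes
the search for a matching. -/
def missing : Cmd Var Mem :=
  .store .ms (L 0) (L 0) ;;
  .loop .a (L 0) (V .sg) (
    .store .ms (plus (V .a) (L 1)) (.arr .need (plus (V .a) (L 1))) ;;
    .store .price (plus (V .a) (L 1)) (L 0) ;; .store .own (plus (V .a) (L 1)) (V .n)) ;;
  .loop .t (V .s) (plus (V .d) (L 1)) (
    (.set .c (M .ch .t) ;; .set .hi (.arr .off (plus (V .c) (L 1))) ;;
      .store .lv (V .t) (L 0) ;; .store .ptr (V .t) (M .off .c)) ;;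
    .loop .x (M .off .c) (V .hi) (
      .ite (.eq (M .sv .x) (V .c)) (.store .ms (M .sl .x) (L 0)) .skip))

/-- One step of the search for a letter for the crossing `u`, which evicts another crossing if that
one has a lower level. -/
def bid : Cmd Var Mem :=
  .set .c (M .ch .u) ;;
  .ite (.lt (M .ptr .u) (.arr .off (plus (V .c) (L 1))))
    (.set .b (.arr .sl (M .ptr .u)) ;; .set .fl (L 0) ;;
      .ite (.eq (.arr .sv (M .ptr .u)) (.arr .ch (plus (V .u) (L 1))))
        (.ite (.eq (M .ms .b) (L 1))
          (.ite (.lt (M .lv .u) (M .price .b)) .skip (.set .fl (L 1))) .skip) .skip ;;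
      .ite (.eq (V .fl) (L 1))
        (.store .price (V .b) (plus (M .lv .u) (L 1)) ;; .set .x (M .own .b) ;;
          .store .own (V .b) (V .u) ;; .set .u (V .x))
        (.store .ptr (V .u) (plus (M .ptr .u) (L 1))))
    (.store .lv (V .u) (plus (M .lv .u) (L 1)) ;; .store .ptr (V .u) (M .off .c) ;;
      .ite (.lt (M .lv .u) (V .n)) .skip (.set .u (V .n)))

/-- Decides whether the missing letters can be matched to the crossings between `ch s, …, ch d`. -/
def auction : Cmd Var Mem :=
  (.set .t (V .s) ;; .set .u (V .n)) ;;
  .loopWhile (.lt (V .t) (plus (V .d) (L 1))) (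
    .ite (.lt (V .u) (V .n)) bid (.ite (.lt (V .t) (V .d)) (.set .u (V .t)) .skip ;; incr .t)) ;;
  .set .ok (L 1) ;;
  .loop .a (L 0) (V .sg) (
    .ite (.eq (.arr .ms (plus (V .a) (L 1))) (L 1))
      (.ite (.eq (.arr .price (plus (V .a) (L 1))) (L 0)) (.set .ok (L 0)) .skip) .skip)

/-- Decides whether some path through the components `ch s, …, ch d` contains all needed letters. -/
def test : Cmd Var Mem := missing ;; auction

/-- Decides whether one component contains all needed letters. -/
def single : Cmd Var Mem :=
  .loop .i (L 0) (V .n) (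
    (.store .ch (L 0) (V .i) ;; .set .s (L 0) ;; .set .d (L 0)) ;; test ;;
    .ite (.eq (V .ok) (L 1)) (.set .lose (L 0)) .skip)

/-- Appends the component `v` to the current chain. -/
def push : Cmd Var Mem :=
  (.set .s (M .stt .d) ;; .set .cnt (M .ct .d) ;; incr .d ;; .store .ch (V .d) (V .v)) ;;
  test ;;
  .ite (.eq (V .ok) (L 1))
    (.store .stt (V .d) (V .d) ;; incr .cnt ;; .store .ct (V .d) (V .cnt) ;;
      .ite (.lt (V .cnt) (V .kk)) .skip (.set .lose (L 0) ;; .set .run (L 0)))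
    (.store .stt (V .d) (V .s) ;; .store .ct (V .d) (V .cnt))

/-- One step of the search through all chains of components. -/
def advance : Cmd Var Mem :=
  .ite (.lt (V .v) (V .n))
    ((.set .fl (L 0) ;; .set .c (M .ch .d) ;; .set .hi (.arr .off (plus (V .c) (L 1)))) ;;
      .loop .x (M .off .c) (V .hi) (.ite (.eq (M .sv .x) (V .v)) (.set .fl (L 1)) .skip) ;;
      .ite (.eq (V .fl) (L 1)) push .skip ;; incr .v)
    (.ite (.eq (V .d) (L 0)) (.set .run (L 0))
      (.set .v (plus (M .ch .d) (L 1)) ;; .set .d (.op .sub (V .d) (L 1))))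

/-- Decides whether some chain of components has at least `kk` arches. -/
def search : Cmd Var Mem :=
  (.set .run (L 1) ;; .store .ch (L 0) (M .ids .q0) ;; .store .stt (L 0) (L 0) ;;
    .store .ct (L 0) (L 0) ;; .set .d (L 0) ;; .set .v (plus (M .ids .q0) (L 1))) ;;
  .loopWhile (.eq (V .run) (L 1)) advance

/-- Decides the problem for a non-empty language and `k ≠ 0`. -/
def solve : Cmd Var Mem :=
  ranks ;; trim ;; group ;; needed ;; single ;;
  .ite (.eq (V .lose) (L 0)) .skip (.ite (.eq (V .nd) (L 1)) search .skip)

/-- The whole program; the answer is yes if the variable `lose` is `0` in the end. -/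
def main : Cmd Var Mem :=
  parse ;; .set .lose (L 1) ;; sizes ;;
  .ite (.eq (M .co .q0) (L 1)) (.ite (.eq (V .nd) (L 0)) (.set .lose (L 0)) solve) .skip

end ESU

attribute [simp] WordRAM.Exp.eval WordRAM.BinOp.eval WordRAM.Cmd.denote WordRAM.Cond.holds

namespace ESU

open WordRAM

/-- Reachability in the graph with the edges `src e → dst e`, `e < m`. -/
def Rch (m : ℕ) (src dst : ℕ → ℕ) : ℕ → ℕ → Prop :=
  Relation.ReflTransGen fun p q => ∃ e < m, src e = p ∧ dst e = q

theorem eval_of_agree {w a : ℕ} {c : Cmd Var Mem} {s s' : St Var Mem} {x : Var} (h : Agree c s s')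
    (hs : s.reg x = a) (hx : c.wr x = false) : (V x).eval w s' = a := (h.1 x hx).trans hs

/-- One round of the closure of the marked set. -/
theorem round_does {w n m v k : ℕ} {src dst : ℕ → ℕ} {s : St Var Mem} (hw : 1 < 2 ^ w)
    (hs : s.mem .src = src) (hd : s.mem .dst = dst)
    (hsrc : ∀ e < m, src e < n) (hm : s.reg .m = m) (hmw : m < 2 ^ w)
    (hI : ∀ q < n, s.mem .mark q = 1 → Rch m src dst v q)
    (hcl : (∀ e < m, s.mem .mark (src e) = 1 → s.mem .mark (dst e) = 1) ∨
      k ≤ ((Finset.range n).filter fun q => s.mem .mark q = 1).card) :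
    Does w (.loop .e (L 0) (V .m) (
      .ite (.eq (.arr .mark (M .src .e)) (L 1)) (.store .mark (M .dst .e) (L 1)) .skip)) s
      (m * 4 + 2) fun s' =>
        (∀ q < n, s.mem .mark q = 1 → s'.mem .mark q = 1) ∧
        (∀ q < n, s'.mem .mark q = 1 → Rch m src dst v q) ∧
        ((∀ e < m, s'.mem .mark (src e) = 1 → s'.mem .mark (dst e) = 1) ∨
          k + 1 ≤ ((Finset.range n).filter fun q => s'.mem .mark q = 1).card) := by
  have h1 : 1 % 2 ^ w = 1 := Nat.mod_eq_of_lt hw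
  refine (Does.loop_const (fun j s' => (∀ q < n, s.mem .mark q = 1 → s'.mem .mark q = 1) ∧
        (∀ q < n, s'.mem .mark q = 1 → Rch m src dst v q) ∧
        (∀ e < j, s.mem .mark (src e) = 1 → s'.mem .mark (dst e) = 1) ∧
        ((∀ e < m, s.mem .mark (src e) = 1 → s.mem .mark (dst e) = 1) →
          ∀ q < n, s'.mem .mark q = 1 → s.mem .mark q = 1)) 0 m 2
      (by simp) (by omega) hmw ?_ (fun s' h => eval_of_agree h hm rfl) rfl ?_ le_rfl).mono (by omega) ?_
  · simpa using hI
  · rintro j s' - hj hej hag ⟨hmo, hr, he, hc⟩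
    refine Does.straight rfl le_rfl ?_
    have hs' : s'.mem .src = src := (hag.2 .src rfl).trans hs
    have hd' : s'.mem .dst = dst := (hag.2 .dst rfl).trans hd
    simp only [Cmd.denote, Cond.holds, Exp.eval, hej, hs', hd', h1]
    split_ifs with h
    · simp only [St.setReg_mem, St.setMem_mem, if_true, Function.update_apply]
      refine ⟨fun q hq h' => ?_, fun q hq h' => ?_, fun e hee h' => ?_, fun hc' q hq h' => ?_⟩
      · split_ifs <;> simp [hmo q hq h']
      · split_ifs at h' with hqd
        · rw [hqd]
          exact (hr _ (hsrc j hj) h).tail ⟨j, hj, rfl, rfl⟩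
        · exact hr q hq h'
      · split_ifs with hqd
        · rfl
        · exact he e (by have : e ≠ j := by rintro rfl; exact hqd rfl
                         omega) h'
      · split_ifs at h' with hqd
        · exact hqd ▸ hc' j hj (hc hc' _ (hsrc j hj) h)
        · exact hc hc' q hq h'
    · simp only [St.setReg_mem]
      refine ⟨hmo, hr, fun e hee h' => ?_, hc⟩
      rcases Nat.lt_succ_iff_lt_or_eq.1 hee with h2 | rfl
      · exact he e h2 h'
      · exact absurd (hmo _ (hsrc e hj) h') h
  · rintro s' hag ⟨⟨hmo, hr, he, hc⟩, -⟩
    refine ⟨hmo, hr, ?_⟩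
    by_cases hall : ∀ q < n, s'.mem .mark q = 1 → s.mem .mark q = 1
    · exact .inl fun e hee h => he e hee (hall _ (hsrc e hee) h)
    · right
      push Not at hall
      obtain ⟨q, hq, h1, h2⟩ := hall
      rcases hcl with hcl | hcl
      · exact absurd (hc hcl q hq h1) h2
      · refine Nat.succ_le_of_lt (hcl.trans_lt (Finset.card_lt_card ?_))
        refine ⟨fun p hp => ?_, fun hsub => ?_⟩
        · simp only [Finset.mem_filter, Finset.mem_range] at hp ⊢
          exact ⟨hp.1, hmo _ hp.1 hp.2⟩
        · have := hsub (x := q) (by simp [hq, h1])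
          simp [h2] at this

/-- The data of an instance in the memory: `n` states, `m` transitions, and `g` letters. -/
structure Graph (w n m : ℕ) (src dst : ℕ → ℕ) (s : St Var Mem) : Prop where
  one_lt : 1 < 2 ^ w
  n_lt : n < 2 ^ w
  m_lt : m < 2 ^ w
  reg_n : s.reg .n = n
  reg_m : s.reg .m = m
  mem_src : s.mem .src = src
  mem_dst : s.mem .dst = dst
  src_lt : ∀ e < m, src e < n
  dst_lt : ∀ e < m, dst e < n

theorem Graph.agree {w n m : ℕ} {src dst : ℕ → ℕ} {s s' : St Var Mem} {c : Cmd Var Mem}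
    (h : Graph w n m src dst s) (ha : Agree c s s') (h1 : c.wr .n = false := by rfl)
    (h2 : c.wr .m = false := by rfl) (h3 : c.wm .src = false := by rfl)
    (h4 : c.wm .dst = false := by rfl) : Graph w n m src dst s' where
  __ := h
  reg_n := (ha.1 _ h1).trans h.reg_n
  reg_m := (ha.1 _ h2).trans h.reg_m
  mem_src := (ha.2 _ h3).trans h.mem_src
  mem_dst := (ha.2 _ h4).trans h.mem_dst

theorem reach_does {w n m v : ℕ} {src dst : ℕ → ℕ} {s : St Var Mem} (hG : Graph w n m src dst s)
    (hv : s.reg .v = v) (hvn : v < n) :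
    Does w reach s (n * (4 * m + 7) + 5) fun s' =>
      ∀ q < n, (s'.mem .mark q = 1 ↔ Rch m src dst v q) := by
  have h1 : 1 % 2 ^ w = 1 := Nat.mod_eq_of_lt hG.one_lt
  refine Does.seq (T₁ := n * 3 + 2) (T₂ := n * (4 * m + 4) + 3)
    (Does.loop_const (fun j s' => ∀ q < j, s'.mem .mark q = 0) 0 n 1 (by simp) (by omega)
      hG.n_lt (by simp) (fun s' h => eval_of_agree h hG.reg_n rfl) rfl ?_ (by omega)) ?_ (by nlinarith)
  · rintro j s' - hj hjq hag hI
    refine Does.straight rfl le_rfl fun q hq => ?_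
    simp only [Cmd.denote, Exp.eval, hjq, St.setReg_mem, St.setMem_mem, if_true,
      Function.update_apply]
    split_ifs with h
    · simp
    · exact hI q (by omega)
  rintro s₁ ha₁ ⟨hI, -⟩
  have hG₁ := hG.agree ha₁
  have hv₁ : s₁.reg .v = v := (ha₁.1 _ rfl).trans hv
  refine Does.seq (T₁ := 1) (T₂ := n * (4 * m + 4) + 2)
    (Q₁ := fun s' => ∀ q < n, s'.mem .mark q = if q = v then 1 else 0)
    (Does.straight rfl le_rfl ?_) ?_ (by omega)
  · intro q hq
    simp only [Cmd.denote, Exp.eval, hv₁, St.setMem_mem, if_true, Function.update_apply, h1]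
    split_ifs
    · rfl
    · exact hI q hq
  rintro s₂ ha₂ hI₂
  have hG₂ := hG₁.agree ha₂
  refine (Does.loop_const (fun k s' => s'.mem .mark v = 1 ∧
      (∀ q < n, s'.mem .mark q = 1 → Rch m src dst v q) ∧
      ((∀ e < m, s'.mem .mark (src e) = 1 → s'.mem .mark (dst e) = 1) ∨
          k + 1 ≤ ((Finset.range n).filter fun q => s'.mem .mark q = 1).card))
    0 n (m * 4 + 2) (by simp) (by omega) hG.n_lt ?_
    (fun s' h => eval_of_agree h hG₂.reg_n rfl) rfl ?_ (by rw [Nat.sub_zero]; nlinarith)).mono le_rfl ?_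
  · simp only [St.setReg_mem]
    refine ⟨by simp [hI₂ v hvn], fun q hq h => ?_, .inr (Finset.card_pos.2
      ⟨v, Finset.mem_filter.2 ⟨Finset.mem_range.2 hvn, by simp [hI₂ v hvn]⟩⟩)⟩
    rw [hI₂ q hq] at h
    split_ifs at h with h'
    rw [h']; exact .refl
  · rintro k s' - hk hkr hag ⟨hv', hr, hc⟩
    have hG' := hG₂.agree hag
    refine (round_does (k := k + 1) hG.one_lt hG'.mem_src hG'.mem_dst hG.src_lt
      hG'.reg_m hG.m_lt hr hc).mono le_rfl ?_
    rintro s'' ha'' ⟨h1, h2, h3⟩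
    exact ⟨h1 v hvn hv', h2, h3⟩
  · rintro s' - ⟨⟨hv', hr, hc⟩, -⟩ q hq
    refine ⟨hr q hq, fun h => ?_⟩
    rcases hc with hc | hc
    · clear hq
      induction h with
      | refl => exact hv'
      | tail _ h ih =>
        obtain ⟨e, he, rfl, rfl⟩ := h
        exact hc e he ih
    · have := Finset.card_filter_le (Finset.range n) fun q => s'.mem .mark q = 1
      rw [Finset.card_range] at this
      omega

end ESU

namespace ESU

open WordRAM

theorem card_filter_range_succ (P : ℕ → Prop) [DecidablePred P] (j : ℕ) :
    ((Finset.range (j + 1)).filter P).card =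
      ((Finset.range j).filter P).card + if P j then 1 else 0 := by
  rw [Finset.range_add_one, Finset.filter_insert]
  split_ifs <;> simp

theorem card_filter_range_le (P : ℕ → Prop) [DecidablePred P] (j : ℕ) :
    ((Finset.range j).filter P).card ≤ j := by
  simpa using Finset.card_filter_le (Finset.range j) P

open Classical in
/-- The number of states that can be reached from `v`. -/
noncomputable def reachCount (n : ℕ) (R : ℕ → ℕ → Prop) (v : ℕ) : ℕ :=
  ((Finset.range n).filter (R v)).card

open Classical in
/-- The number of states that come before the strongly connected component of `v` in a topological
order. -/
noncomputable def rank (n : ℕ) (R : ℕ → ℕ → Prop) (v : ℕ) : ℕ :=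
  ((Finset.range n).filter fun p => reachCount n R v < reachCount n R p ∨
    (reachCount n R p = reachCount n R v ∧
      ∀ q ≤ p, reachCount n R q = reachCount n R v → ¬ R v q)).card

theorem sizes_does {w n m : ℕ} {src dst : ℕ → ℕ} {s : St Var Mem} (hG : Graph w n m src dst s) :
    Does w sizes s (n * (n * (4 * m + 13) + 13) + 2) fun s' => ∀ v < n,
      s'.mem .size v = reachCount n (Rch m src dst) v ∧
      (s'.mem .co v = 1 ↔ ∃ q < n, Rch m src dst v q ∧ s.mem .fin q = 1) := by
  have h1 : 1 % 2 ^ w = 1 := Nat.mod_eq_of_lt hG.one_lt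
  refine (Does.loop_const (fun j s' => ∀ v < j, s'.mem .size v = reachCount n (Rch m src dst) v ∧
      (s'.mem .co v = 1 ↔ ∃ q < n, Rch m src dst v q ∧ s.mem .fin q = 1)) 0 n
    (n * (4 * m + 13) + 11) (by simp) (by omega) hG.n_lt (by simp)
    (fun s' h => eval_of_agree h hG.reg_n rfl) rfl ?_ (by simp)).mono le_rfl
    fun s' _ h => h.1
  rintro v s₀ - hv hvr ha₀ hI
  have hG₀ := hG.agree ha₀
  refine Does.seq (T₂ := n * 6 + 6) (reach_does hG₀ hvr hv) ?_ (by nlinarith)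
  intro s₁ ha₁ hR
  have hG₁ := hG₀.agree ha₁
  refine Does.seq (T₁ := 2) (T₂ := n * 6 + 4) (Q₁ := fun s' => s'.reg .cnt = 0 ∧ s'.reg .fl = 0)
    (Does.straight rfl le_rfl (by simp)) ?_ (by omega)
  rintro s₂ ha₂ hz
  have hG₂ := hG₁.agree ha₂
  classical
  refine Does.seq (T₁ := n * 6 + 2) (T₂ := 2)
    (Does.loop_const (fun j s' => s'.reg .cnt = ((Finset.range j).filter (Rch m src dst v)).card ∧
      s'.reg .fl ≤ 1 ∧ (s'.reg .fl = 1 ↔ ∃ q < j, Rch m src dst v q ∧ s.mem .fin q = 1)) 0 n 4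
    (by simp) (by omega) hG.n_lt (by simp [hz])
    (fun s' h => eval_of_agree h hG₂.reg_n rfl) rfl ?_ (by simp)) ?_ (by omega)
  · rintro q s' - hq hqr ha ⟨hc, hf, hfl⟩
    refine Does.straight rfl le_rfl ?_
    have hmark : s'.mem .mark q = 1 ↔ Rch m src dst v q := by
      rw [ha.2 .mark rfl, ha₂.2 .mark rfl, hR q hq]
    have hfin : s'.mem .fin = s.mem .fin := by
      rw [ha.2 .fin rfl, ha₂.2 .fin rfl, ha₁.2 .fin rfl, ha₀.2 .fin rfl]
    have hlt : s'.reg .cnt + 1 < 2 ^ w := by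
      have := card_filter_range_le (Rch m src dst v) q
      have := hG.n_lt
      omega
    simp only [Cmd.denote, Cond.holds, Exp.eval, hqr, h1, hmark, card_filter_range_succ, hfin]
    by_cases hr : Rch m src dst v q
    · by_cases hff : s.mem .fin q = 1
      · simp [hr, hff, hc ▸ Nat.mod_eq_of_lt hlt, hc, h1, hqr, hfin]
        exact ⟨q, by omega, hr, hff⟩
      · simp [hr, hff, hc ▸ Nat.mod_eq_of_lt hlt, hc, h1, hqr, hfin]
        refine ⟨hf, hfl.trans ⟨fun ⟨p, hp, h⟩ => ⟨p, by omega, h⟩, fun ⟨p, hp, h⟩ => ⟨p, ?_, h⟩⟩⟩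
        have : p ≠ q := by rintro rfl; exact hff h.2
        omega
    · simp [hr, hc, h1]
      refine ⟨hf, hfl.trans ⟨fun ⟨p, hp, h⟩ => ⟨p, by omega, h⟩, fun ⟨p, hp, h⟩ => ⟨p, ?_, h⟩⟩⟩
      have : p ≠ q := by rintro rfl; exact hr h.1
      omega
  · rintro s₃ ha₃ ⟨⟨hc, hf, hfl⟩, -⟩
    refine Does.straight rfl le_rfl fun p hp => ?_
    have hv₃ : s₃.reg .v = v := by rw [ha₃.1 .v rfl, ha₂.1 .v rfl, ha₁.1 .v rfl, hvr]
    have e1 : s₃.mem .size = s₀.mem .size := by rw [ha₃.2 .size rfl, ha₂.2 .size rfl, ha₁.2 .size rfl]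
    have e2 : s₃.mem .co = s₀.mem .co := by rw [ha₃.2 .co rfl, ha₂.2 .co rfl, ha₁.2 .co rfl]
    by_cases hpv : p = v
    · subst hpv
      simpa [hv₃, reachCount, hc] using hfl
    · simpa [hv₃, hpv, e1, e2] using hI p (by omega)

theorem ranks_does {w n m : ℕ} {src dst : ℕ → ℕ} {s : St Var Mem} (hG : Graph w n m src dst s)
    (hsize : ∀ v < n, s.mem .size v = reachCount n (Rch m src dst) v) :
    Does w ranks s (n * (n * (4 * m + 15) + 12) + 2) fun s' => ∀ v < n,
      s'.mem .ids v = rank n (Rch m src dst) v := by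
  have h1 : 1 % 2 ^ w = 1 := Nat.mod_eq_of_lt hG.one_lt
  refine (Does.loop_const (fun j s' => ∀ v < j, s'.mem .ids v = rank n (Rch m src dst) v) 0 n
    (n * (4 * m + 15) + 10) (by simp) (by omega) hG.n_lt (by simp)
    (fun s' h => eval_of_agree h hG.reg_n rfl) rfl ?_ (by simp)).mono le_rfl
    fun s' _ h => h.1
  rintro v s₀ - hv hvr ha₀ hI
  have hG₀ := hG.agree ha₀
  refine Does.seq (T₂ := n * 8 + 5) (reach_does hG₀ hvr hv) ?_ (by nlinarith)
  intro s₁ ha₁ hR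
  have hG₁ := hG₀.agree ha₁
  refine Does.seq (T₁ := 2) (T₂ := n * 8 + 3) (Q₁ := fun s' => s'.reg .cnt = 0 ∧ s'.reg .st = 0)
    (Does.straight rfl le_rfl (by simp)) ?_ (by omega)
  rintro s₂ ha₂ hz
  have hG₂ := hG₁.agree ha₂
  classical
  let P : ℕ → Prop := fun p => reachCount n (Rch m src dst) v < reachCount n (Rch m src dst) p ∨
    (reachCount n (Rch m src dst) p = reachCount n (Rch m src dst) v ∧
      ∀ q ≤ p, reachCount n (Rch m src dst) q = reachCount n (Rch m src dst) v →
        ¬ Rch m src dst v q)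
  refine Does.seq (T₁ := n * 8 + 2) (T₂ := 1)
    (Does.loop_const (fun j s' => s'.reg .cnt = ((Finset.range j).filter P).card ∧
      (s'.reg .st = 0 ↔ ∀ q < j, reachCount n (Rch m src dst) q = reachCount n (Rch m src dst) v →
        ¬ Rch m src dst v q)) 0 n 6
    (by simp) (by omega) hG.n_lt (by simp [hz])
    (fun s' h => eval_of_agree h hG₂.reg_n rfl) rfl ?_ (by simp)) ?_ (by omega)
  · rintro q s' - hq hqr ha ⟨hc, hst⟩
    refine Does.straight rfl (by decide) ?_
    have hmark : s'.mem .mark q = 1 ↔ Rch m src dst v q := by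
      rw [ha.2 .mark rfl, ha₂.2 .mark rfl, hR q hq]
    have hsz : ∀ p < n, s'.mem .size p = reachCount n (Rch m src dst) p := by
      intro p hp
      rw [ha.2 .size rfl, ha₂.2 .size rfl, ha₁.2 .size rfl, ha₀.2 .size rfl, hsize p hp]
    have hv' : s'.reg .v = v := by
      rw [ha.1 .v rfl, ha₂.1 .v rfl, ha₁.1 .v rfl, hvr]
    have hlt : s'.reg .cnt + 1 < 2 ^ w := by
      have := card_filter_range_le P q
      have := hG.n_lt
      omega
    rw [hc] at hlt
    have hle : (∀ p < q + 1, reachCount n (Rch m src dst) p = reachCount n (Rch m src dst) v →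
        ¬ Rch m src dst v p) ↔ (∀ p < q, reachCount n (Rch m src dst) p =
          reachCount n (Rch m src dst) v → ¬ Rch m src dst v p) ∧
        (reachCount n (Rch m src dst) q = reachCount n (Rch m src dst) v →
          ¬ Rch m src dst v q) := by
      simp only [Nat.lt_succ_iff_lt_or_eq, or_imp, forall_and, forall_eq]
    rw [card_filter_range_succ, hle]
    rcases lt_trichotomy (reachCount n (Rch m src dst) v) (reachCount n (Rch m src dst) q)
      with h | h | h
    · have hP : P q := .inl h
      simp [hqr, hv', hsz v hv, hsz q hq, h, hc, Nat.mod_eq_of_lt hlt, hP, hst, h.ne']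
    · have hP : P q ↔ (∀ p < q, reachCount n (Rch m src dst) p =
          reachCount n (Rch m src dst) v → ¬ Rch m src dst v p) ∧
        (reachCount n (Rch m src dst) q = reachCount n (Rch m src dst) v →
          ¬ Rch m src dst v q) := by
        rw [← hle]
        simp only [P, h, lt_irrefl, false_or, true_and, Nat.lt_succ_iff]
      by_cases hr : Rch m src dst v q
      · have hP' : ¬ P q := fun h' => (hP.1 h').2 h.symm hr
        simp [hqr, hv', hsz v hv, hsz q hq, h, hc, hP', hr, h1, hmark]
      · by_cases h0 : s'.reg .st = 0
        · have hP' : P q := hP.2 ⟨hst.1 h0, fun _ => hr⟩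
          have := hst.1 h0
          rw [h] at this
          simp [hqr, hv', hsz v hv, hsz q hq, h, hc, hP', hr, h1, hmark, h0, Nat.mod_eq_of_lt hlt]
          exact this
        · have hP' : ¬ P q := fun h' => h0 (hst.2 (hP.1 h').1)
          have := mt hst.2 h0
          rw [h] at this
          simp [hqr, hv', hsz v hv, hsz q hq, h, hc, hP', hr, h1, hmark, h0]
          simpa using this
    · have hP : ¬ P q := by simp [P, h.le, h.ne]
      simp [hqr, hv', hsz v hv, hsz q hq, h.le, not_lt.2 h.le, h.ne, hc, hP, hst]
  · rintro s₃ ha₃ ⟨⟨hc, -⟩, -⟩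
    refine Does.straight rfl le_rfl fun p hp => ?_
    have hv₃ : s₃.reg .v = v := by rw [ha₃.1 .v rfl, ha₂.1 .v rfl, ha₁.1 .v rfl, hvr]
    have e1 : s₃.mem .ids = s₀.mem .ids := by rw [ha₃.2 .ids rfl, ha₂.2 .ids rfl, ha₁.2 .ids rfl]
    by_cases hpv : p = v
    · subst hpv
      simp only [Cmd.denote, Exp.eval, hv₃, hc, St.setReg_mem, St.setMem_mem, if_true,
        Function.update_self]
      rfl
    · simpa [hv₃, hpv, e1] using hI p (by omega)

open Classical in
theorem trim_does {w n m q₀ : ℕ} {src dst : ℕ → ℕ} {s : St Var Mem} (hG : Graph w n m src dst s)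
    (hq₀ : s.reg .q0 = q₀) (hq : q₀ < n) :
    Does w trim s (n * (4 * m + 12) + 8) fun s' => ∀ v < n,
      s'.mem .ids v = if Rch m src dst q₀ v ∧ s.mem .co v = 1 then s.mem .ids v else n := by
  have h1 : 1 % 2 ^ w = 1 := Nat.mod_eq_of_lt hG.one_lt
  refine Does.seq (T₁ := 1) (T₂ := n * (4 * m + 12) + 7) (Q₁ := fun s' => s'.reg .v = q₀)
    (Does.straight rfl le_rfl
      (by simp [hq₀, Nat.mod_eq_of_lt (hq.trans hG.n_lt)])) ?_ (by omega)
  intro s₁ ha₁ hv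
  have hG₁ := hG.agree ha₁
  refine Does.seq (T₂ := n * 5 + 2) (reach_does hG₁ hv hq) ?_ (by nlinarith)
  intro s₂ ha₂ hR
  have hG₂ := hG₁.agree ha₂
  have hi₂ : s₂.mem .ids = s.mem .ids := by rw [ha₂.2 .ids rfl, ha₁.2 .ids rfl]
  refine (Does.loop_const (fun j s' =>
      (∀ v < j, s'.mem .ids v = if Rch m src dst q₀ v ∧ s.mem .co v = 1 then s.mem .ids v else n) ∧
      ∀ v ≥ j, s'.mem .ids v = s.mem .ids v) 0 n 3
    (by simp) (by omega) hG.n_lt (by simp [hi₂])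
    (fun s' h => eval_of_agree h hG₂.reg_n rfl) rfl ?_ (by simp)).mono le_rfl fun s' _ h => h.1.1
  rintro q s' - hqn hqr ha ⟨hlt, hge⟩
  refine Does.straight rfl le_rfl ?_
  have hmark : s'.mem .mark q = 1 ↔ Rch m src dst q₀ q := by rw [ha.2 .mark rfl, hR q hqn]
  have hco : s'.mem .co = s.mem .co := by rw [ha.2 .co rfl, ha₂.2 .co rfl, ha₁.2 .co rfl]
  have hn : s'.reg .n = n := (hG₂.agree ha).reg_n
  simp only [Cmd.denote, Cond.holds, Exp.eval, hqr, h1, hmark, hco, hn]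
  refine ⟨fun v hv => ?_, fun v hv => ?_⟩
  · by_cases hvq : v = q
    · subst hvq
      by_cases h : Rch m src dst q₀ v <;> by_cases h' : s.mem .co v = 1 <;>
        simp [h, h', hge v le_rfl]
    · have := hlt v (by omega)
      split_ifs <;> simp_all
  · have hvq : v ≠ q := by omega
    have := hge v (by omega)
    split_ifs <;> simp_all

end ESU

namespace ESU

open WordRAM

/-- The transitions between the components: `Edge i a j` holds if some transition with the label `a`
leads from the component `i` to the component `j`. -/
def Edge (n m : ℕ) (src lab dst ids : ℕ → ℕ) (i a j : ℕ) : Prop :=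
  j < n ∧ ∃ e < m, ids (src e) = i ∧ lab e = a ∧ ids (dst e) = j

/-- The transitions that leave the component `i` are stored in the cells from `off i` to
`off (i + 1) - 1` of the arrays `sl` (labels) and `sv` (targets). -/
structure Grouped (n m : ℕ) (E : ℕ → ℕ → ℕ → Prop) (off sl sv : ℕ → ℕ) : Prop where
  mono : ∀ i < n, off i ≤ off (i + 1)
  zero : off 0 = 0
  le : off n ≤ m
  mem : ∀ i < n, ∀ a j, (∃ x, off i ≤ x ∧ x < off (i + 1) ∧ sl x = a ∧ sv x = j) ↔ E i a j

theorem Grouped.exists_component {n m : ℕ} {E : ℕ → ℕ → ℕ → Prop} {off sl sv : ℕ → ℕ}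
    (h : Grouped n m E off sl sv) {x : ℕ} (hx : x < off n) :
    ∃ i < n, off i ≤ x ∧ x < off (i + 1) := by
  have : ∀ k ≤ n, x < off k → ∃ i < n, off i ≤ x ∧ x < off (i + 1) := by
    intro k
    induction k with
    | zero => intro _ h'; rw [h.zero] at h'; omega
    | succ k ih =>
      intro hk h'
      by_cases hxk : x < off k
      · exact ih (by omega) hxk
      · exact ⟨k, hk, by omega, h'⟩
  exact this n le_rfl hx

theorem Grouped.off_le {n m : ℕ} {E : ℕ → ℕ → ℕ → Prop} {off sl sv : ℕ → ℕ}
    (h : Grouped n m E off sl sv) {i j : ℕ} (hij : i ≤ j) (hj : j ≤ n) : off i ≤ off j := by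
  induction j, hij using Nat.le_induction with
  | base => exact le_rfl
  | succ j hij ih => exact (ih (by omega)).trans (h.mono j (by omega))

theorem Grouped.exists_label {n m : ℕ} {E : ℕ → ℕ → ℕ → Prop} {off sl sv : ℕ → ℕ}
    (h : Grouped n m E off sl sv) (a : ℕ) :
    (∃ x < off n, sl x = a) ↔ ∃ i < n, ∃ j, E i a j := by
  constructor
  · rintro ⟨x, hx, rfl⟩
    obtain ⟨i, hi, h1, h2⟩ := h.exists_component hx
    exact ⟨i, hi, sv x, (h.mem i hi _ _).1 ⟨x, h1, h2, rfl, rfl⟩⟩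
  · rintro ⟨i, hi, j, hE⟩
    obtain ⟨x, -, hx, ha, -⟩ := (h.mem i hi a j).2 hE
    exact ⟨x, hx.trans_le (h.off_le hi le_rfl), ha⟩

/-- The number of the first `k` transitions that leave the component `i` and are useful. -/
def outCount (n : ℕ) (src dst ids : ℕ → ℕ) (i k : ℕ) : ℕ :=
  ((Finset.range k).filter fun e => ids (src e) = i ∧ ids (dst e) < n).card

def offset (n m : ℕ) (src dst ids : ℕ → ℕ) (i : ℕ) : ℕ :=
  ((Finset.range m).filter fun e => ids (src e) < i ∧ ids (dst e) < n).card

theorem offset_succ (n m : ℕ) (src dst ids : ℕ → ℕ) (i : ℕ) :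
    offset n m src dst ids (i + 1) = offset n m src dst ids i + outCount n src dst ids i m := by
  simp only [offset, outCount, Finset.card_filter, ← Finset.sum_add_distrib]
  refine Finset.sum_congr rfl fun e _ => ?_
  split_ifs <;> omega

theorem group_does {w n m : ℕ} {src dst lab ids : ℕ → ℕ} {s : St Var Mem}
    (hG : Graph w n m src dst s) (hlab : s.mem .lab = lab) (hids : s.mem .ids = ids) :
    Does w group s (n * (m * 7 + 5) + 4) fun s' =>
      Grouped n m (Edge n m src lab dst ids) (s'.mem .off) (s'.mem .sl) (s'.mem .sv) ∧
      s'.reg .g = s'.mem .off n := by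
  have h1 : 1 % 2 ^ w = 1 := Nat.mod_eq_of_lt hG.one_lt
  set O := offset n m src dst ids with hO
  set K := outCount n src dst ids with hK
  have hOm : ∀ i, O i ≤ m := fun i => card_filter_range_le _ m
  have hOs : ∀ i, O (i + 1) = O i + K i m := offset_succ n m src dst ids
  have hKs : ∀ i j, K i (j + 1) = K i j + if ids (src j) = i ∧ ids (dst j) < n then 1 else 0 :=
    fun i j => card_filter_range_succ _ j
  have hKm : ∀ i, Monotone (K i) := fun i j k hjk =>
    Finset.card_le_card (Finset.filter_subset_filter _ (Finset.range_mono hjk))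
  have hO0 : O 0 = 0 := by simp [hO, offset]
  refine Does.seq (T₁ := 1) (T₂ := n * (m * 7 + 5) + 3) (Q₁ := fun s' => s'.reg .g = 0)
    (Does.straight rfl le_rfl (by simp)) ?_ (by omega)
  intro s₁ ha₁ hg₁
  have hG₁ := hG.agree ha₁
  refine Does.seq (T₁ := n * (m * 7 + 5) + 2) (T₂ := 1)
    (Does.loop_const (fun i s' => s'.reg .g = O i ∧ (∀ k < i, s'.mem .off k = O k) ∧
      ∀ k < i, ∀ a j, (∃ x, O k ≤ x ∧ x < O (k + 1) ∧ s'.mem .sl x = a ∧ s'.mem .sv x = j) ↔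
        Edge n m src lab dst ids k a j) 0 n (m * 7 + 3) (by simp) (by omega) hG.n_lt
      (by simp [hg₁, hO0]) (fun s' h => eval_of_agree h hG₁.reg_n rfl) rfl ?_ (by simp)) ?_
    (by omega)
  · rintro i s₂ - hi hir ha₂ ⟨hg₂, hoff, hmem⟩
    have hG₂ := hG₁.agree ha₂
    refine Does.seq (T₁ := 1) (T₂ := m * 7 + 2)
      (Q₁ := fun s' => ∀ k ≤ i, s'.mem .off k = O k) (Does.straight rfl le_rfl ?_) ?_ (by omega)
    · intro k hk
      by_cases hki : k = i
      · simp [hki, hir, hg₂]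
      · simp [hki, hir, hoff k (by omega)]
    intro s₃ ha₃ hoff₃
    have hG₃ := hG₂.agree ha₃
    have hg₃ : s₃.reg .g = O i := by rw [ha₃.1 .g rfl, hg₂]
    have hir₃ : s₃.reg .i = i := by rw [ha₃.1 .i rfl, hir]
    have hlab₃ : s₃.mem .lab = lab := by
      rw [ha₃.2 .lab rfl, ha₂.2 .lab rfl, ha₁.2 .lab rfl, hlab]
    have hids₃ : s₃.mem .ids = ids := by
      rw [ha₃.2 .ids rfl, ha₂.2 .ids rfl, ha₁.2 .ids rfl, hids]
    refine (Does.loop_const (fun j s' => s'.reg .g = O i + K i j ∧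
        (∀ x < O i, s'.mem .sl x = s₃.mem .sl x ∧ s'.mem .sv x = s₃.mem .sv x) ∧
        ∀ a b, (∃ x, O i ≤ x ∧ x < O i + K i j ∧ s'.mem .sl x = a ∧ s'.mem .sv x = b) ↔
          b < n ∧ ∃ e < j, ids (src e) = i ∧ lab e = a ∧ ids (dst e) = b) 0 m 5 (by simp)
        (by omega) hG.m_lt ?_ (fun s' h => eval_of_agree h hG₃.reg_m rfl) rfl ?_ (by simp)).mono
        le_rfl ?_
    · simp only [St.setReg_mem]
      refine ⟨by simp [hg₃, hK, outCount], fun _ _ => by simp, fun a b => ?_⟩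
      have : K i 0 = 0 := by simp [hK, outCount]
      simp only [this, add_zero, Nat.not_lt_zero, false_and, exists_false, and_false, iff_false,
        not_exists]
      intro x; omega
    · rintro e s' - he her ha ⟨hg, hold, hnew⟩
      refine Does.straight rfl (by decide) ?_
      have hG' := hG₃.agree ha
      have hlab' : s'.mem .lab = lab := by rw [ha.2 .lab rfl, hlab₃]
      have hids' : s'.mem .ids = ids := by rw [ha.2 .ids rfl, hids₃]
      have hi' : s'.reg .i = i := by rw [ha.1 .i rfl, hir₃]
      have hstep : ¬ (ids (src e) = i ∧ ids (dst e) < n) →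
          (s'.reg .g = O i + K i (e + 1) ∧
          (∀ x < O i, s'.mem .sl x = s₃.mem .sl x ∧ s'.mem .sv x = s₃.mem .sv x) ∧
          ∀ a b, (∃ x, O i ≤ x ∧ x < O i + K i (e + 1) ∧ s'.mem .sl x = a ∧ s'.mem .sv x = b) ↔
            b < n ∧ ∃ e' < e + 1, ids (src e') = i ∧ lab e' = a ∧ ids (dst e') = b) := by
        intro hne
        rw [hKs, if_neg hne, add_zero]
        refine ⟨hg, hold, fun a b => (hnew a b).trans (and_congr_right fun hb =>
          ⟨fun ⟨e', h, h'⟩ => ⟨e', by omega, h'⟩, fun ⟨e', h, h'⟩ => ⟨e', ?_, h'⟩⟩)⟩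
        rcases Nat.lt_succ_iff_lt_or_eq.1 h with h | rfl
        · exact h
        · exact absurd ⟨h'.1, h'.2.2 ▸ hb⟩ hne
      simp only [Cmd.denote, Cond.holds, Exp.eval, her, hids', hG'.mem_src, hG'.mem_dst, hi',
        hG'.reg_n]
      by_cases hc1 : ids (src e) = i
      · by_cases hc2 : ids (dst e) < n
        · clear hstep
          have hK1 : K i (e + 1) = K i e + 1 := by rw [hKs, if_pos ⟨hc1, hc2⟩]
          have hlt : O i + K i e + 1 < 2 ^ w := by
            have h2 := hKm i (show e + 1 ≤ m from he)
            have h3 := hOs i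
            have h4 := hOm (i + 1)
            have := hG.m_lt
            omega
          have hlt' : O i + K i e < 2 ^ w := by omega
          rw [hK1]
          simp only [hc1, hc2, if_true, St.setReg_mem, St.setMem_mem, St.setMem_reg, reduceCtorEq,
            if_false, St.setReg_reg, hg, her, hlab', hids', hG'.mem_src, hG'.mem_dst, BinOp.eval,
            h1, Nat.mod_eq_of_lt hlt, Function.update_apply]
          refine ⟨by omega, fun x hx => ?_, fun a b => ?_⟩
          · rw [if_neg (by omega), if_neg (by omega)]; exact hold x hx
          · constructor
            · rintro ⟨x, hx1, hx2, hx3, hx4⟩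
              by_cases hx : x = O i + K i e
              · rw [if_pos hx] at hx3 hx4
                exact ⟨hx4 ▸ hc2, e, by omega, hc1, hx3, hx4⟩
              · rw [if_neg hx] at hx3 hx4
                obtain ⟨hb, e', he', h⟩ := (hnew a b).1 ⟨x, hx1, by omega, hx3, hx4⟩
                exact ⟨hb, e', by omega, h⟩
            · rintro ⟨hb, e', he', h⟩
              rcases Nat.lt_succ_iff_lt_or_eq.1 he' with h2 | rfl
              · obtain ⟨x, hx1, hx2, hx3⟩ := (hnew a b).2 ⟨hb, e', h2, h⟩
                refine ⟨x, hx1, by omega, ?_⟩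
                rw [if_neg (by omega), if_neg (by omega)]; exact hx3
              · exact ⟨O i + K i e', by omega, by omega, by simpa using h.2⟩
        · simpa [hc1, hc2] using hstep (by tauto)
      · simpa [hc1] using hstep (by tauto)
    · rintro s' ha' ⟨⟨hg, hold, hnew⟩, -⟩
      rw [← hOs] at hg
      simp only [← hOs] at hnew
      simp only [St.setReg_mem, St.setReg_reg, reduceCtorEq, if_false]
      have hO' : ∀ k ≤ i, O k ≤ O i := by
        intro k hk
        exact Finset.card_le_card fun e he => by
          simp only [Finset.mem_filter] at he ⊢
          exact ⟨he.1, by omega, he.2.2⟩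
      refine ⟨hg, fun k hk => ?_, fun k hk a b => ?_⟩
      · rw [ha'.2 .off rfl]; exact hoff₃ k (by omega)
      · rcases Nat.lt_succ_iff_lt_or_eq.1 hk with hk | rfl
        · rw [← hmem k hk, ← ha₃.2 .sl rfl, ← ha₃.2 .sv rfl]
          refine exists_congr fun x => and_congr_right fun _ => and_congr_right fun hx => ?_
          have := hold x (hx.trans_le (hO' (k + 1) hk))
          rw [this.1, this.2]
        · exact hnew a b
  · rintro s₂ ha₂ ⟨⟨hg, hoff, hmem⟩, -⟩
    have hn₂ : s₂.reg .n = n := (hG₁.agree ha₂).reg_n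
    have hoff' : ∀ i ≤ n, (if i = n then O n else s₂.mem .off i) = O i := by
      intro i hi
      split_ifs with h
      · rw [h]
      · exact hoff i (by omega)
    refine Does.straight rfl le_rfl ?_
    simp only [Cmd.denote, Exp.eval, St.setMem_mem, St.setMem_reg, reduceCtorEq, if_false, if_true,
      hn₂, hg, Function.update_self]
    refine ⟨⟨fun i hi => ?_, ?_, ?_, fun i hi a j => ?_⟩, trivial⟩ <;>
      simp only [Function.update_apply]
    · rw [hoff' i hi.le, hoff' (i + 1) hi, hOs]; omega
    · rw [hoff' 0 (by omega), hO0]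
    · simpa using hOm n
    · rw [hoff' i hi.le, hoff' (i + 1) hi]; exact hmem i hi a j

theorem needed_does {w n m sg : ℕ} {E : ℕ → ℕ → ℕ → Prop} {s : St Var Mem} (hw : 1 < 2 ^ w)
    (hgr : Grouped n m E (s.mem .off) (s.mem .sl) (s.mem .sv)) (hg : s.reg .g = s.mem .off n)
    (hsg : s.reg .sg = sg) (hsgw : sg < 2 ^ w) (hmw : m < 2 ^ w) :
    Does w needed s (sg * 3 + m * 3 + 5) fun s' => ∀ a ≤ sg,
      (s'.mem .need a = 1 ↔ a ≠ 0 ∧ ∃ i < n, ∃ j, E i a j) := by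
  have h1 : 1 % 2 ^ w = 1 := Nat.mod_eq_of_lt hw
  have hle := hgr.le
  refine Does.seq (T₁ := sg * 3 + 2) (T₂ := m * 3 + 3)
    (Does.loop_const (fun j s' => ∀ a ≤ j, a ≠ 0 → s'.mem .need a = 0) 0 sg 1 (by simp) (by omega)
      hsgw (by simp +contextual) (fun s' h => eval_of_agree h hsg rfl) rfl ?_ (by simp)) ?_
    (by omega)
  · rintro j s' - hj hjr - hI
    refine Does.straight rfl le_rfl fun a ha h0 => ?_
    have hlt : j + 1 < 2 ^ w := by omega
    by_cases haj : a = j + 1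
    · simp [haj, hjr, Nat.mod_eq_of_lt hlt]
    · simp [haj, hjr, Nat.mod_eq_of_lt hlt, hI a (by omega) h0]
  rintro s₁ ha₁ ⟨hI₁, -⟩
  have hsl : s₁.mem .sl = s.mem .sl := ha₁.2 .sl rfl
  refine Does.seq (T₁ := m * 3 + 2) (T₂ := 1)
    (Does.loop_const (fun j s' => ∀ a ≤ sg, a ≠ 0 →
      (s'.mem .need a = 1 ↔ ∃ x < j, s.mem .sl x = a)) 0 (s.mem .off n) 1 (by simp) (by omega)
      (by omega) ?_ (fun s' h => eval_of_agree h ((ha₁.1 .g rfl).trans hg) rfl) rfl ?_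
      (by rw [Nat.sub_zero]; nlinarith)) ?_ (by omega)
  · intro a ha h0
    simp [hI₁ a ha h0]
  · rintro j s' - hj hjr ha' hI
    refine Does.straight rfl le_rfl fun a ha h0 => ?_
    have hsl' : s'.mem .sl = s.mem .sl := (ha'.2 .sl rfl).trans hsl
    simp only [Nat.lt_succ_iff_lt_or_eq, or_and_right, exists_or, exists_eq_left, ← hI a ha h0]
    by_cases haj : a = s.mem .sl j
    · simp [haj, hjr, hsl', h1]
    · simp [haj, hjr, hsl', h1, Ne.symm haj]
  · rintro s₂ ha₂ ⟨hI, -⟩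
    refine Does.straight rfl le_rfl fun a ha => ?_
    by_cases h0 : a = 0
    · simp [h0]
    · simpa [h0, hgr.exists_label] using hI a ha h0

end ESU

/-! ### Matchings by an auction -/

namespace ESU

/-- The state of an auction in which the crossings `u` with `s ≤ u < d` bid for letters. The
crossing `u` has the level `lv u`, and it looks at the cells from `lo u` to `hi u - 1`, the next
one being `ptr u`; the cell `x` contains the letter `sl x`, in which `u` is interested if `W u x`.
The letter `b` has the price `price b` and belongs to the crossing `own b` (or `n`, if to none).
The crossings `≥ t` have not yet started, and `cur` is the one to bid (or `n`, if there is none). -/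
structure Auction (n sg s d : ℕ) (lo hi sl : ℕ → ℕ) (W : ℕ → ℕ → Prop)
    (lv ptr price own : ℕ → ℕ) (t cur : ℕ) : Prop where
  ptr_mem : ∀ u, s ≤ u → u < d → lo u ≤ ptr u ∧ ptr u ≤ hi u
  lv_le : ∀ u, s ≤ u → u < d → lv u ≤ n
  lt_price : ∀ u, s ≤ u → u < d → ∀ x, lo u ≤ x → x < ptr u → W u x → lv u < price (sl x)
  le_price : ∀ u, s ≤ u → u < d → ∀ x, lo u ≤ x → x < hi u → W u x → lv u ≤ price (sl x)
  own_cases : ∀ b, 1 ≤ b → b ≤ sg → own b = n ∧ price b = 0 ∨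
    s ≤ own b ∧ own b < d ∧ own b < t ∧ price b = lv (own b) + 1 ∧
      ∃ x, lo (own b) ≤ x ∧ x < hi (own b) ∧ W (own b) x ∧ sl x = b
  own_inj : ∀ b b', 1 ≤ b → b ≤ sg → 1 ≤ b' → b' ≤ sg → own b < n → own b = own b' → b = b'
  started : ∀ u, s ≤ u → u < d → u < t →
    (∃ b, 1 ≤ b ∧ b ≤ sg ∧ own b = u) ∨ lv u = n ∨ u = cur
  fresh : ∀ u, s ≤ u → u < d → t ≤ u → lv u = 0
  cur_cases : cur = n ∨ s ≤ cur ∧ cur < d ∧ cur < t ∧ lv cur < n ∧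
    ∀ b, 1 ≤ b → b ≤ sg → own b ≠ cur

/-- A bound for the number of remaining steps of an auction. -/
def auctionPotential (n sg s d : ℕ) (lo hi lv ptr price : ℕ → ℕ) : ℕ :=
  ∑ u ∈ Finset.Ico s d, ((n - lv u) * (hi u - lo u + 1) + (hi u - ptr u)) +
    ∑ b ∈ Finset.Ico 1 (sg + 1), (n - price b)

section

variable {n sg s d : ℕ} {lo hi sl : ℕ → ℕ} {W : ℕ → ℕ → Prop} {lv ptr price own : ℕ → ℕ}
  {t cur : ℕ}

theorem sum_update_lt {I : Finset ℕ} {f g : ℕ → ℕ} {i : ℕ} (hi : i ∈ I)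
    (hne : ∀ j ∈ I, j ≠ i → g j = f j) (hlt : g i < f i) : ∑ j ∈ I, g j < ∑ j ∈ I, f j := by
  refine Finset.sum_lt_sum (fun j hj => ?_) ⟨i, hi, hlt⟩
  by_cases h : j = i
  · exact h ▸ hlt.le
  · exact (hne j hj h).le

theorem Auction.start_crossing (h : Auction n sg s d lo hi sl W lv ptr price own t n) (hn : d < n)
    (hs : s ≤ t) (ht : t < d) :
    Auction n sg s d lo hi sl W lv ptr price own (t + 1) t where
  __ := h
  own_cases b h1 h2 := (h.own_cases b h1 h2).imp_right fun ⟨h1, h2, h3, h4⟩ =>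
    ⟨h1, h2, by omega, h4⟩
  started u h1 h2 h3 := by
    by_cases hu : u = t
    · exact .inr (.inr hu)
    · exact (h.started u h1 h2 (by omega)).imp_right fun h => .inl (h.resolve_right (by omega))
  fresh u h1 h2 h3 := h.fresh u h1 h2 (by omega)
  cur_cases := .inr ⟨hs, ht, by omega, by rw [h.fresh t hs ht le_rfl]; omega, fun b h1 h2 => by
    rcases h.own_cases b h1 h2 with h | h <;> omega⟩

theorem Auction.finish (h : Auction n sg s d lo hi sl W lv ptr price own t n) (ht : t = d) :
    Auction n sg s d lo hi sl W lv ptr price own (t + 1) n where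
  __ := h
  own_cases b h1 h2 := (h.own_cases b h1 h2).imp_right fun ⟨h1, h2, h3, h4⟩ =>
    ⟨h1, h2, by omega, h4⟩
  started u h1 h2 h3 := h.started u h1 h2 (by omega)
  fresh u h1 h2 h3 := h.fresh u h1 h2 (by omega)
  cur_cases := .inl rfl

theorem Auction.next (h : Auction n sg s d lo hi sl W lv ptr price own t cur)
    (hc : cur < n) (hx : ptr cur < hi cur)
    (hW : W cur (ptr cur) → lv cur < price (sl (ptr cur))) :
    Auction n sg s d lo hi sl W lv (Function.update ptr cur (ptr cur + 1)) price own t cur ∧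
    auctionPotential n sg s d lo hi lv (Function.update ptr cur (ptr cur + 1)) price <
      auctionPotential n sg s d lo hi lv ptr price := by
  obtain ⟨hcs, hcd, -⟩ := h.cur_cases.resolve_left hc.ne
  have hp := h.ptr_mem cur hcs hcd
  refine ⟨{ h with ptr_mem := fun u h1 h2 => ?_, lt_price := fun u h1 h2 x hx1 hx2 hw => ?_ }, ?_⟩
  · rw [Function.update_apply]
    split_ifs with hu
    · rw [hu]; omega
    · exact h.ptr_mem u h1 h2
  · rw [Function.update_apply] at hx2
    split_ifs at hx2 with hu
    · subst hu
      by_cases hxp : x = ptr u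
      · rw [hxp] at hw ⊢; exact hW hw
      · exact h.lt_price u h1 h2 x hx1 (by omega) hw
    · exact h.lt_price u h1 h2 x hx1 hx2 hw
  · refine Nat.add_lt_add_right (sum_update_lt (Finset.mem_Ico.2 ⟨hcs, hcd⟩) (fun j _ hj => ?_) ?_) _
    · rw [Function.update_of_ne hj]
    · rw [Function.update_self]; omega

theorem Auction.level (h : Auction n sg s d lo hi sl W lv ptr price own t cur)
    (hc : cur < n) (hx : ¬ ptr cur < hi cur) :
    Auction n sg s d lo hi sl W (Function.update lv cur (lv cur + 1))
      (Function.update ptr cur (lo cur)) price own t (if lv cur + 1 < n then cur else n) ∧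
    auctionPotential n sg s d lo hi (Function.update lv cur (lv cur + 1))
      (Function.update ptr cur (lo cur)) price < auctionPotential n sg s d lo hi lv ptr price := by
  obtain ⟨hcs, hcd, hct, hlv, hown⟩ := h.cur_cases.resolve_left hc.ne
  have hp := h.ptr_mem cur hcs hcd
  refine ⟨⟨fun u h1 h2 => ?_, fun u h1 h2 => ?_, fun u h1 h2 x hx1 hx2 hw => ?_,
    fun u h1 h2 x hx1 hx2 hw => ?_, fun b h1 h2 => ?_, h.own_inj, fun u h1 h2 h3 => ?_,
    fun u h1 h2 h3 => ?_, ?_⟩, ?_⟩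
  · rw [Function.update_apply]
    split_ifs with hu
    · rw [hu]; omega
    · exact h.ptr_mem u h1 h2
  · rw [Function.update_apply]
    split_ifs with hu
    · omega
    · exact h.lv_le u h1 h2
  · rw [Function.update_apply] at hx2 ⊢
    split_ifs at hx2 ⊢ with hu
    · subst hu; omega
    · exact h.lt_price u h1 h2 x hx1 hx2 hw
  · rw [Function.update_apply]
    split_ifs with hu
    · subst hu
      exact h.lt_price u h1 h2 x hx1 (by omega) hw
    · exact h.le_price u h1 h2 x hx1 hx2 hw
  · rw [Function.update_of_ne (hown b h1 h2)]
    exact h.own_cases b h1 h2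
  · rw [Function.update_apply]
    rcases h.started u h1 h2 h3 with h' | h' | h'
    · exact .inl h'
    · rw [if_neg (by rintro rfl; omega)]; exact .inr (.inl h')
    · rw [if_pos h']
      split_ifs
      · exact .inr (.inr h')
      · exact .inr (.inl (by omega))
  · rw [Function.update_of_ne (by omega)]; exact h.fresh u h1 h2 h3
  · split_ifs with h'
    · exact .inr ⟨hcs, hcd, hct, by simpa using h', hown⟩
    · exact .inl rfl
  · refine Nat.add_lt_add_right (sum_update_lt (Finset.mem_Ico.2 ⟨hcs, hcd⟩) (fun j _ hj => ?_) ?_) _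
    · rw [Function.update_of_ne hj, Function.update_of_ne hj]
    · rw [Function.update_self, Function.update_self]
      have : n - lv cur = (n - (lv cur + 1)) + 1 := by omega
      rw [this, Nat.add_mul]
      omega

theorem Auction.take (h : Auction n sg s d lo hi sl W lv ptr price own t cur) (hn : d < n)
    (hc : cur < n) (hx : ptr cur < hi cur) (hW : W cur (ptr cur))
    (hp : price (sl (ptr cur)) ≤ lv cur) (hb1 : 1 ≤ sl (ptr cur)) (hb2 : sl (ptr cur) ≤ sg) :
    Auction n sg s d lo hi sl W lv ptr (Function.update price (sl (ptr cur)) (lv cur + 1))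
      (Function.update own (sl (ptr cur)) cur) t (own (sl (ptr cur))) ∧
    auctionPotential n sg s d lo hi lv ptr (Function.update price (sl (ptr cur)) (lv cur + 1)) <
      auctionPotential n sg s d lo hi lv ptr price := by
  obtain ⟨hcs, hcd, hct, hlv, hown⟩ := h.cur_cases.resolve_left hc.ne
  have hptr := h.ptr_mem cur hcs hcd
  set b₀ := sl (ptr cur) with hb₀
  have hle : ∀ b, price b ≤ Function.update price b₀ (lv cur + 1) b := by
    intro b
    rw [Function.update_apply]
    split_ifs with hb
    · rw [hb]; omega
    · exact le_rfl
  refine ⟨⟨h.ptr_mem, h.lv_le, fun u h1 h2 x hx1 hx2 hw => ?_, fun u h1 h2 x hx1 hx2 hw => ?_,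
    fun b h1 h2 => ?_, fun b b' h1 h2 h3 h4 h5 h6 => ?_, fun u h1 h2 h3 => ?_, h.fresh, ?_⟩, ?_⟩
  · exact (h.lt_price u h1 h2 x hx1 hx2 hw).trans_le (hle _)
  · exact (h.le_price u h1 h2 x hx1 hx2 hw).trans (hle _)
  · rw [Function.update_apply, Function.update_apply]
    split_ifs with hb
    · exact .inr ⟨hcs, hcd, hct, rfl, ptr cur, hptr.1, hx, hW, hb.symm⟩
    · exact h.own_cases b h1 h2
  · rw [Function.update_apply] at h5
    rw [Function.update_apply, Function.update_apply] at h6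
    split_ifs at h5 h6 with hb hb' hb'
    · rw [hb, hb']
    · exact absurd h6.symm (hown b' h3 h4)
    · exact absurd h6 (hown b h1 h2)
    · exact h.own_inj b b' h1 h2 h3 h4 h5 h6
  · rcases h.started u h1 h2 h3 with ⟨b, h4, h5, h6⟩ | h' | h'
    · by_cases hb : b = b₀
      · exact .inr (.inr (by rw [← hb, h6]))
      · exact .inl ⟨b, h4, h5, by rw [Function.update_of_ne hb, h6]⟩
    · exact .inr (.inl h')
    · exact .inl ⟨b₀, hb1, hb2, by rw [Function.update_self, h']⟩
  · rcases h.own_cases b₀ hb1 hb2 with h' | ⟨h1, h2, h3, h4, -⟩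
    · exact .inl h'.1
    · refine .inr ⟨h1, h2, h3, by omega, fun b h5 h6 => ?_⟩
      rw [Function.update_apply]
      split_ifs with hb
      · exact fun h' => hown b₀ hb1 hb2 h'.symm
      · exact fun h' => hb (h.own_inj b b₀ h5 h6 hb1 hb2 (by omega) h')
  · refine Nat.add_lt_add_left (sum_update_lt (Finset.mem_Ico.2 ⟨hb1, by omega⟩)
      (fun j _ hj => ?_) ?_) _
    · rw [Function.update_of_ne hj]
    · rw [Function.update_self]; omega

/-- When the auction is over, all letters are sold if and only if they can be matched to the
crossings. -/
theorem Auction.sold_iff (h : Auction n sg s d lo hi sl W lv ptr price own (d + 1) n) (hn : d < n)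
    {B : ℕ → Prop} {A : ℕ → ℕ → Prop} (hB : ∀ b, B b → 1 ≤ b ∧ b ≤ sg)
    (hA : ∀ u b, s ≤ u → u < d →
      ((∃ x, lo u ≤ x ∧ x < hi u ∧ W u x ∧ sl x = b) ↔ B b ∧ A u b)) :
    (∀ b, B b → price b ≠ 0) ↔
      ∃ f : ℕ → ℕ, Set.InjOn f {b | B b} ∧ ∀ b, B b → s ≤ f b ∧ f b < d ∧ A (f b) b := by
  classical
  constructor
  · intro hp
    have hown : ∀ b, B b → s ≤ own b ∧ own b < d ∧ A (own b) b := by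
      intro b hb
      have hb' := hB b hb
      rcases h.own_cases b hb'.1 hb'.2 with h' | ⟨h1, h2, -, -, h3⟩
      · exact absurd h'.2 (hp b hb)
      · exact ⟨h1, h2, ((hA _ b h1 h2).1 h3).2⟩
    refine ⟨own, fun b hb b' hb' he => ?_, hown⟩
    have h1 := hB b hb
    have h2 := hB b' hb'
    exact h.own_inj b b' h1.1 h1.2 h2.1 h2.2 (by have := hown b hb; omega) he
  · rintro ⟨f, hf, hfA⟩ b₀ hb₀ hp₀
    have hsold : ∀ b, 1 ≤ b → b ≤ sg → price b ≠ 0 →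
        s ≤ own b ∧ own b < d ∧ price b = lv (own b) + 1 ∧ B b := by
      intro b h1 h2 h3
      rcases h.own_cases b h1 h2 with h' | ⟨h4, h5, -, h6, h7⟩
      · exact absurd h'.2 h3
      · exact ⟨h4, h5, h6, ((hA _ b h4 h5).1 h7).1⟩
    obtain ⟨l, hl1, hln, hl⟩ : ∃ l, 1 ≤ l ∧ l ≤ n ∧ ∀ b, 1 ≤ b → b ≤ sg → price b ≠ l := by
      by_contra! hcon
      choose! g hg1 hg2 hg3 using hcon
      have hmaps : ∀ l ∈ Finset.Icc 1 n, own (g l) ∈ Finset.Ico s d := by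
        intro l hl
        rw [Finset.mem_Icc] at hl
        have := hsold (g l) (hg1 l hl.1 hl.2) (hg2 l hl.1 hl.2)
          (by rw [hg3 l hl.1 hl.2]; omega)
        exact Finset.mem_Ico.2 ⟨this.1, this.2.1⟩
      have hinj : Set.InjOn (fun l => own (g l)) (Finset.Icc 1 n : Finset ℕ) := by
        intro l hl l' hl' he
        have hm := Finset.mem_Ico.1 (hmaps l hl)
        rw [Finset.mem_coe, Finset.mem_Icc] at hl hl'
        have := h.own_inj _ _ (hg1 l hl.1 hl.2) (hg2 l hl.1 hl.2) (hg1 l' hl'.1 hl'.2)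
          (hg2 l' hl'.1 hl'.2) (by omega) he
        rw [← hg3 l hl.1 hl.2, ← hg3 l' hl'.1 hl'.2, this]
      have := Finset.card_le_card_of_injOn _ hmaps hinj
      simp only [Nat.card_Icc, Nat.card_Ico] at this
      omega
    let U := (Finset.Icc 1 sg).filter fun b => B b ∧ price b < l
    have hUm : ∀ b, b ∈ U ↔ B b ∧ price b < l := by
      intro b
      simp only [U, Finset.mem_filter, Finset.mem_Icc, and_iff_right_iff_imp]
      exact fun h => hB b h.1
    have hnext : ∀ b ∈ U, ∃ b' ∈ U.erase b₀, own b' = f b := by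
      intro b hb
      rw [hUm] at hb
      obtain ⟨h1, h2, h3⟩ := hfA b hb.1
      obtain ⟨x, hx1, hx2, hx3, hx4⟩ := (hA (f b) b h1 h2).2 ⟨hb.1, h3⟩
      have hle := h.le_price (f b) h1 h2 x hx1 hx2 hx3
      rw [hx4] at hle
      rcases h.started (f b) h1 h2 (by omega) with ⟨b', h4, h5, h6⟩ | h' | h'
      · have h7 : price b' ≠ 0 := by
          rcases h.own_cases b' h4 h5 with h' | h' <;> omega
        obtain ⟨-, -, h9, h10⟩ := hsold b' h4 h5 h7
        have := hl b' h4 h5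
        rw [h6] at h9
        refine ⟨b', Finset.mem_erase.2 ⟨?_, (hUm b').2 ⟨h10, by omega⟩⟩, h6⟩
        rintro rfl
        exact h7 hp₀
      · omega
      · omega
    choose! g hg hgf using hnext
    have hcard := Finset.card_le_card_of_injOn g hg fun b hb b' hb' he => by
      rw [Finset.mem_coe] at hb hb'
      refine hf ((hUm b).1 hb).1 ((hUm b').1 hb').1 ?_
      rw [← hgf b hb, ← hgf b' hb', he]
    rw [Finset.card_erase_of_mem ((hUm b₀).2 ⟨hb₀, by omega⟩)] at hcard
    have : 0 < U.card := Finset.card_pos.2 ⟨b₀, (hUm b₀).2 ⟨hb₀, by omega⟩⟩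
    omega

end

end ESU

namespace ESU

open WordRAM

/-- The letter `a` is needed, but occurs in none of the components `c p, …, c d`. -/
def Missing (E : ℕ → ℕ → ℕ → Prop) (N : ℕ → Prop) (c : ℕ → ℕ) (p d a : ℕ) : Prop :=
  N a ∧ ∀ t, p ≤ t → t ≤ d → ¬ E (c t) a (c t)

/-- The missing letters can be read on the transitions between the components `c p, …, c d`. -/
def Covers (E : ℕ → ℕ → ℕ → Prop) (N : ℕ → Prop) (c : ℕ → ℕ) (p d : ℕ) : Prop :=
  ∃ f : ℕ → ℕ, Set.InjOn f {a | Missing E N c p d a} ∧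
    ∀ a, Missing E N c p d a → p ≤ f a ∧ f a < d ∧ E (c (f a)) a (c (f a + 1))

/-- The graph of the components and the needed letters in the memory. -/
structure Net (w n m sg : ℕ) (E : ℕ → ℕ → ℕ → Prop) (N : ℕ → Prop) (s : St Var Mem) : Prop where
  one_lt : 1 < 2 ^ w
  n_lt : n < 2 ^ w
  m_lt : m < 2 ^ w
  sg_lt : sg < 2 ^ w
  reg_n : s.reg .n = n
  reg_sg : s.reg .sg = sg
  grouped : Grouped n m E (s.mem .off) (s.mem .sl) (s.mem .sv)
  label_le : ∀ i a j, E i a j → a ≤ sg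
  target_lt : ∀ i a j, E i a j → j < n
  need : ∀ a ≤ sg, s.mem .need a = 1 ↔ N a
  needed : ∀ a, N a → 1 ≤ a ∧ a ≤ sg

theorem Net.agree {w n m sg : ℕ} {E : ℕ → ℕ → ℕ → Prop} {N : ℕ → Prop} {s s' : St Var Mem}
    {c : Cmd Var Mem} (h : Net w n m sg E N s) (ha : Agree c s s')
    (h1 : c.wr .n = false := by rfl) (h2 : c.wr .sg = false := by rfl)
    (h3 : c.wm .off = false := by rfl) (h4 : c.wm .sl = false := by rfl)
    (h5 : c.wm .sv = false := by rfl) (h6 : c.wm .need = false := by rfl) :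
    Net w n m sg E N s' where
  __ := h
  reg_n := (ha.1 _ h1).trans h.reg_n
  reg_sg := (ha.1 _ h2).trans h.reg_sg
  grouped := by rw [ha.2 _ h3, ha.2 _ h4, ha.2 _ h5]; exact h.grouped
  need := by rw [ha.2 _ h6]; exact h.need

/-- The components `c p, …, c d` are different and in topological order. -/
structure Ascending (n : ℕ) (c : ℕ → ℕ) (p d : ℕ) : Prop where
  le : p ≤ d
  lt : ∀ t, p ≤ t → t ≤ d → c t < n
  step : ∀ t, p ≤ t → t < d → c t < c (t + 1)

theorem Grouped.sum_le {n m : ℕ} {E : ℕ → ℕ → ℕ → Prop} {off sl sv : ℕ → ℕ}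
    (h : Grouped n m E off sl sv) {c : ℕ → ℕ} {p d : ℕ} (hc : Ascending n c p d) :
    ∑ t ∈ Finset.Ico p (d + 1), (off (c t + 1) - off (c t)) ≤ m := by
  suffices ∀ e, p ≤ e → e ≤ d →
      ∑ t ∈ Finset.Ico p (e + 1), (off (c t + 1) - off (c t)) ≤ off (c e + 1) from
    (this d hc.le le_rfl).trans ((h.off_le (hc.lt d hc.le le_rfl) le_rfl).trans h.le)
  intro e he
  induction e, he using Nat.le_induction with
  | base => simp
  | succ e he ih =>
    intro hed
    rw [Finset.sum_Ico_succ_top (by omega)]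
    have h1 := ih (by omega)
    have h2 : off (c e + 1) ≤ off (c (e + 1)) := h.off_le (hc.step e he hed) (hc.lt (e + 1) (by omega) hed).le
    have h3 := h.mono _ (hc.lt (e + 1) (by omega) hed)
    omega

theorem Ascending.le_apply {n : ℕ} {c : ℕ → ℕ} {p d : ℕ} (h : Ascending n c p d) :
    d - p ≤ c d := by
  suffices ∀ e, p ≤ e → e ≤ d → e - p ≤ c e from this d h.le le_rfl
  intro e he
  induction e, he using Nat.le_induction with
  | base => simp
  | succ e he ih =>
    intro hed
    have := ih (by omega)
    have := h.step e he hed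
    omega

section

variable {w n m sg p d : ℕ} {E : ℕ → ℕ → ℕ → Prop} {N : ℕ → Prop} {c : ℕ → ℕ} {s : St Var Mem}

theorem missing_does (hN : Net w n m sg E N s) (hch : s.mem .ch = c) (hs : s.reg .s = p)
    (hd : s.reg .d = d) (hdn : d < n) (hc : Ascending n c p d) :
    Does w missing s (5 * sg + 4 * m + 8 * n + 5) fun s' =>
      (∀ a ≤ sg, (s'.mem .ms a = 1 ↔ Missing E N c p d a)) ∧
      (∀ a, 1 ≤ a → a ≤ sg → s'.mem .price a = 0 ∧ s'.mem .own a = n) ∧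
      ∀ t, p ≤ t → t ≤ d → s'.mem .lv t = 0 ∧ s'.mem .ptr t = s'.mem .off (c t) := by
  have h1 : 1 % 2 ^ w = 1 := Nat.mod_eq_of_lt hN.one_lt
  have hnw := hN.n_lt
  have hpd := hc.le
  refine Does.seq (T₁ := 1) (T₂ := 5 * sg + 4 * m + 8 * n + 4) (Q₁ := fun s' => s'.mem .ms 0 = 0)
    (Does.straight rfl le_rfl (by simp)) ?_ (by omega)
  intro s₁ ha₁ hms₁
  have hN₁ := hN.agree ha₁
  refine Does.seq (T₁ := sg * 5 + 2) (T₂ := 4 * m + 8 * n + 2)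
    (Does.loop_const (fun j s' => (∀ a ≤ j, (s'.mem .ms a = 1 ↔ N a)) ∧
      ∀ a, 1 ≤ a → a ≤ j → s'.mem .price a = 0 ∧ s'.mem .own a = n) 0 sg 3 (by simp) (by omega)
      hN.sg_lt ?_ (fun s' h => eval_of_agree h hN₁.reg_sg rfl) rfl ?_ (by simp)) ?_ (by omega)
  · have hN0 : ¬ N 0 := fun h => by have := hN.needed 0 h; omega
    refine ⟨fun a ha => ?_, fun a h1 h2 => by omega⟩
    obtain rfl : a = 0 := by omega
    simp [hms₁, hN0]
  · rintro j s' - hj hjr ha ⟨hI, hI'⟩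
    have hN' := hN₁.agree ha
    have hlt : j + 1 < 2 ^ w := by have := hN.sg_lt; omega
    refine Does.straight rfl le_rfl ⟨fun a haj => ?_, fun a ha1 haj => ?_⟩
    · by_cases haj' : a = j + 1
      · simpa [haj', hjr, Nat.mod_eq_of_lt hlt] using hN'.need (j + 1) hj
      · simpa [haj', hjr, Nat.mod_eq_of_lt hlt] using hI a (by omega)
    · by_cases haj' : a = j + 1
      · simp [haj', hjr, Nat.mod_eq_of_lt hlt, hN'.reg_n]
      · simpa [haj', hjr, Nat.mod_eq_of_lt hlt] using hI' a ha1 (by omega)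
  rintro s₂ ha₂ ⟨⟨hms, hpr⟩, -⟩
  have hN₂ := hN₁.agree ha₂
  set off := s₂.mem .off with hoff
  have hsum : ∑ t ∈ Finset.Ico p (d + 1), (off (c t + 1) - off (c t)) ≤ m := hN₂.grouped.sum_le hc
  refine (Does.loop (fun j s' => (∀ a ≤ sg, (s'.mem .ms a = 1 ↔
        N a ∧ ∀ t, p ≤ t → t < j → ¬ E (c t) a (c t))) ∧
      ∀ t, p ≤ t → t < j → s'.mem .lv t = 0 ∧ s'.mem .ptr t = off (c t)) p (d + 1)
    (fun t => 4 * (off (c t + 1) - off (c t)) + 6) ?_ (by omega) (by omega) ?_ ?_ rfl ?_ ?_).mono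
    le_rfl ?_
  · exact (ha₂.1 .s rfl).trans ((ha₁.1 .s rfl).trans hs)
  · simp only [St.setReg_mem]
    refine ⟨fun a ha => (hms a ha).trans (iff_self_and.2 fun _ t h1 h2 => by omega),
      fun t h1 h2 => by omega⟩
  · intro s' ha
    have : s'.reg .d = d := (ha.1 .d rfl).trans ((ha₂.1 .d rfl).trans ((ha₁.1 .d rfl).trans hd))
    simp [this, h1, Nat.mod_eq_of_lt (show d + 1 < 2 ^ w by omega)]
  · rintro t s' hpt htd htr ha ⟨hI, hI'⟩
    have hN' := hN₂.agree ha
    have hch' : s'.mem .ch = c := by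
      rw [ha.2 .ch rfl, ha₂.2 .ch rfl, ha₁.2 .ch rfl, hch]
    have hoff' : s'.mem .off = off := ha.2 .off rfl
    have hct : c t < n := hc.lt t hpt (by omega)
    have hG := hN'.grouped
    rw [hoff'] at hG
    have hoffm : off (c t + 1) < 2 ^ w :=
      ((hG.off_le hct le_rfl).trans hG.le).trans_lt hN.m_lt
    have e1 : c t % 2 ^ w = c t := Nat.mod_eq_of_lt (by omega)
    have e2 : (c t + 1) % 2 ^ w = c t + 1 := Nat.mod_eq_of_lt (by omega)
    refine Does.seq (T₁ := 4) (T₂ := 4 * (off (c t + 1) - off (c t)) + 2)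
      (Q₁ := fun s'' => s''.reg .c = c t ∧ s''.reg .hi = off (c t + 1) ∧
        ∀ u, p ≤ u → u ≤ t → s''.mem .lv u = 0 ∧ s''.mem .ptr u = off (c u))
      (Does.straight rfl le_rfl ?_) ?_ (by omega)
    · simp only [Cmd.denote, Exp.eval, BinOp.eval, h1, htr, hch', hoff', e1, e2,
        St.setReg_reg, St.setReg_mem, St.setMem_mem, St.setMem_reg, reduceCtorEq, if_true,
        if_false, Nat.mod_eq_of_lt hoffm]
      refine ⟨trivial, trivial, fun u hu1 hu2 => ?_⟩
      by_cases hut : u = t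
      · simp [hut]
      · simpa [hut] using hI' u hu1 (by omega)
    rintro s₃ ha₃ ⟨hc₃, hhi₃, hlv₃⟩
    have hN₃ := hN'.agree ha₃
    have hoff₃ : s₃.mem .off = off := (ha₃.2 .off rfl).trans hoff'
    have hG₃ := hN₃.grouped
    rw [hoff₃] at hG₃
    have hms₃ : s₃.mem .ms = s'.mem .ms := ha₃.2 .ms rfl
    refine (Does.loop_const (fun x s'' => ∀ a ≤ sg, (s''.mem .ms a = 1 ↔ s₃.mem .ms a = 1 ∧
      ∀ y, off (c t) ≤ y → y < x → s₃.mem .sv y = c t → s₃.mem .sl y ≠ a))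
      (off (c t)) (off (c t + 1)) 2 (by simp [hc₃, hoff₃]) (hG.mono _ hct) hoffm ?_
      (fun s' h => eval_of_agree h hhi₃ rfl) rfl ?_ (by omega)).mono le_rfl ?_
    · exact fun a ha => iff_self_and.2 fun _ y h1 h2 => by omega
    · intro x s₄ hx1 hx2 hxr ha₄ hI₄
      refine Does.straight rfl le_rfl fun a hag => ?_
      have hsv : s₄.mem .sv = s₃.mem .sv := ha₄.2 .sv rfl
      have hsl : s₄.mem .sl = s₃.mem .sl := ha₄.2 .sl rfl
      have hc₄ : s₄.reg .c = c t := (ha₄.1 .c rfl).trans hc₃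
      have hsplit : (∀ y, off (c t) ≤ y → y < x + 1 → s₃.mem .sv y = c t → s₃.mem .sl y ≠ a) ↔
          (∀ y, off (c t) ≤ y → y < x → s₃.mem .sv y = c t → s₃.mem .sl y ≠ a) ∧
          (s₃.mem .sv x = c t → s₃.mem .sl x ≠ a) := by
        simp only [Nat.lt_succ_iff_lt_or_eq, or_imp, forall_and, forall_eq]
        exact and_congr_right fun _ => ⟨fun h => h x hx1 rfl, fun h y _ hy => hy ▸ h⟩
      rw [hsplit, ← and_assoc, ← hI₄ a hag]
      by_cases hv : s₃.mem .sv x = c t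
      · by_cases hla : a = s₃.mem .sl x
        · simp [hxr, hsv, hsl, hc₄, hv, hla]
        · simp [hxr, hsv, hsl, hc₄, hv, hla, Ne.symm hla]
      · simp [hxr, hsv, hsl, hc₄, hv]
    · rintro s₄ ha₄ ⟨hI₄, -⟩
      simp only [St.setReg_mem]
      refine ⟨fun a hag => ?_, fun u hu1 hu2 => ?_⟩
      · rw [hI₄ a hag, hms₃, hI a hag, and_assoc]
        refine and_congr_right fun _ => ?_
        simp only [Nat.lt_succ_iff_lt_or_eq, or_imp, forall_and]
        refine and_congr_right fun _ => ?_
        have := hG₃.mem (c t) hct a (c t)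
        constructor
        · rintro h u - rfl hE
          obtain ⟨y, hy1, hy2, hy3, hy4⟩ := this.2 hE
          exact h y hy1 hy2 hy4 hy3
        · intro h y hy1 hy2 hy3 hy4
          exact h t hpt rfl (this.1 ⟨y, hy1, hy2, hy4, hy3⟩)
      · rw [ha₄.2 .lv rfl, ha₄.2 .ptr rfl]
        exact hlv₃ u hu1 (by omega)
  · simp only [add_assoc, Finset.sum_add_distrib, ← Finset.mul_sum]
    simp only [Finset.sum_const, Nat.card_Ico, smul_eq_mul]
    omega
  · rintro s' ha ⟨⟨hI, hI'⟩, -⟩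
    rw [ha.2 .price rfl, ha.2 .own rfl, ha.2 .off rfl]
    exact ⟨fun a hag => (hI a hag).trans (by simp only [Missing, Nat.lt_succ_iff]), hpr,
      fun t h1 h2 => hI' t h1 (by omega)⟩

/-- The auction in the memory. -/
def InAuction (n sg p d : ℕ) (c off sl sv ms : ℕ → ℕ) (s : St Var Mem) : Prop :=
  Auction n sg p d (fun u => off (c u)) (fun u => off (c u + 1)) sl
    (fun u x => sv x = c (u + 1) ∧ ms (sl x) = 1) (s.mem .lv) (s.mem .ptr) (s.mem .price)
    (s.mem .own) (s.reg .t) (s.reg .u)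

def memPotential (n sg p d : ℕ) (c off : ℕ → ℕ) (s : St Var Mem) : ℕ :=
  auctionPotential n sg p d (fun u => off (c u)) (fun u => off (c u + 1)) (s.mem .lv) (s.mem .ptr)
    (s.mem .price)

theorem bid_does {ms off sl sv : ℕ → ℕ} (hN : Net w n m sg E N s) (hch : s.mem .ch = c)
    (hms : s.mem .ms = ms) (hoff : s.mem .off = off) (hsl : s.mem .sl = sl)
    (hsv : s.mem .sv = sv) (hms0 : ms 0 ≠ 1) (hdn : d < n) (hc : Ascending n c p d)
    (hA : InAuction n sg p d c off sl sv ms s) (hu : s.reg .u < n) :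
    Does w bid s 13 fun s' => InAuction n sg p d c off sl sv ms s' ∧
      memPotential n sg p d c off s' < memPotential n sg p d c off s := by
  have h1 : 1 % 2 ^ w = 1 := Nat.mod_eq_of_lt hN.one_lt
  have hnw := hN.n_lt
  have hmw := hN.m_lt
  have hsgw := hN.sg_lt
  obtain ⟨hus, hud, -, hlv, -⟩ := hA.cur_cases.resolve_left hu.ne
  have hG := hN.grouped
  rw [hoff, hsl, hsv] at hG
  have hcu := hc.lt _ hus hud.le
  have hoffm : off (c (s.reg .u) + 1) ≤ m := (hG.off_le hcu le_rfl).trans hG.le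
  have e1 : c (s.reg .u) % 2 ^ w = c (s.reg .u) := Nat.mod_eq_of_lt (by omega)
  have e2 : (c (s.reg .u) + 1) % 2 ^ w = c (s.reg .u) + 1 := Nat.mod_eq_of_lt (by omega)
  have e3 : (s.reg .u + 1) % 2 ^ w = s.reg .u + 1 := Nat.mod_eq_of_lt (by omega)
  have e4 : (s.mem .lv (s.reg .u) + 1) % 2 ^ w = s.mem .lv (s.reg .u) + 1 :=
    Nat.mod_eq_of_lt (by omega)
  refine Does.straight rfl (by decide) ?_
  by_cases hptr : s.mem .ptr (s.reg .u) < off (c (s.reg .u) + 1)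
  · have e5 : (s.mem .ptr (s.reg .u) + 1) % 2 ^ w = s.mem .ptr (s.reg .u) + 1 :=
      Nat.mod_eq_of_lt (by omega)
    have hlab : sl (s.mem .ptr (s.reg .u)) ≤ sg := hN.label_le _ _ _ ((hG.mem _ hcu _ _).1
      ⟨_, (hA.ptr_mem _ hus hud).1, hptr, rfl, rfl⟩)
    have e6 : sl (s.mem .ptr (s.reg .u)) % 2 ^ w = sl (s.mem .ptr (s.reg .u)) :=
      Nat.mod_eq_of_lt (by omega)
    by_cases hW : (sv (s.mem .ptr (s.reg .u)) = c (s.reg .u + 1) ∧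
        ms (sl (s.mem .ptr (s.reg .u))) = 1) ∧
        s.mem .price (sl (s.mem .ptr (s.reg .u))) ≤ s.mem .lv (s.reg .u)
    · have hb : 1 ≤ sl (s.mem .ptr (s.reg .u)) := by
        refine Nat.one_le_iff_ne_zero.2 fun h0 => hms0 ?_
        rw [← hW.1.2, h0]
      have e7 : s.mem .own (sl (s.mem .ptr (s.reg .u))) % 2 ^ w =
          s.mem .own (sl (s.mem .ptr (s.reg .u))) := by
        refine Nat.mod_eq_of_lt ?_
        rcases hA.own_cases _ hb hlab with h | h <;> omega
      have h2 := not_lt.2 hW.2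
      have hstep := hA.take hdn hu hptr hW.1 hW.2 hb hlab
      simpa [bid, hch, hms, hoff, hsl, hsv, e1, e2, e3, e4, e5, e6, e7, h1, hptr, hW.1.1, hW.1.2,
        h2, InAuction, memPotential] using hstep
    · have hstep := hA.next hu hptr fun h => by
        by_contra hlt
        exact hW ⟨h, not_lt.1 hlt⟩
      by_cases h3 : sv (s.mem .ptr (s.reg .u)) = c (s.reg .u + 1)
      · by_cases h4 : ms (sl (s.mem .ptr (s.reg .u))) = 1
        · have h5 : s.mem .lv (s.reg .u) < s.mem .price (sl (s.mem .ptr (s.reg .u))) := by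
            by_contra hlt
            exact hW ⟨⟨h3, h4⟩, not_lt.1 hlt⟩
          simpa [bid, hch, hms, hoff, hsl, hsv, e1, e2, e3, e4, e5, e6, h1, hptr, h3, h4, h5,
            InAuction, memPotential] using hstep
        · simpa [bid, hch, hms, hoff, hsl, hsv, e1, e2, e3, e4, e5, e6, h1, hptr, h3, h4,
            InAuction, memPotential] using hstep
      · simpa [bid, hch, hms, hoff, hsl, hsv, e1, e2, e3, e4, e5, e6, h1, hptr, h3,
          InAuction, memPotential] using hstep
  · have hstep := hA.level hu hptr
    by_cases h2 : s.mem .lv (s.reg .u) + 1 < n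
    · simpa [bid, hch, hoff, e1, e2, e4, h1, hptr, hN.reg_n, h2, InAuction, memPotential]
        using hstep
    · simpa [bid, hch, hoff, e1, e2, e4, h1, hptr, hN.reg_n, h2, InAuction, memPotential,
        Nat.mod_eq_of_lt hnw] using hstep

theorem test_does (hN : Net w n m sg E N s) (hch : s.mem .ch = c) (hs : s.reg .s = p)
    (hd : s.reg .d = d) (hdn : d < n) (hc : Ascending n c p d) :
    Does w test s (100 * (n * (n + m + sg))) fun s' => s'.reg .ok = 1 ↔ Covers E N c p d := by
  have h1 : 1 % 2 ^ w = 1 := Nat.mod_eq_of_lt hN.one_lt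
  have hnw := hN.n_lt
  have hpd := hc.le
  refine Does.seq (T₁ := 5 * sg + 4 * m + 8 * n + 5) (T₂ := 16 * (n * (m + n) + m + n * sg + n) +
      (5 * sg + 6)) (missing_does hN hch hs hd hdn hc) ?_ (by nlinarith)
  rintro s₁ ha₁ ⟨hms, hpr, hlv⟩
  have hN₁ := hN.agree ha₁
  set off := s₁.mem .off with hoff
  set ms := s₁.mem .ms with hms_def
  have hsum : ∑ t ∈ Finset.Ico p (d + 1), (off (c t + 1) - off (c t)) ≤ m := hN₁.grouped.sum_le hc
  have hd₁ : s₁.reg .d = d := (ha₁.1 .d rfl).trans hd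
  have hs₁ : s₁.reg .s = p := (ha₁.1 .s rfl).trans hs
  have hch₁ : s₁.mem .ch = c := (ha₁.2 .ch rfl).trans hch
  have hms0 : ms 0 ≠ 1 := fun h => by
    have := hN.needed 0 ((hms 0 (by omega)).1 h).1
    omega
  refine Does.seq (T₁ := 2) (T₂ := 16 * (n * (m + n) + m + n * sg + n) + 5 * sg + 4)
    (Q₁ := fun s' => s'.reg .t = p ∧ s'.reg .u = n) (Does.straight rfl le_rfl ?_) ?_ (by omega)
  · simp [hs₁, hN₁.reg_n, Nat.mod_eq_of_lt hnw, Nat.mod_eq_of_lt (show p < 2 ^ w by omega)]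
  rintro s₂ ha₂ ⟨ht₂, hu₂⟩
  have hN₂ := hN₁.agree ha₂
  have hd₂ : s₂.reg .d = d := (ha₂.1 .d rfl).trans hd₁
  have hch₂ : s₂.mem .ch = c := (ha₂.2 .ch rfl).trans hch₁
  have hms₂ : s₂.mem .ms = ms := ha₂.2 .ms rfl
  have hoff₂ : s₂.mem .off = off := ha₂.2 .off rfl
  refine Does.seq (T₁ := 16 * (n * (m + n) + m + n * sg + n) + 1) (T₂ := 5 * sg + 3)
    (Does.while_ (fun s' => InAuction n sg p d c off (s₂.mem .sl) (s₂.mem .sv) ms s' ∧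
      p ≤ s'.reg .t ∧ s'.reg .t ≤ d + 1 ∧ (s'.reg .t = d + 1 → s'.reg .u = n))
      (fun s' => 16 * (memPotential n sg p d c off s' + (d + 1 - s'.reg .t))) ?_ ?_ ?_) ?_ (by omega)
  · rw [InAuction, ht₂, hu₂]
    refine ⟨⟨fun u h2 h3 => ?_, fun u h2 h3 => ?_, fun u h2 h3 x h4 h5 => ?_,
      fun u h2 h3 x h4 h5 h6 => ?_, fun b h2 h3 => ?_, fun b b' h2 h3 h4 h5 h6 => ?_,
      fun u h2 h3 h4 => by omega, fun u h2 h3 h4 => ?_, .inl rfl⟩, le_rfl, by omega,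
      fun _ => rfl⟩
    · rw [ha₂.2 .ptr rfl, (hlv u h2 h3.le).2]
      exact ⟨le_rfl, hN₁.grouped.mono _ (hc.lt u h2 h3.le)⟩
    · rw [ha₂.2 .lv rfl, (hlv u h2 h3.le).1]; omega
    · rw [ha₂.2 .ptr rfl, (hlv u h2 h3.le).2] at h5
      omega
    · rw [ha₂.2 .lv rfl, (hlv u h2 h3.le).1]; omega
    · rw [ha₂.2 .own rfl, ha₂.2 .price rfl]
      exact .inl (hpr b h2 h3).symm
    · rw [ha₂.2 .own rfl, (hpr b h2 h3).2] at h6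
      omega
    · rw [ha₂.2 .lv rfl, (hlv u h2 h3.le).1]
  · rintro s' ha ⟨hA, hpt, htd, hend⟩ hcond
    have hN' := hN₂.agree ha
    have hd' : s'.reg .d = d := (ha.1 .d rfl).trans hd₂
    have hmod : (d + 1) % 2 ^ w = d + 1 := Nat.mod_eq_of_lt (by omega)
    simp only [Cond.holds, Exp.eval, BinOp.eval, hd', h1, hmod] at hcond
    refine ⟨14, Does.ite (T₁ := 13) (fun hu => ?_) (fun hu => ?_) le_rfl⟩
    · simp only [Cond.holds, Exp.eval, hN'.reg_n] at hu
      refine (bid_does hN' ((ha.2 .ch rfl).trans hch₂) ((ha.2 .ms rfl).trans hms₂)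
        ((ha.2 .off rfl).trans hoff₂) (ha.2 .sl rfl) (ha.2 .sv rfl) hms0 hdn hc hA hu).mono le_rfl ?_
      rintro s'' ha' ⟨hA', hlt⟩
      rw [ha'.1 .t rfl]
      exact ⟨⟨hA', hpt, htd, by omega⟩, by omega⟩
    · simp only [Cond.holds, Exp.eval, hN'.reg_n] at hu
      have hun : s'.reg .u = n := by
        rcases hA.cur_cases with h | h <;> omega
      rw [InAuction, hun] at hA
      refine Does.straight rfl (by decide) ?_
      have hmt : (s'.reg .t + 1) % 2 ^ w = s'.reg .t + 1 := Nat.mod_eq_of_lt (by omega)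
      have hmt' : s'.reg .t % 2 ^ w = s'.reg .t := Nat.mod_eq_of_lt (by omega)
      by_cases htd' : s'.reg .t < d
      · have hA' := hA.start_crossing hdn hpt htd'
        simp [InAuction, memPotential, htd', hmt, hmt', h1, hd']
        exact ⟨⟨hA', by omega, by omega⟩, by omega⟩
      · have hA' := hA.finish (by omega)
        simp [InAuction, memPotential, htd', hmt, h1, hun, hd']
        exact ⟨⟨hA', by omega, by omega⟩, by omega⟩
  · have h2 : memPotential n sg p d c off s₂ ≤ n * (m + n) + m + n * sg := by
      have h3 : ∑ b ∈ Finset.Ico 1 (sg + 1), (n - s₂.mem .price b) ≤ n * sg := by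
        refine (Finset.sum_le_sum fun b _ => Nat.sub_le n _).trans ?_
        simp [Nat.mul_comm]
      have h4 : ∑ u ∈ Finset.Ico p d, ((n - s₂.mem .lv u) * (off (c u + 1) - off (c u) + 1) +
          (off (c u + 1) - s₂.mem .ptr u)) ≤ ∑ u ∈ Finset.Ico p d,
          (n * (off (c u + 1) - off (c u)) + n + (off (c u + 1) - off (c u))) := by
        refine Finset.sum_le_sum fun u hu => ?_
        rw [Finset.mem_Ico] at hu
        rw [ha₂.2 .ptr rfl, (hlv u hu.1 hu.2.le).2]
        have := Nat.mul_le_mul_right (off (c u + 1) - off (c u) + 1)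
          (Nat.sub_le n (s₂.mem .lv u))
        rw [Nat.mul_add n] at this
        omega
      have h5 : ∑ u ∈ Finset.Ico p d, (off (c u + 1) - off (c u)) ≤ m := by
        rw [Finset.sum_Ico_succ_top hpd] at hsum
        omega
      have h8 : ∑ u ∈ Finset.Ico p d,
          (n * (off (c u + 1) - off (c u)) + n + (off (c u + 1) - off (c u))) =
          n * ∑ u ∈ Finset.Ico p d, (off (c u + 1) - off (c u)) + (d - p) * n +
            ∑ u ∈ Finset.Ico p d, (off (c u + 1) - off (c u)) := by
        simp [Finset.sum_add_distrib, Finset.mul_sum]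
      have h6 := Nat.mul_le_mul_left n h5
      have h7 : (d - p) * n ≤ n * n := Nat.mul_le_mul_right n (by omega)
      rw [memPotential, auctionPotential, Nat.mul_add]
      omega
    have : d + 1 - s₂.reg .t ≤ n := by omega
    omega
  · rintro s₃ ha₃ ⟨⟨hA, hpt, htd, hend⟩, hcond⟩
    have hd₃ : s₃.reg .d = d := (ha₃.1 .d rfl).trans hd₂
    have hmod : (d + 1) % 2 ^ w = d + 1 := Nat.mod_eq_of_lt (by omega)
    simp only [Cond.holds, Exp.eval, BinOp.eval, hd₃, h1, hmod] at hcond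
    have ht₃ : s₃.reg .t = d + 1 := by omega
    have hN₃ := hN₂.agree ha₃
    have hms₃ : s₃.mem .ms = ms := (ha₃.2 .ms rfl).trans hms₂
    rw [InAuction, hend ht₃, ht₃] at hA
    have hG := hN₂.grouped
    rw [hoff₂] at hG
    have hsold := hA.sold_iff hdn (B := Missing E N c p d) (A := fun u b => E (c u) b (c (u + 1)))
      (fun b hb => hN.needed b hb.1) (by
        intro u b h2 h3
        rw [← hG.mem (c u) (hc.lt u h2 h3.le) b (c (u + 1))]
        constructor
        · rintro ⟨x, hx1, hx2, ⟨hx3, hx4⟩, rfl⟩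
          refine ⟨(hms _ ?_).1 hx4, x, hx1, hx2, rfl, hx3⟩
          exact hN.label_le _ _ _ ((hG.mem (c u) (hc.lt u h2 h3.le) _ _).1 ⟨x, hx1, hx2, rfl, rfl⟩)
        · rintro ⟨hb, x, hx1, hx2, rfl, hx3⟩
          exact ⟨x, hx1, hx2, ⟨hx3, (hms _ (hN.needed _ hb.1).2).2 hb⟩, rfl⟩)
    rw [← Covers] at hsold
    refine Does.seq (T₁ := 1) (T₂ := 5 * sg + 2) (Q₁ := fun s' => s'.reg .ok = 1)
      (Does.straight rfl le_rfl (by simp [h1])) ?_ (by omega)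
    intro s₄ ha₄ hok
    have hN₄ := hN₃.agree ha₄
    refine (Does.loop_const (fun j s' => s'.reg .ok = 1 ↔ ∀ b ≤ j, ms b = 1 → s₃.mem .price b ≠ 0)
      0 sg 3 (by simp) (by omega) hN.sg_lt ?_ (fun s' h => eval_of_agree h hN₄.reg_sg rfl) rfl ?_
      (by omega)).mono le_rfl ?_
    · simp only [St.setReg_reg, reduceCtorEq, if_false, hok, true_iff]
      intro b hb h
      obtain rfl : b = 0 := by omega
      exact absurd h hms0
    · rintro j s' - hj hjr ha hI
      have hms' : s'.mem .ms = ms := (ha.2 .ms rfl).trans ((ha₄.2 .ms rfl).trans hms₃)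
      have hpr' : s'.mem .price = s₃.mem .price := (ha.2 .price rfl).trans (ha₄.2 .price rfl)
      have hmj : (j + 1) % 2 ^ w = j + 1 := Nat.mod_eq_of_lt (by have := hN.sg_lt; omega)
      have hsplit : (∀ b ≤ j + 1, ms b = 1 → s₃.mem .price b ≠ 0) ↔
          (∀ b ≤ j, ms b = 1 → s₃.mem .price b ≠ 0) ∧
            (ms (j + 1) = 1 → s₃.mem .price (j + 1) ≠ 0) := by
        simp only [Nat.le_succ_iff, or_imp, forall_and, forall_eq]
      refine Does.straight rfl (by decide) ?_
      rw [hsplit, ← hI]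
      by_cases h2 : ms (j + 1) = 1 <;> by_cases h3 : s₃.mem .price (j + 1) = 0 <;>
        simp [hjr, hms', hpr', hmj, h1, h2, h3]
    · rintro s' ha ⟨hI, -⟩
      rw [hI, ← hsold]
      exact ⟨fun h b hb => h b (hN.needed b hb.1).2 ((hms b (hN.needed b hb.1).2).2 hb),
        fun h b hb hb' => h b ((hms b hb).1 hb')⟩

end

end ESU

/-! ### The search through the chains of components -/

namespace ESU

open WordRAM

theorem Covers.congr {E : ℕ → ℕ → ℕ → Prop} {N : ℕ → Prop} {c c' : ℕ → ℕ} {p d : ℕ}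
    (h : ∀ t ≤ d, c t = c' t) : Covers E N c p d ↔ Covers E N c' p d := by
  suffices ∀ {c c' : ℕ → ℕ}, (∀ t ≤ d, c t = c' t) → Covers E N c p d → Covers E N c' p d from
    ⟨this h, this fun t ht => (h t ht).symm⟩
  rintro c c' h ⟨f, hf, hfE⟩
  have hM : ∀ a, Missing E N c' p d a → Missing E N c p d a := fun a ha =>
    ⟨ha.1, fun t h1 h2 => by rw [h t h2]; exact ha.2 t h1 h2⟩
  refine ⟨f, fun a ha b hb => hf (hM a ha) (hM b hb), fun a ha => ?_⟩
  obtain ⟨h1, h2, h3⟩ := hfE a (hM a ha)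
  rw [h _ h2.le, h _ h2] at h3
  exact ⟨h1, h2, h3⟩

theorem Covers.mono {E : ℕ → ℕ → ℕ → Prop} {N : ℕ → Prop} {c : ℕ → ℕ} {p p' d : ℕ}
    (h : Covers E N c p d) (hp : p' ≤ p) : Covers E N c p' d := by
  obtain ⟨f, hf, hfE⟩ := h
  have hM : ∀ a, Missing E N c p' d a → Missing E N c p d a := fun a ha =>
    ⟨ha.1, fun t h1 h2 => ha.2 t (by omega) h2⟩
  exact ⟨f, fun a ha b hb => hf (hM a ha) (hM b hb), fun a ha =>
    ⟨hp.trans (hfE a (hM a ha)).1, (hfE a (hM a ha)).2⟩⟩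

open Classical in
/-- The greedy division of the chain `c 0, …, c d` into arches: the start of the last, unfinished
arch, and the number of the finished arches. -/
noncomputable def greedy (E : ℕ → ℕ → ℕ → Prop) (N : ℕ → Prop) (c : ℕ → ℕ) : ℕ → ℕ × ℕ
  | 0 => (0, 0)
  | d + 1 => if Covers E N c (greedy E N c d).1 (d + 1) then (d + 1, (greedy E N c d).2 + 1)
      else greedy E N c d

section

variable {E : ℕ → ℕ → ℕ → Prop} {N : ℕ → Prop} {n k : ℕ}

theorem greedy_fst_le (c : ℕ → ℕ) (d : ℕ) : (greedy E N c d).1 ≤ d := by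
  induction d with
  | zero => exact le_rfl
  | succ d ih =>
    rw [greedy]
    split_ifs
    · exact le_rfl
    · omega

theorem greedy_snd_le (c : ℕ → ℕ) (d : ℕ) : (greedy E N c d).2 ≤ d := by
  induction d with
  | zero => exact le_rfl
  | succ d ih =>
    rw [greedy]
    split_ifs
    · exact Nat.succ_le_succ ih
    · omega

theorem greedy_snd_mono (c : ℕ → ℕ) {d e : ℕ} (h : d ≤ e) :
    (greedy E N c d).2 ≤ (greedy E N c e).2 := by
  induction e, h using Nat.le_induction with
  | base => exact le_rfl
  | succ e _ ih =>
    rw [greedy]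
    split_ifs
    · exact ih.trans (Nat.le_succ _)
    · exact ih

theorem greedy_congr {c c' : ℕ → ℕ} {d : ℕ} (h : ∀ t ≤ d, c t = c' t) :
    greedy E N c d = greedy E N c' d := by
  induction d with
  | zero => rfl
  | succ d ih =>
    rw [greedy, greedy, ih fun t ht => h t (by omega)]
    split_ifs with h1 h2 h2
    · rfl
    · exact absurd ((Covers.congr h).1 h1) h2
    · exact absurd ((Covers.congr h).2 h2) h1
    · rfl

/-- The list `c d, …, c e` is a path of components in topological order. -/
def IsChain (E : ℕ → ℕ → ℕ → Prop) (c : ℕ → ℕ) (d e : ℕ) : Prop :=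
  ∀ t, d ≤ t → t < e → c t < c (t + 1) ∧ ∃ a, E (c t) a (c (t + 1))

/-- The chain `c 0, …, c d` can be extended, by a component `≥ v` in the first place, to a chain with
at least `k` arches. -/
def Wins (E : ℕ → ℕ → ℕ → Prop) (N : ℕ → Prop) (k : ℕ) (c : ℕ → ℕ) (d v : ℕ) : Prop :=
  ∃ c' e, d < e ∧ (∀ t ≤ d, c' t = c t) ∧ v ≤ c' (d + 1) ∧ IsChain E c' d e ∧
    k ≤ (greedy E N c' e).2

theorem Wins.congr {c c' : ℕ → ℕ} {d v : ℕ} (h : ∀ t ≤ d, c t = c' t) :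
    Wins E N k c d v ↔ Wins E N k c' d v := by
  refine exists_congr fun b => exists_congr fun e => and_congr_right fun _ =>
    and_congr_left fun _ => forall_congr' fun t => forall_congr' fun ht => ?_
  rw [h t ht]

theorem wins_of_not_edge {c : ℕ → ℕ} {d v : ℕ} (h : ¬ ∃ a, E (c d) a v) :
    Wins E N k c d v ↔ Wins E N k c d (v + 1) := by
  refine exists_congr fun b => exists_congr fun e => and_congr_right fun hde =>
    and_congr_right fun hb => ⟨fun ⟨h1, h2, h3⟩ => ⟨?_, h2, h3⟩, fun ⟨h1, h2, h3⟩ => ⟨by omega, h2, h3⟩⟩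
  rcases h1.lt_or_eq with h1 | h1
  · exact h1
  · have := (h2 d le_rfl hde).2
    rw [hb d le_rfl, ← h1] at this
    exact absurd this h

theorem not_wins {c : ℕ → ℕ} {d : ℕ} (hE : ∀ i a j, E i a j → j < n) : ¬ Wins E N k c d n := by
  rintro ⟨b, e, hde, -, hv, hch, -⟩
  obtain ⟨a, ha⟩ := (hch d le_rfl hde).2
  have := hE _ _ _ ha
  omega

theorem wins_of_edge {c : ℕ → ℕ} {d v : ℕ} (hlt : c d < v) (h : ∃ a, E (c d) a v) :
    Wins E N k c d v ↔ k ≤ (greedy E N (Function.update c (d + 1) v) (d + 1)).2 ∨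
      Wins E N k (Function.update c (d + 1) v) (d + 1) (v + 1) ∨ Wins E N k c d (v + 1) := by
  have hup : ∀ t ≤ d, Function.update c (d + 1) v t = c t := fun t ht =>
    Function.update_of_ne (by omega) _ _
  have hself : Function.update c (d + 1) v (d + 1) = v := Function.update_self ..
  constructor
  · rintro ⟨b, e, hde, hb, hv, hch, hk⟩
    rcases hv.lt_or_eq with hv | hv
    · exact .inr (.inr ⟨b, e, hde, hb, hv, hch, hk⟩)
    have hb' : ∀ t ≤ d + 1, b t = Function.update c (d + 1) v t := by
      intro t ht
      rcases Nat.le_succ_iff.1 ht with ht | rfl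
      · rw [hup t ht, hb t ht]
      · rw [hself, hv]
    rcases (Nat.succ_le_of_lt hde).lt_or_eq with he | he
    · refine .inr (.inl ⟨b, e, he, hb', ?_, fun t h1 h2 => hch t (by omega) h2, hk⟩)
      have := (hch (d + 1) (by omega) he).1
      omega
    · subst he
      left
      rwa [← greedy_congr hb']
  · rintro (hk | ⟨b, e, hde, hb, hv, hch, hk⟩ | ⟨b, e, hde, hb, hv, hch, hk⟩)
    · refine ⟨_, d + 1, by omega, hup, hself.ge, fun t h1 h2 => ?_, hk⟩
      obtain rfl : t = d := by omega
      rw [hup t le_rfl, hself]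
      exact ⟨hlt, h⟩
    · have hbd : b d = c d := by rw [hb d (by omega), hup d le_rfl]
      have hbd' : b (d + 1) = v := by rw [hb _ le_rfl, hself]
      refine ⟨b, e, by omega, fun t ht => by rw [hb t (by omega), hup t ht], hbd'.ge,
        fun t h1 h2 => ?_, hk⟩
      by_cases htd : t = d
      · rw [htd, hbd, hbd']; exact ⟨hlt, h⟩
      · exact hch t (by omega) h2
    · exact ⟨b, e, hde, hb, by omega, hch, hk⟩

end

section

variable {w n m sg k : ℕ} {E : ℕ → ℕ → ℕ → Prop} {N : ℕ → Prop} {s : St Var Mem}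

theorem single_does (hN : Net w n m sg E N s) :
    Does w single s (n * (100 * (n * (n + m + sg)) + 7) + 2) fun s' =>
      s'.reg .lose = 0 ↔ s.reg .lose = 0 ∨ ∃ i < n, ∀ a, N a → E i a i := by
  have h1 : 1 % 2 ^ w = 1 := Nat.mod_eq_of_lt hN.one_lt
  refine (Does.loop_const (fun j s' => s'.reg .lose = 0 ↔ s.reg .lose = 0 ∨
      ∃ i < j, ∀ a, N a → E i a i) 0 n (100 * (n * (n + m + sg)) + 5) (by simp) (by omega) hN.n_lt
    (by simp) (fun s' h => eval_of_agree h hN.reg_n rfl) rfl ?_ (by simp)).mono le_rfl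
    fun s' _ h => h.1
  rintro i s₀ - hi hir ha₀ hI
  have hN₀ := hN.agree ha₀
  refine Does.seq (T₁ := 3) (T₂ := 100 * (n * (n + m + sg)) + 2)
    (Q₁ := fun s' => s'.mem .ch 0 = i ∧ s'.reg .s = 0 ∧ s'.reg .d = 0)
    (Does.straight rfl le_rfl (by simp [hir])) ?_ (by omega)
  rintro s₁ ha₁ ⟨hc₁, hs₁, hd₁⟩
  have hN₁ := hN₀.agree ha₁
  refine Does.seq (T₂ := 2) (test_does hN₁ rfl hs₁ hd₁ (by omega) ⟨le_rfl, fun t _ ht => ?_,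
    fun t _ ht => by omega⟩) ?_ (by omega)
  · obtain rfl : t = 0 := by omega
    omega
  intro s₂ ha₂ hok
  have hlose : s₂.reg .lose = s₀.reg .lose := (ha₂.1 .lose rfl).trans (ha₁.1 .lose rfl)
  have hcov : Covers E N (s₁.mem .ch) 0 0 ↔ ∀ a, N a → E i a i := by
    rw [← hc₁]
    constructor
    · rintro ⟨f, -, hf⟩ a ha
      by_contra h
      have := hf a ⟨ha, fun t _ ht => by
        obtain rfl : t = 0 := by omega
        exact h⟩
      omega
    · intro h
      have hM : ∀ a, ¬ Missing E N (s₁.mem .ch) 0 0 a := fun a ha => ha.2 0 le_rfl le_rfl (h a ha.1)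
      exact ⟨id, fun a ha => absurd ha (hM a), fun a ha => absurd ha (hM a)⟩
  rw [hcov] at hok
  have hsplit : (∃ i' < i + 1, ∀ a, N a → E i' a i') ↔
      (∃ i' < i, ∀ a, N a → E i' a i') ∨ ∀ a, N a → E i a i := by
    simp only [Nat.lt_succ_iff_lt_or_eq, or_and_right, exists_or, exists_eq_left]
  refine Does.straight rfl le_rfl ?_
  simp only [hsplit, ← or_assoc, ← hI]
  by_cases h : ∀ a, N a → E i a i
  · simp [h1, hok.2 h, h]
    exact .inr h
  · simp [h1, mt hok.1 h, h, hlose]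

/-- The state of the search; `W` says whether it will succeed. -/
structure Searching (n k : ℕ) (E : ℕ → ℕ → ℕ → Prop) (N : ℕ → Prop) (W : Prop) (s : St Var Mem) :
    Prop where
  lt : ∀ t ≤ s.reg .d, s.mem .ch t < n
  chain : IsChain E (s.mem .ch) 0 (s.reg .d)
  arches : ∀ t ≤ s.reg .d, s.mem .stt t = (greedy E N (s.mem .ch) t).1 ∧
    s.mem .ct t = (greedy E N (s.mem .ch) t).2
  le : s.reg .v ≤ n
  last_lt : s.mem .ch (s.reg .d) < s.reg .v
  few : (greedy E N (s.mem .ch) (s.reg .d)).2 < k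
  lose : s.reg .lose ≠ 0
  iff : W ↔ Wins E N k (s.mem .ch) (s.reg .d) (s.reg .v) ∨
    ∃ i < s.reg .d, Wins E N k (s.mem .ch) i (s.mem .ch (i + 1) + 1)

/-- The invariant of the search. -/
def SearchInv (n k : ℕ) (E : ℕ → ℕ → ℕ → Prop) (N : ℕ → Prop) (W : Prop) (s : St Var Mem) : Prop :=
  (s.reg .run = 1 ∧ Searching n k E N W s) ∨ (s.reg .run = 0 ∧ (s.reg .lose = 0 ↔ W))

/-- A bound for the number of remaining steps of the search. -/
def searchPotential (n : ℕ) (s : St Var Mem) : ℕ :=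
  if s.reg .run = 1 then 3 * 2 ^ (n - s.reg .v) +
    ∑ i ∈ Finset.Ico 1 (s.reg .d + 1), 3 * 2 ^ (n - 1 - s.mem .ch i) + (n - s.reg .d) else 0

theorem IsChain.lt_of_searching {W : Prop} {v : ℕ} (hS : Searching n k E N W s) (hv : s.reg .v = v)
    (hvn : v < n) : Ascending n (Function.update (s.mem .ch) (s.reg .d + 1) v) 0 (s.reg .d + 1) := by
  refine ⟨by omega, fun t _ ht => ?_, fun t _ ht => ?_⟩
  · rw [Function.update_apply]
    split_ifs
    · exact hvn
    · exact hS.lt t (by omega)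
  · rw [Function.update_of_ne (by omega), Function.update_apply]
    split_ifs with h
    · obtain rfl : t = s.reg .d := by omega
      exact hv ▸ hS.last_lt
    · exact (hS.chain t (by omega) (by omega)).1

theorem push_does {W : Prop} (hN : Net w n m sg E N s) (hk : s.reg .kk = k)
    (hrun : s.reg .run = 1) (hS : Searching n k E N W s)
    (hvn : s.reg .v < n) (hE : ∃ a, E (s.mem .ch (s.reg .d)) a (s.reg .v)) :
    Does w push s (100 * (n * (n + m + sg)) + 12) fun s' =>
      (s'.reg .run = 0 ∧ s'.reg .lose = 0 ∧ W) ∨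
      (s'.reg .run = 1 ∧ s'.reg .d = s.reg .d + 1 ∧ s'.reg .d < n ∧
        s'.mem .ch = Function.update (s.mem .ch) (s.reg .d + 1) (s.reg .v) ∧
        ∀ v, v = s.reg .v + 1 → Searching n k E N W (s'.setReg .v v)) := by
  have h1 : 1 % 2 ^ w = 1 := Nat.mod_eq_of_lt hN.one_lt
  have hnw := hN.n_lt
  have hasc := IsChain.lt_of_searching hS rfl hvn
  set d := s.reg .d with hd
  set v := s.reg .v with hv
  set c := Function.update (s.mem .ch) (d + 1) v with hc
  have hdn : d + 1 < n := by
    have := hasc.le_apply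
    rw [hc, Function.update_self] at this
    omega
  have hcc : ∀ t ≤ d, c t = s.mem .ch t := fun t ht => Function.update_of_ne (by omega) _ _
  have hself : c (d + 1) = v := Function.update_self ..
  have hgr := hS.arches d le_rfl
  have hg1 := greedy_fst_le (E := E) (N := N) (s.mem .ch) d
  have hg2 := greedy_snd_le (E := E) (N := N) (s.mem .ch) d
  set x := greedy E N (s.mem .ch) d with hx
  have hxc : greedy E N c d = x := greedy_congr hcc
  have hm : ∀ y ≤ d, (y + 1) % 2 ^ w = y + 1 := fun y hy => Nat.mod_eq_of_lt (by omega)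
  have hm' : ∀ y ≤ d, y % 2 ^ w = y := fun y hy => Nat.mod_eq_of_lt (by omega)
  refine Does.seq (T₁ := 4) (T₂ := 100 * (n * (n + m + sg)) + 8)
    (Q₁ := fun s' => s'.reg .s = x.1 ∧ s'.reg .cnt = x.2 ∧ s'.reg .d = d + 1 ∧ s'.mem .ch = c)
    (Does.straight rfl le_rfl ?_) ?_ (by omega)
  · simp [← hd, ← hv, hgr, hm d le_rfl, hm' _ hg1, hm' _ hg2, h1, hc]
  rintro s₁ ha₁ ⟨hs₁, hcnt₁, hd₁, hc₁⟩
  have hN₁ := hN.agree ha₁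
  refine Does.seq (T₂ := 8) (test_does hN₁ hc₁ hs₁ hd₁ hdn ⟨by omega, fun t _ ht =>
    hasc.lt t (by omega) ht, fun t _ ht => hasc.step t (by omega) ht⟩) ?_ (by omega)
  intro s₂ ha₂ hok
  have hd₂ : s₂.reg .d = d + 1 := (ha₂.1 .d rfl).trans hd₁
  have hs₂ : s₂.reg .s = x.1 := (ha₂.1 .s rfl).trans hs₁
  have hcnt₂ : s₂.reg .cnt = x.2 := (ha₂.1 .cnt rfl).trans hcnt₁
  have hc₂ : s₂.mem .ch = c := (ha₂.2 .ch rfl).trans hc₁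
  have hkk₂ : s₂.reg .kk = k := (ha₂.1 .kk rfl).trans ((ha₁.1 .kk rfl).trans hk)
  have hrun₂ : s₂.reg .run = 1 := (ha₂.1 .run rfl).trans ((ha₁.1 .run rfl).trans hrun)
  have hlose₂ : s₂.reg .lose ≠ 0 := by
    rw [ha₂.1 .lose rfl, ha₁.1 .lose rfl]
    exact hS.lose
  have hstt₂ : s₂.mem .stt = s.mem .stt := (ha₂.2 .stt rfl).trans (ha₁.2 .stt rfl)
  have hct₂ : s₂.mem .ct = s.mem .ct := (ha₂.2 .ct rfl).trans (ha₁.2 .ct rfl)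
  have hwin := wins_of_edge (N := N) (k := k) hS.last_lt hE
  rw [← hd, ← hv, ← hc] at hwin
  have hgreedy : greedy E N c (d + 1) = if s₂.reg .ok = 1 then (d + 1, x.2 + 1) else x := by
    rw [greedy, hxc]
    by_cases h : s₂.reg .ok = 1
    · rw [if_pos h, if_pos (hok.1 h)]
    · rw [if_neg h, if_neg (mt hok.2 h)]
  have hnew : ∀ s' : St Var Mem, ¬ k ≤ (greedy E N c (d + 1)).2 → s'.reg .d = d + 1 →
      s'.mem .ch = c → s'.reg .lose ≠ 0 → s'.reg .v = v + 1 →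
      s'.mem .stt = Function.update (s.mem .stt) (d + 1) (greedy E N c (d + 1)).1 →
      s'.mem .ct = Function.update (s.mem .ct) (d + 1) (greedy E N c (d + 1)).2 →
      Searching n k E N W s' := by
    intro s' hk' e1 e2 e3 e4 e5 e6
    refine ⟨fun t ht => ?_, fun t _ ht => ?_, fun t ht => ?_, by omega, ?_, ?_, e3, ?_⟩
    · rw [e2]; exact hasc.lt t (by omega) (by omega)
    · rw [e2]
      rw [e1] at ht
      by_cases htd : t = d
      · rw [htd, hcc d le_rfl, hself]; exact ⟨hS.last_lt, hE⟩
      · rw [hcc t (by omega), hcc (t + 1) (by omega)]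
        exact hS.chain t (by omega) (by omega)
    · rw [e2, e5, e6]
      rw [e1] at ht
      by_cases htd : t = d + 1
      · rw [htd, Function.update_self, Function.update_self]; exact ⟨rfl, rfl⟩
      · rw [Function.update_of_ne htd, Function.update_of_ne htd,
          greedy_congr (c' := s.mem .ch) fun u hu => hcc u (by omega)]
        exact hS.arches t (by omega)
    · rw [e1, e2, e4, hself]; omega
    · rw [e1, e2]; omega
    · rw [hS.iff, e1, e2, e4, ← hd, ← hv, hwin, or_iff_right hk', or_assoc]
      refine or_congr_right ?_
      have hsplit : (∃ i < d + 1, Wins E N k c i (c (i + 1) + 1)) ↔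
          (∃ i < d, Wins E N k c i (c (i + 1) + 1)) ∨ Wins E N k c d (c (d + 1) + 1) := by
        simp only [Nat.lt_succ_iff_lt_or_eq, or_and_right, exists_or, exists_eq_left]
      rw [hsplit, hself, or_comm]
      refine or_congr (exists_congr fun i => and_congr_right fun hi => ?_)
        (Wins.congr fun t ht => (hcc t ht).symm)
      rw [hcc (i + 1) hi]
      exact Wins.congr fun t ht => (hcc t (by omega)).symm
  refine Does.straight rfl (by decide) ?_
  by_cases h : s₂.reg .ok = 1
  · rw [if_pos h] at hgreedy
    by_cases hlt : x.2 + 1 < k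
    · right
      simp [h, h1, hd₂, hcnt₂, hm _ hg2, hkk₂, hlt, hrun₂, hdn, hc₂]
      refine hnew _ (by rw [hgreedy]; simpa using hlt) ?_ ?_ ?_ ?_ ?_ ?_ <;>
        simp [hd₂, hc₂, hlose₂, hstt₂, hct₂, hgreedy]
    · left
      simp [h, h1, hd₂, hcnt₂, hm _ hg2, hkk₂, hlt]
      rw [hS.iff, ← hd, ← hv, hwin]
      exact .inl (.inl (by rw [hgreedy]; simpa using hlt))
  · rw [if_neg h] at hgreedy
    right
    simp [h, h1, hd₂, hcnt₂, hs₂, hrun₂, hdn, hc₂]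
    refine hnew _ (by rw [hgreedy]; simpa using hS.few) ?_ ?_ ?_ ?_ ?_ ?_ <;>
      simp [hd₂, hc₂, hlose₂, hstt₂, hct₂, hgreedy]

theorem two_pow_sub {n v : ℕ} (h : v < n) : 2 ^ (n - v) = 2 ^ (n - (v + 1)) + 2 ^ (n - (v + 1)) := by
  rw [show n - v = n - (v + 1) + 1 by omega, pow_succ, mul_two]

theorem advance_does {W : Prop} (hN : Net w n m sg E N s) (hk : s.reg .kk = k)
    (hrun : s.reg .run = 1) (hS : Searching n k E N W s) :
    Does w advance s (150 * (n * (n + m + sg))) fun s' => SearchInv n k E N W s' ∧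
      searchPotential n s' < searchPotential n s := by
  have h1 : 1 % 2 ^ w = 1 := Nat.mod_eq_of_lt hN.one_lt
  have hnw := hN.n_lt
  have hmw := hN.m_lt
  have hlast := hS.last_lt
  have hvn := hS.le
  have hasc : Ascending n (s.mem .ch) 0 (s.reg .d) :=
    ⟨Nat.zero_le _, fun t _ ht => hS.lt t ht, fun t h1 h2 => (hS.chain t h1 h2).1⟩
  have hdn : s.reg .d < n := by
    have := hasc.le_apply
    have := hS.lt _ le_rfl
    omega
  have hcn := hS.lt _ le_rfl
  set d := s.reg .d with hd
  set v := s.reg .v with hv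
  refine Does.ite (T₁ := 100 * (n * (n + m + sg)) + 4 * m + 20) (fun hlt => ?_) (fun hlt => ?_) ?_
  · simp only [Cond.holds, Exp.eval, hN.reg_n, ← hv] at hlt
    have hG := hN.grouped
    have hoffm : s.mem .off (s.mem .ch d + 1) ≤ m := (hG.off_le hcn le_rfl).trans hG.le
    have hpow := two_pow_sub hlt
    have hpos := Nat.two_pow_pos (n - (v + 1))
    refine Does.seq (T₁ := 3) (T₂ := 100 * (n * (n + m + sg)) + 4 * m + 17)
      (Q₁ := fun s' => s'.reg .fl = 0 ∧ s'.reg .c = s.mem .ch d ∧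
        s'.reg .hi = s.mem .off (s.mem .ch d + 1)) (Does.straight rfl le_rfl ?_) ?_ (by omega)
    · simp [← hd, h1, Nat.mod_eq_of_lt (show s.mem .ch d < 2 ^ w by omega),
        Nat.mod_eq_of_lt (show s.mem .ch d + 1 < 2 ^ w by omega),
        Nat.mod_eq_of_lt (show s.mem .off (s.mem .ch d + 1) < 2 ^ w by omega)]
    rintro s₁ ha₁ ⟨hfl₁, hc₁, hhi₁⟩
    refine Does.seq (T₁ := m * 4 + 2) (T₂ := 100 * (n * (n + m + sg)) + 14)
      (Does.loop_const (fun x s' => s'.reg .fl ≤ 1 ∧ (s'.reg .fl = 1 ↔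
        ∃ y, s.mem .off (s.mem .ch d) ≤ y ∧ y < x ∧ s.mem .sv y = v))
        (s.mem .off (s.mem .ch d)) (s.mem .off (s.mem .ch d + 1)) 2 ?_ (hG.mono _ hcn) (by omega) ?_
        (fun s' h => eval_of_agree h hhi₁ rfl) rfl ?_ ?_) ?_ (by omega)
    · have hoff₁ : s₁.mem .off = s.mem .off := ha₁.2 .off rfl
      simp [hc₁, hoff₁]
    · simp only [St.setReg_reg, reduceCtorEq, if_false, hfl₁]
      refine ⟨by omega, by simp; omega⟩
    · rintro x s' hx1 hx2 hxr ha ⟨hle, hI⟩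
      have hsv : s'.mem .sv = s.mem .sv := (ha.2 .sv rfl).trans (ha₁.2 .sv rfl)
      have hv' : s'.reg .v = v := (ha.1 .v rfl).trans (ha₁.1 .v rfl)
      have hsplit : (∃ y, s.mem .off (s.mem .ch d) ≤ y ∧ y < x + 1 ∧ s.mem .sv y = v) ↔
          (∃ y, s.mem .off (s.mem .ch d) ≤ y ∧ y < x ∧ s.mem .sv y = v) ∨ s.mem .sv x = v := by
        constructor
        · rintro ⟨y, h1, h2, h3⟩
          rcases Nat.lt_succ_iff_lt_or_eq.1 h2 with h2 | rfl
          · exact .inl ⟨y, h1, h2, h3⟩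
          · exact .inr h3
        · rintro (⟨y, h1, h2, h3⟩ | h3)
          · exact ⟨y, h1, by omega, h3⟩
          · exact ⟨x, hx1, by omega, h3⟩
      refine Does.straight rfl le_rfl ?_
      rw [hsplit, ← hI]
      by_cases h : s.mem .sv x = v
      · simp [hxr, hsv, hv', h, h1]
      · simp [hxr, hsv, hv', h, h1, hle]
    · have : s.mem .off (s.mem .ch d + 1) - s.mem .off (s.mem .ch d) ≤ m := by omega
      omega
    rintro s₂ ha₂ ⟨⟨-, hfl⟩, -⟩
    have hN₂ := (hN.agree ha₁).agree ha₂
    have hfl' : s₂.reg .fl = 1 ↔ ∃ a, E (s.mem .ch d) a v := by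
      rw [hfl]
      constructor
      · rintro ⟨y, h1, h2, h3⟩
        exact ⟨s.mem .sl y, (hG.mem _ hcn _ _).1 ⟨y, h1, h2, rfl, h3⟩⟩
      · rintro ⟨a, ha⟩
        obtain ⟨y, h1, h2, -, h3⟩ := (hG.mem _ hcn _ _).2 ha
        exact ⟨y, h1, h2, h3⟩
    have hreg : ∀ x, x ≠ .fl → x ≠ .c → x ≠ .hi → x ≠ .x → s₂.reg x = s.reg x := by
      intro x h1 h2 h3 h4
      rw [ha₂.1 x (by simp [Cmd.loop, Cmd.wr, h1, h4]), ha₁.1 x (by simp [Cmd.wr, h1, h2, h3])]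
    have hmem : s₂.mem = s.mem := by
      funext a
      rw [ha₂.2 a rfl, ha₁.2 a rfl]
    have hS₂ : Searching n k E N W s₂ := by
      have e1 := hreg .d (by decide) (by decide) (by decide) (by decide)
      have e2 := hreg .v (by decide) (by decide) (by decide) (by decide)
      have e3 := hreg .lose (by decide) (by decide) (by decide) (by decide)
      refine ⟨?_, ?_, ?_, ?_, ?_, ?_, ?_, ?_⟩ <;> simp only [e1, e2, e3, hmem]
      exacts [hS.lt, hS.chain, hS.arches, hS.le, hS.last_lt, hS.few, hS.lose, hS.iff]
    have hd₂ : s₂.reg .d = d := hreg .d (by decide) (by decide) (by decide) (by decide)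
    have hv₂ : s₂.reg .v = v := hreg .v (by decide) (by decide) (by decide) (by decide)
    have hrun₂ : s₂.reg .run = 1 :=
      (hreg .run (by decide) (by decide) (by decide) (by decide)).trans hrun
    have hkk₂ : s₂.reg .kk = k := (hreg .kk (by decide) (by decide) (by decide) (by decide)).trans hk
    have hvm : (v + 1) % 2 ^ w = v + 1 := Nat.mod_eq_of_lt (by omega)
    by_cases hf : s₂.reg .fl = 1
    · refine Does.seq (T₁ := 100 * (n * (n + m + sg)) + 13) (T₂ := 1)
        (Does.ite (T₁ := 100 * (n * (n + m + sg)) + 12) (fun _ => push_does hN₂ hkk₂ hrun₂ hS₂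
          (by omega) (by rw [hmem, hd₂, hv₂]; exact hfl'.1 hf))
          (fun h => absurd (by simpa [h1] using hf) h) le_rfl) ?_ le_rfl
      intro s₃ ha₃ h₃
      have hv₃ : s₃.reg .v = v := (ha₃.1 .v rfl).trans hv₂
      refine Does.straight rfl le_rfl ?_
      simp only [Cmd.denote, Exp.eval, BinOp.eval, hv₃, h1, hvm]
      rcases h₃ with ⟨hr, hl, hW⟩ | ⟨hr, hd₃, hdn₃, hc₃, hS₃⟩
      · refine ⟨.inr ⟨by simpa using hr, by simp [hl, hW]⟩, ?_⟩
        simp only [searchPotential, St.setReg_reg, reduceCtorEq, if_false, hr, hrun]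
        simp
      · refine ⟨.inl ⟨by simpa using hr, hS₃ _ (by rw [hv₂])⟩, ?_⟩
        rw [hd₂, hmem, hv₂] at hc₃
        rw [hd₂] at hd₃
        simp only [searchPotential, St.setReg_reg, St.setReg_mem, reduceCtorEq, if_false, hr, hrun,
          if_true, hd₃, hc₃]
        rw [Finset.sum_Ico_succ_top (by omega), Function.update_self, ← hd, ← hv]
        have hsum : ∑ i ∈ Finset.Ico 1 (d + 1),
            3 * 2 ^ (n - 1 - Function.update (s.mem .ch) (d + 1) v i) =
            ∑ i ∈ Finset.Ico 1 (d + 1), 3 * 2 ^ (n - 1 - s.mem .ch i) := by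
          refine Finset.sum_congr rfl fun i hi => ?_
          rw [Finset.mem_Ico] at hi
          rw [Function.update_of_ne (by omega)]
        rw [hsum, show n - 1 - v = n - (v + 1) by omega]
        omega
    · refine Does.seq (T₁ := 1) (T₂ := 1) (Q₁ := fun s' => s' = s₂)
        (Does.ite (T₁ := 0) (fun h => absurd (by simpa [h1] using h) hf)
          (fun h => Does.straight rfl le_rfl rfl) le_rfl) ?_ (by omega)
      rintro _ - rfl
      refine Does.straight rfl le_rfl ?_
      simp only [Cmd.denote, Exp.eval, BinOp.eval, hv₂, h1, hvm]
      refine ⟨.inl ⟨by simpa using hrun₂, ?_⟩, ?_⟩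
      · refine ⟨?_, ?_, ?_, ?_, ?_, ?_, ?_, ?_⟩ <;>
          simp only [St.setReg_reg, St.setReg_mem, reduceCtorEq, if_false, if_true]
        · exact hS₂.lt
        · exact hS₂.chain
        · exact hS₂.arches
        · exact hlt
        · have := hS₂.last_lt
          omega
        · exact hS₂.few
        · exact hS₂.lose
        · rw [hS₂.iff, hv₂, wins_of_not_edge]
          rw [hmem, hd₂]
          exact mt hfl'.2 hf
      · simp only [searchPotential, St.setReg_reg, St.setReg_mem, reduceCtorEq, if_false, hrun₂, hrun,
          if_true, hd₂, hmem, ← hd, ← hv]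
        omega
  · simp only [Cond.holds, Exp.eval, hN.reg_n, ← hv] at hlt
    have hvn' : v = n := by omega
    have hW := hS.iff
    rw [← hv, hvn', or_iff_right (not_wins hN.target_lt)] at hW
    refine Does.straight rfl ((by decide : _ ≤ 4).trans (by omega)) ?_
    by_cases hd0 : d = 0
    · simp only [← hd, hd0, Nat.not_lt_zero, false_and, exists_false, iff_false] at hW
      simp [← hd, hd0, SearchInv, searchPotential, hrun, hS.lose, hW]
    · have hch1 : (s.mem .ch d + 1) % 2 ^ w = s.mem .ch d + 1 := Nat.mod_eq_of_lt (by omega)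
      have hd1 : (d + (2 ^ w - 1)) % 2 ^ w = d - 1 := by
        rw [show d + (2 ^ w - 1) = d - 1 + 2 ^ w by omega, Nat.add_mod_right]
        exact Nat.mod_eq_of_lt (by omega)
      have hd2 : (d - 1) % 2 ^ w = d - 1 := Nat.mod_eq_of_lt (by omega)
      obtain ⟨d', hd'⟩ : ∃ d', d = d' + 1 := ⟨d - 1, by omega⟩
      have hstep := (hS.chain d' (Nat.zero_le _) (by omega)).1
      simp only [Cmd.denote, Cond.holds, Exp.eval, BinOp.eval, ← hd, hd0, Nat.zero_mod, if_false,
        St.setReg_reg, reduceCtorEq, h1, Nat.mod_mod, hch1, hd1, hd2]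
      refine ⟨.inl ⟨by simpa using hrun, ?_⟩, ?_⟩
      · refine ⟨?_, ?_, ?_, ?_, ?_, ?_, ?_, ?_⟩ <;>
          simp only [St.setReg_reg, St.setReg_mem, reduceCtorEq, if_false, if_true]
        · exact fun t ht => hS.lt t (by omega)
        · exact fun t h1 h2 => hS.chain t h1 (by omega)
        · exact fun t ht => hS.arches t (by omega)
        · omega
        · rw [hd', Nat.add_sub_cancel]; omega
        · refine (greedy_snd_mono _ (Nat.sub_le d 1)).trans_lt ?_
          exact hS.few
        · exact hS.lose
        · rw [hW, ← hd, hd', Nat.add_sub_cancel, ← hd']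
          simp only [hd', Nat.lt_succ_iff_lt_or_eq, or_and_right, exists_or, exists_eq_left]
          exact or_comm
      · simp only [searchPotential, St.setReg_reg, St.setReg_mem, reduceCtorEq, if_false, hrun,
          if_true, ← hd, ← hv]
        rw [hd', Nat.add_sub_cancel, Finset.sum_Ico_succ_top (by omega : 1 ≤ d' + 1), ← hd',
          show n - 1 - s.mem .ch d = n - (s.mem .ch d + 1) by omega, hvn', Nat.sub_self,
          pow_zero]
        omega
  · have : 1 ≤ n := by omega
    nlinarith

theorem search_does {i₀ : ℕ} (hN : Net w n m sg E N s) (hk : s.reg .kk = k) (hk0 : 1 ≤ k)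
    (hi₀ : s.mem .ids (s.reg .q0) = i₀) (hi : i₀ < n) (hlose : s.reg .lose ≠ 0) :
    Does w search s (2 ^ n * (800 * (n * (n + m + sg)))) fun s' =>
      s'.reg .lose = 0 ↔ Wins E N k (fun _ => i₀) 0 (i₀ + 1) := by
  have h1 : 1 % 2 ^ w = 1 := Nat.mod_eq_of_lt hN.one_lt
  have hnw := hN.n_lt
  have hB : 1 ≤ n * (n + m + sg) := Nat.mul_pos (by omega) (by omega)
  set B := n * (n + m + sg) with hB'
  have hpow : 1 ≤ 2 ^ n := Nat.one_le_two_pow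
  have hnp : n < 2 ^ n := Nat.lt_two_pow_self
  refine Does.seq (T₁ := 6) (T₂ := (3 * 2 ^ n + n) * (150 * B + 1) + 1)
    (Q₁ := fun s' => s'.reg .run = 1 ∧ s'.mem .ch 0 = i₀ ∧ s'.mem .stt 0 = 0 ∧ s'.mem .ct 0 = 0 ∧
      s'.reg .d = 0 ∧ s'.reg .v = i₀ + 1) (Does.straight rfl le_rfl ?_) ?_ ?_
  · simp [h1, hi₀, Nat.mod_eq_of_lt (show i₀ + 1 < 2 ^ w by omega)]
  · rintro s₁ ha₁ ⟨hrun, hch, hstt, hct, hd, hv⟩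
    have hN₁ := hN.agree ha₁
    have hk₁ : s₁.reg .kk = k := (ha₁.1 .kk rfl).trans hk
    have hS : Searching n k E N (Wins E N k (fun _ => i₀) 0 (i₀ + 1)) s₁ := by
      refine ⟨?_, ?_, ?_, ?_, ?_, ?_, fun h => hlose ((ha₁.1 .lose rfl).symm.trans h), ?_⟩ <;> try rw [hd]
      · intro t ht
        obtain rfl : t = 0 := by omega
        omega
      · exact fun t _ ht => by omega
      · intro t ht
        obtain rfl : t = 0 := by omega
        exact ⟨hstt, hct⟩
      · omega
      · omega
      · exact hk0
      · simp only [Nat.not_lt_zero, false_and, exists_false, or_false, hv]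
        refine Wins.congr fun t ht => ?_
        obtain rfl : t = 0 := by omega
        exact hch.symm
    refine (Does.while_ (SearchInv n k E N (Wins E N k (fun _ => i₀) 0 (i₀ + 1)))
      (fun s' => searchPotential n s' * (150 * B + 1)) (.inl ⟨hrun, hS⟩) ?_ ?_).mono le_rfl ?_
    · intro s₂ ha₂ hI hcond
      simp only [Cond.holds, Exp.eval, h1] at hcond
      rcases hI with ⟨-, hS₂⟩ | ⟨h0, -⟩
      · refine ⟨150 * B, (advance_does (hN₁.agree ha₂) ((ha₂.1 .kk rfl).trans hk₁) hcond
          hS₂).mono le_rfl ?_⟩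
        rintro s₃ - ⟨hI, hlt⟩
        refine ⟨hI, ?_⟩
        have := Nat.mul_le_mul_right (150 * B + 1) (Nat.succ_le_of_lt hlt)
        rw [Nat.succ_mul] at this
        omega
      · omega
    · refine Nat.add_le_add_right (Nat.mul_le_mul_right _ ?_) 1
      simp only [searchPotential, hrun, if_true, hd, hv]
      simp only [zero_add, Finset.Ico_self, Finset.sum_empty, add_zero, Nat.sub_zero]
      have := Nat.pow_le_pow_right (n := 2) (by omega) (Nat.sub_le n (i₀ + 1))
      omega
    · rintro s₂ - ⟨hI, hcond⟩
      simp only [Cond.holds, Exp.eval, h1] at hcond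
      rcases hI with ⟨h, -⟩ | ⟨-, h⟩
      · exact absurd h hcond
      · exact h
  · have h2 : (3 * 2 ^ n + n) * (150 * B + 1) ≤ (4 * 2 ^ n) * (151 * B) :=
      Nat.mul_le_mul (by omega) (by omega)
    have h3 : 1 ≤ 2 ^ n * B := Nat.mul_pos hpow hB
    have h4 : 2 ^ n * (800 * B) = 800 * (2 ^ n * B) := by ring
    have h5 : (4 * 2 ^ n) * (151 * B) = 604 * (2 ^ n * B) := by ring
    omega

end

end ESU

/-! ### Reading the input -/

namespace ESU

open WordRAM

theorem getD_of_drop {l l' : List ℕ} {p a : ℕ} (h : l.drop p = a :: l') :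
    l.getD p 0 = a ∧ l.drop (p + 1) = l' ∧ p < l.length := by
  have hp : p < l.length := by
    by_contra hp
    rw [List.drop_eq_nil_of_le (not_lt.1 hp)] at h
    cases h
  rw [List.drop_eq_getElem_cons hp] at h
  obtain ⟨h1, h2⟩ := List.cons.inj h
  exact ⟨by rw [List.getD_eq_getElem _ _ hp, h1], h2, hp⟩

theorem lt_length_of_drop {l l' : List ℕ} {p a : ℕ} (h : l.drop p = a :: l') (hl : l' ≠ []) :
    p + 1 < l.length := by
  have := congrArg List.length h
  have := List.length_pos_of_ne_nil hl
  simp only [List.length_drop, List.length_cons] at *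
  omega

/-- The transitions in the list are stored in the memory. -/
def Stored (l : List (ℕ × ℕ × ℕ)) (s : St Var Mem) : Prop :=
  ∀ i x, l[i]? = some x → s.mem .src i = x.1 ∧ s.mem .lab i = x.2.1 ∧ s.mem .dst i = x.2.2

theorem Stored.append {l : List (ℕ × ℕ × ℕ)} {s s' : St Var Mem} {x : ℕ × ℕ × ℕ}
    (h : Stored l s) (h1 : s'.mem .src = Function.update (s.mem .src) l.length x.1)
    (h2 : s'.mem .lab = Function.update (s.mem .lab) l.length x.2.1)
    (h3 : s'.mem .dst = Function.update (s.mem .dst) l.length x.2.2) : Stored (l ++ [x]) s' := by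
  intro i y hy
  rw [h1, h2, h3]
  by_cases hi : i = l.length
  · rw [hi, List.getElem?_concat_length, Option.some_inj] at hy
    simp [hi, hy]
  · have hlt : i < l.length := by
      have := (List.getElem?_eq_some_iff.1 hy).1
      simp at this
      omega
    rw [List.getElem?_append_left hlt] at hy
    simpa [hi] using h i y hy

namespace NFAData

def encodeEdge (A : NFAData) (q : Fin A.n) (e : Option (Fin A.σ) × Fin A.n) : ℕ × ℕ × ℕ :=
  (q, encodeLabel e.1, e.2)

/-- The transitions in the order of the input. -/
def edges (A : NFAData) (l : List (Fin A.n)) : List (ℕ × ℕ × ℕ) :=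
  l.flatMap fun q => (A.trans q).map (A.encodeEdge q)

theorem edges_append (A : NFAData) (l l' : List (Fin A.n)) :
    A.edges (l ++ l') = A.edges l ++ A.edges l' := List.flatMap_append

theorem length_edges (A : NFAData) : (A.edges (List.finRange A.n)).length = A.m := by
  simp only [edges, List.length_flatMap, List.length_map, m]
  rw [← List.sum_ofFn, List.ofFn_eq_map]

end NFAData

theorem readState_does {w : ℕ} {A : NFAData} {input rest : List ℕ} {s : St Var Mem} {q : Fin A.n}
    {l : List (ℕ × ℕ × ℕ)} (hlen : input.length ≤ 2 ^ w) (hword : ∀ v ∈ input, v < 2 ^ w)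
    (hw : 1 < 2 ^ w)
    (hinp : s.mem .inp = fun i => input.getD i 0) (hrest : rest ≠ []) (hq : s.reg .q = q)
    (hdrop : input.drop (s.reg .pos) = A.encodeState q ++ rest) (hl : Stored l s)
    (he : s.reg .e = l.length) (hle : s.reg .e ≤ s.reg .pos) :
    Does w ((.store .fin (V .q) (M .inp .pos) ;; incr .pos ;; .set .len (M .inp .pos) ;;
        incr .pos) ;;
      .loop .j (L 0) (V .len) (
        .store .src (V .e) (V .q) ;; .store .lab (V .e) (M .inp .pos) ;; incr .pos ;;
        .store .dst (V .e) (M .inp .pos) ;; incr .pos ;; incr .e)) s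
      ((A.trans q).length * 8 + 6) fun s' =>
      input.drop (s'.reg .pos) = rest ∧ s'.mem .fin = Function.update (s.mem .fin) q (A.final q).toNat ∧
      Stored (l ++ (A.trans q).map (A.encodeEdge q)) s' ∧
      s'.reg .e = (l ++ (A.trans q).map (A.encodeEdge q)).length ∧ s'.reg .e ≤ s'.reg .pos := by
  have h1 : 1 % 2 ^ w = 1 := Nat.mod_eq_of_lt hw
  have hmem : ∀ {p a : ℕ} {l' : List ℕ}, input.drop p = a :: l' → a < 2 ^ w := fun h =>
    hword _ (List.mem_of_mem_drop (by rw [h]; exact List.mem_cons_self))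
  simp only [NFAData.encodeState, List.cons_append] at hdrop
  set body := (A.trans q).flatMap fun e => [NFAData.encodeLabel e.1, e.2.val] with hbody
  have hne : body ++ rest ≠ [] := by simp [hrest]
  have d1 := getD_of_drop hdrop
  have b1 := lt_length_of_drop hdrop (by simp)
  have d2 := getD_of_drop d1.2.1
  have b2 := lt_length_of_drop d1.2.1 hne
  have hlen' := hmem d1.2.1
  have e1 : (s.reg .pos + 1) % 2 ^ w = s.reg .pos + 1 := Nat.mod_eq_of_lt (by omega)
  have e2 : (s.reg .pos + 1 + 1) % 2 ^ w = s.reg .pos + 1 + 1 := Nat.mod_eq_of_lt (by omega)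
  refine Does.seq (T₁ := 4) (T₂ := (A.trans q).length * 8 + 2)
    (Q₁ := fun s' => s'.mem .fin = Function.update (s.mem .fin) q (A.final q).toNat ∧
      s'.reg .pos = s.reg .pos + 2 ∧ s'.reg .len = (A.trans q).length)
    (Does.straight rfl le_rfl ?_) ?_ (by omega)
  · have d1' := d1.1
    have d2' := d2.1
    rw [List.getD_eq_getElem?_getD] at d1' d2'
    simp [hq, hinp, d1', d2', e1, e2, h1, Nat.mod_eq_of_lt hlen']
  rintro s₁ ha₁ ⟨hfin, hpos, hlen₁⟩
  have hinp₁ : s₁.mem .inp = fun i => input.getD i 0 := (ha₁.2 .inp rfl).trans hinp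
  have hq₁ : s₁.reg .q = q := (ha₁.1 .q rfl).trans hq
  have he₁ : s₁.reg .e = l.length := (ha₁.1 .e rfl).trans he
  refine (Does.loop_const (fun j s' =>
      input.drop (s'.reg .pos) = (((A.trans q).drop j).flatMap fun e =>
        [NFAData.encodeLabel e.1, e.2.val]) ++ rest ∧
      Stored (l ++ ((A.trans q).take j).map (A.encodeEdge q)) s' ∧
      s'.reg .e = (l ++ ((A.trans q).take j).map (A.encodeEdge q)).length ∧
      s'.reg .e ≤ s'.reg .pos) 0 (A.trans q).length 6 (by simp) (by omega) hlen' ?_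
    (fun s' h => eval_of_agree h hlen₁ rfl) rfl ?_ (by omega)).mono le_rfl ?_
  · simp only [St.setReg_reg, reduceCtorEq, if_false, List.drop_zero, List.take_zero, List.map_nil,
      List.append_nil, hpos]
    refine ⟨d2.2.1, fun i x hx => ?_, he₁, by omega⟩
    simp only [St.setReg_mem]
    rw [ha₁.2 .src rfl, ha₁.2 .lab rfl, ha₁.2 .dst rfl]
    exact hl i x hx
  · rintro j s' - hj hjr ha ⟨hd, hst, hee, hep⟩
    have hinp' : s'.mem .inp = fun i => input.getD i 0 := (ha.2 .inp rfl).trans hinp₁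
    have hq' : s'.reg .q = q := (ha.1 .q rfl).trans hq₁
    rw [List.drop_eq_getElem_cons hj, List.flatMap_cons] at hd
    simp only [List.cons_append, List.nil_append, List.append_assoc] at hd
    have d1 := getD_of_drop hd
    have b1 := lt_length_of_drop hd (by simp)
    have d2 := getD_of_drop d1.2.1
    have b2 := lt_length_of_drop d1.2.1 (by simp [hrest])
    have e1 : (s'.reg .pos + 1) % 2 ^ w = s'.reg .pos + 1 := Nat.mod_eq_of_lt (by omega)
    have e2 : (s'.reg .pos + 1 + 1) % 2 ^ w = s'.reg .pos + 1 + 1 := Nat.mod_eq_of_lt (by omega)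
    have e3 : (s'.reg .e + 1) % 2 ^ w = s'.reg .e + 1 := Nat.mod_eq_of_lt (by omega)
    have hcat : l ++ ((A.trans q).take (j + 1)).map (A.encodeEdge q) =
        l ++ ((A.trans q).take j).map (A.encodeEdge q) ++ [A.encodeEdge q (A.trans q)[j]] := by
      rw [List.take_succ_eq_append_getElem hj, List.map_append, List.append_assoc]
      rfl
    have d1' := d1.1
    have d2' := d2.1
    rw [List.getD_eq_getElem?_getD] at d1' d2'
    refine Does.straight rfl le_rfl ⟨?_, ?_, ?_, ?_⟩
    · simp [e1, e2, h1, d2.2.1]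
    · rw [hcat]
      refine hst.append ?_ ?_ ?_ <;>
        simp [e1, e2, h1, hee, hq', hinp', d1', d2', NFAData.encodeEdge]
    · rw [hcat, List.length_append, ← hee]
      simp [e3, h1]
    · simp [e1, e2, e3, h1]
      omega
  · rintro s' ha ⟨⟨hd, hst, hee, hep⟩, -⟩
    simp only [List.drop_length, List.take_length, List.flatMap_nil, List.nil_append] at hd hst hee
    exact ⟨hd, (ha.2 .fin rfl).trans hfin, hst, hee, hep⟩

theorem _root_.WordRAM.Does.set_seq {w T : ℕ} {r : Var} {e : Exp Var Mem} {c : Cmd Var Mem}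
    {s : St Var Mem} {Q : St Var Mem → Prop}
    (h : Does w c (s.setReg r (e.eval w s % 2 ^ w)) T Q) : Does w (.set r e ;; c) s (T + 1) Q := by
  refine Does.seq (T₁ := 1) (T₂ := T) (Q₁ := fun s' => s' = s.setReg r (e.eval w s % 2 ^ w))
    (Does.straight rfl le_rfl rfl) ?_ (by omega)
  rintro _ - rfl
  exact h

theorem _root_.WordRAM.Does.of_state {w T : ℕ} {c : Cmd Var Mem} {s : St Var Mem}
    {P Q : St Var Mem → Prop} (hs : P s) (h : ∀ s', P s' → Does w c s' T Q) : Does w c s T Q :=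
  h s hs

theorem parse_does {w : ℕ} {x : Instance} {s : St Var Mem} (hx : problem.valid w x)
    (hinp : s.mem .inp = fun i => (x.input w).getD i 0) :
    Does w parse s (8 * x.A.m + 8 * x.A.n + 20) fun s' =>
      s'.reg .n = x.A.n ∧ s'.reg .sg = x.A.σ ∧ s'.reg .q0 = x.A.initial ∧ s'.reg .m = x.A.m ∧
      s'.reg .nd = (Nat.digits (2 ^ w) x.k).length ∧
      (∀ d l, Nat.digits (2 ^ w) x.k = d :: l → s'.reg .kk = d) ∧
      (∀ q : Fin x.A.n, s'.mem .fin q = (x.A.final q).toNat) ∧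
      Stored (x.A.edges (List.finRange x.A.n)) s' ∧ x.A.m < 2 ^ w := by
  obtain ⟨-, -, hlen, hword⟩ := hx
  set A := x.A with hA
  set tail := (Nat.digits (2 ^ w) x.k).length :: Nat.digits (2 ^ w) x.k with htail
  set input := x.input w with hinput
  have hin : input = A.n :: A.σ :: A.initial.val ::
      ((List.finRange A.n).flatMap A.encodeState ++ tail) := rfl
  have hn0 : 0 < A.n := (Nat.zero_le _).trans_lt A.initial.isLt
  have hn : A.n < 2 ^ w := hword _ (by simp [hin])
  have hsg : A.σ < 2 ^ w := hword _ (by simp [hin])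
  have hq0 : A.initial.val < 2 ^ w := A.initial.isLt.trans hn
  have hw4 : 3 < 2 ^ w := by
    have : 4 ≤ input.length := by simp [hin, htail]; omega
    omega
  have h1 : 1 % 2 ^ w = 1 := Nat.mod_eq_of_lt (by omega)
  have h2 : 2 % 2 ^ w = 2 := Nat.mod_eq_of_lt (by omega)
  have h3 : 3 % 2 ^ w = 3 := Nat.mod_eq_of_lt hw4
  have i0 := getD_of_drop (l := input) (p := 0) hin
  have i1 := getD_of_drop i0.2.1
  have i2 := getD_of_drop i1.2.1
  have hdrop := i2.2.1
  have i0' := i0.1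
  have i1' := i1.1
  have i2' := i2.1
  rw [List.getD_eq_getElem?_getD] at i0' i1' i2'
  simp only [zero_add, one_add_one_eq_two, Nat.reduceAdd] at i1' i2' hdrop
  unfold parse
  refine Does.mono (T₁ := 8 * A.m + 8 * A.n + 2 + 6 + 1 + 1 + 1 + 1 + 1) ?_ (by omega) fun _ _ h => h
  refine Does.set_seq (Does.set_seq (Does.set_seq (Does.set_seq (Does.set_seq ?_))))
  refine Does.of_state (P := fun s₁ => s₁.reg .n = A.n ∧ s₁.reg .sg = A.σ ∧
      s₁.reg .q0 = A.initial ∧ s₁.reg .pos = 3 ∧ s₁.reg .e = 0 ∧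
      s₁.mem .inp = fun i => input.getD i 0) ?_ ?_
  · simp [hinp, i0', i1', i2', h1, h2, h3, Nat.mod_eq_of_lt, hn, hsg, hq0]
  rintro s₁ ⟨hn₁, hsg₁, hq₁, hp₁, he₁, hinp₁⟩
  refine Does.seq (T₁ := 8 * A.m + 8 * A.n + 2) (T₂ := 6) (Does.loop (fun q s' =>
      input.drop (s'.reg .pos) = ((List.finRange A.n).drop q).flatMap A.encodeState ++ tail ∧
      (∀ q' : Fin A.n, q'.val < q → s'.mem .fin q' = (A.final q').toNat) ∧
      Stored (A.edges ((List.finRange A.n).take q)) s' ∧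
      s'.reg .e = (A.edges ((List.finRange A.n).take q)).length ∧ s'.reg .e ≤ s'.reg .pos)
    0 A.n (fun q => if h : q < A.n then (A.trans ⟨q, h⟩).length * 8 + 6 else 0) (by simp)
    (Nat.zero_le _) hn ?_ (fun s' h => eval_of_agree h hn₁ rfl) rfl ?_ ?_) ?_ le_rfl
  · refine ⟨by simpa [hp₁] using hdrop, by simp, ?_, by simp [he₁, NFAData.edges],
      by simp [he₁]⟩
    intro i x hx
    simp [NFAData.edges] at hx
  · rintro q s' - hq hqr ha ⟨hd, hf, hst, he, hep⟩
    have hl : q < (List.finRange A.n).length := by simpa using hq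
    rw [List.drop_eq_getElem_cons hl, List.flatMap_cons, List.append_assoc] at hd
    have hg : (List.finRange A.n)[q] = ⟨q, hq⟩ := by simp
    rw [hg] at hd
    simp only [dif_pos hq]
    refine (readState_does hlen hword (by omega) ((ha.2 .inp rfl).trans hinp₁)
      (q := ⟨q, hq⟩) (by simp [htail]) hqr hd hst he hep).mono le_rfl ?_
    rintro s'' ha'' ⟨hd', hf', hst', he', hep'⟩
    have hcat : A.edges ((List.finRange A.n).take (q + 1)) =
        A.edges ((List.finRange A.n).take q) ++
          (A.trans ⟨q, hq⟩).map (A.encodeEdge ⟨q, hq⟩) := by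
      rw [List.take_succ_eq_append_getElem hl, hg, A.edges_append]
      simp [NFAData.edges]
    rw [hcat]
    refine ⟨by simpa using hd', fun q' hq' => ?_, hst', by simpa using he', by simpa using hep'⟩
    simp only [St.setReg_mem, hf', Function.update_apply]
    split_ifs with h
    · have : q' = ⟨q, hq⟩ := Fin.ext h
      rw [this]
    · exact hf q' (lt_of_le_of_ne (Nat.lt_succ_iff.1 hq') h)
  · rw [Nat.Ico_zero_eq_range, Finset.sum_range]
    simp only [Fin.is_lt, dite_true, Fin.eta, Finset.sum_add_distrib, NFAData.m, Finset.sum_const,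
      Finset.card_univ, Fintype.card_fin, ← Finset.sum_mul, smul_eq_mul]
    omega
  rintro s₂ ha₂ ⟨⟨hd, hf, hst, he, hep⟩, -⟩
  have hfull : (List.finRange A.n).take A.n = List.finRange A.n := by
    rw [List.take_of_length_le]; simp
  rw [List.drop_eq_nil_of_le (as := List.finRange A.n) (by simp), List.flatMap_nil, List.nil_append, htail] at hd
  rw [hfull] at hst he
  rw [A.length_edges] at he
  have d := getD_of_drop hd
  have hdig : (Nat.digits (2 ^ w) x.k).length < 2 ^ w :=
    hword _ (List.mem_of_mem_drop (by rw [hd]; exact List.mem_cons_self))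
  have hm : A.m < 2 ^ w := by omega
  have hinp₂ : s₂.mem .inp = fun i => input.getD i 0 := (ha₂.2 .inp rfl).trans hinp₁
  have d' := d.1
  rw [List.getD_eq_getElem?_getD] at d'
  have ht : 0 < 2 ^ w := by omega
  refine Does.straight rfl le_rfl ?_
  rcases hdd : Nat.digits (2 ^ w) x.k with _ | ⟨d0, l⟩
  · simp only [hdd, List.length_nil] at d'
    refine ⟨?_, ?_, ?_, ?_, ?_, ?_, ?_, ?_, hm⟩
    all_goals simp [hinp₂, d', he, Nat.mod_eq_of_lt hm, ha₂.1 .n rfl, ha₂.1 .sg rfl,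
      ha₂.1 .q0 rfl, hn₁, hsg₁, hq₁]
    · exact fun q => hf q q.isLt
    · exact hst
  · rw [hdd] at d hd hdig d'
    have d2 := getD_of_drop d.2.1
    have b2 := lt_length_of_drop hd (by simp)
    have hd0 : d0 < 2 ^ w := hword _ (List.mem_of_mem_drop (by rw [d.2.1]; exact List.mem_cons_self))
    have e1 : (s₂.reg .pos + 1) % 2 ^ w = s₂.reg .pos + 1 := Nat.mod_eq_of_lt (by omega)
    have d2' := d2.1
    rw [List.getD_eq_getElem?_getD] at d2'
    have hlt : 0 < (l.length + 1) % 2 ^ w := by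
      rw [Nat.mod_eq_of_lt (by simpa using hdig)]; omega
    simp only [List.length_cons] at d' hdig
    refine ⟨?_, ?_, ?_, ?_, ?_, ?_, ?_, ?_, hm⟩
    all_goals simp [hinp₂, d', d2', he, Nat.mod_eq_of_lt hm, Nat.mod_eq_of_lt hdig,
      Nat.mod_eq_of_lt hd0, ha₂.1 .n rfl, ha₂.1 .sg rfl,
      ha₂.1 .q0 rfl, hn₁, hsg₁, hq₁, h1, e1]
    · exact fun q => hf q q.isLt
    · exact hst

end ESU

/-! ### Arches -/

namespace ESU

/-- The word begins with `k` consecutive factors each of which contains all letters of `S`. -/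
def Arches {α : Type} (S : Set α) : ℕ → List α → Prop
  | 0, _ => True
  | k + 1, w => ∃ u v, w = u ++ v ∧ (∀ a ∈ S, a ∈ u) ∧ Arches S k v

section Arches

variable {α : Type} {S : Set α} {k : ℕ} {w u : List α}

theorem Arches.append_right (h : Arches S k w) (u : List α) : Arches S k (w ++ u) := by
  induction k generalizing w with
  | zero => trivial
  | succ k ih =>
    obtain ⟨x, y, rfl, hx, hy⟩ := h
    exact ⟨x, y ++ u, by simp, hx, ih hy⟩

theorem Arches.append (h : Arches S k w) (hu : ∀ a ∈ S, a ∈ u) : Arches S (k + 1) (w ++ u) := by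
  induction k generalizing w with
  | zero => exact ⟨w ++ u, [], by simp, fun a ha => List.mem_append_right _ (hu a ha), trivial⟩
  | succ k ih =>
    obtain ⟨x, y, rfl, hx, hy⟩ := h
    exact ⟨x, y ++ u, by simp, hx, ih hy⟩

theorem Arches.anti (h : Arches S k w) {j : ℕ} (hj : j ≤ k) : Arches S j w := by
  induction k generalizing w j with
  | zero => rw [Nat.le_zero.1 hj]; trivial
  | succ k ih =>
    rcases j with _ | j
    · trivial
    · obtain ⟨x, y, rfl, hx, hy⟩ := h
      exact ⟨x, y, rfl, hx, ih hy (by omega)⟩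

theorem Arches.sublist (h : Arches S k w) {z : List α} (hz : ∀ a ∈ z, a ∈ S) (hk : z.length = k) :
    z.Sublist w := by
  induction k generalizing w z with
  | zero => simp [List.length_eq_zero_iff.1 hk]
  | succ k ih =>
    obtain ⟨x, y, rfl, hx, hy⟩ := h
    obtain ⟨a, z, rfl⟩ := List.exists_cons_of_length_eq_add_one hk
    exact (List.singleton_sublist.2 (hx a (hz a (by simp)))).append
      (ih hy (fun b hb => hz b (by simp [hb])) (by simpa using hk))

theorem arches_of_sublist (h : ∀ z : List α, (∀ a ∈ z, a ∈ S) → z.length = k → z.Sublist w) :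
    Arches S k w := by
  induction k generalizing w with
  | zero => trivial
  | succ k ih =>
    rcases S.eq_empty_or_nonempty with rfl | ⟨b, hb⟩
    · refine ⟨[], w, rfl, by simp, ih fun z hz hk => ?_⟩
      rcases z with _ | ⟨a, z⟩
      · simp
      · exact absurd (hz a (by simp)) (by simp)
    classical
    have hall : ∃ i, ∀ a ∈ S, a ∈ w.take i := ⟨w.length, fun a ha => by
      rw [List.take_length]
      refine (h (List.replicate (k + 1) a) (fun c hc => ?_) (by simp)).subset (by simp)
      rwa [List.eq_of_mem_replicate hc]⟩
    obtain ⟨i, hi, hmin⟩ : ∃ i, (∀ a ∈ S, a ∈ w.take (i + 1)) ∧ ∃ a ∈ S, a ∉ w.take i := by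
      have h1 := Nat.find_spec hall
      have h2 : Nat.find hall ≠ 0 := fun h0 => by
        rw [h0] at h1
        simpa using h1 b hb
      obtain ⟨i, hi⟩ := Nat.exists_eq_succ_of_ne_zero h2
      refine ⟨i, by rwa [hi] at h1, ?_⟩
      have := Nat.find_min hall (m := i) (by omega)
      push Not at this
      exact this
    obtain ⟨c, hc, hci⟩ := hmin
    have hlt : i < w.length := by
      by_contra hge
      have := hi c hc
      rw [List.take_of_length_le (by omega)] at this hci
      exact hci this
    have hx : w[i] = c := by
      have := hi c hc
      rw [List.take_succ_eq_append_getElem hlt] at this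
      exact (List.mem_singleton.1 ((List.mem_append.1 this).resolve_left hci)).symm
    refine ⟨w.take (i + 1), w.drop (i + 1), (List.take_append_drop _ _).symm, hi,
      ih fun z hz hk => ?_⟩
    have hs := h (c :: z) (by simpa [hc] using hz) (by simp [hk])
    rw [← List.take_append_drop i w, List.drop_eq_getElem_cons hlt, hx] at hs
    clear h ih hall hi hx
    generalize List.take i w = p at hs hci
    induction p with
    | nil => exact List.cons_sublist_cons.1 hs
    | cons y p ihp =>
      simp only [List.mem_cons, not_or] at hci
      rw [List.cons_append] at hs
      refine ihp ((List.sublist_cons_iff.1 hs).resolve_right ?_) hci.2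
      rintro ⟨r, hr, -⟩
      exact hci.1 (List.cons.inj hr).1

theorem isUniversal_iff (hw : ∀ a ∈ w, a ∈ S) : IsUniversal S k w ↔ Arches S k w := by
  constructor
  · intro h
    refine arches_of_sublist fun z hz hk => ?_
    have : z ∈ {u : List α | (∀ a ∈ u, a ∈ S) ∧ u.length = k} := ⟨hz, hk⟩
    rw [← h] at this
    exact this.1
  · intro h
    ext z
    exact ⟨fun ⟨h1, h2⟩ => ⟨fun a ha => hw a (h1.subset ha), h2⟩, fun ⟨h1, h2⟩ =>
      ⟨h.sublist h1 h2, h2⟩⟩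

end Arches

theorem mem_map_encodeLabel {s : ℕ} {l : List (Option (Fin s))} {a : Fin s} :
    a.val + 1 ∈ l.map NFAData.encodeLabel ↔ a ∈ l.reduceOption := by
  rw [List.mem_map, List.reduceOption_mem_iff]
  constructor
  · rintro ⟨o, ho, h⟩
    rcases o with _ | b
    · simp [NFAData.encodeLabel] at h
    · have : b = a := Fin.ext (by simpa [NFAData.encodeLabel] using h)
      exact this ▸ ho
  · exact fun h => ⟨_, h, rfl⟩

theorem arches_map_encodeLabel {s k : ℕ} {S : Set (Fin s)} {l : List (Option (Fin s))} :
    Arches ((fun a : Fin s => a.val + 1) '' S) k (l.map NFAData.encodeLabel) ↔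
      Arches S k l.reduceOption := by
  induction k generalizing l with
  | zero => exact Iff.rfl
  | succ k ih =>
    constructor
    · rintro ⟨u, v, h, hu, hv⟩
      obtain ⟨x, y, rfl, rfl, rfl⟩ := List.map_eq_append_iff.1 h
      exact ⟨x.reduceOption, y.reduceOption, List.reduceOption_append _ _,
        fun a ha => mem_map_encodeLabel.1 (hu _ ⟨a, ha, rfl⟩), ih.1 hv⟩
    · rintro ⟨u, v, h, hu, hv⟩
      obtain ⟨x, y, rfl, rfl, rfl⟩ := (List.reduceOption_eq_append_iff ..).1 h
      refine ⟨_, _, List.map_append, ?_, ih.2 hv⟩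
      rintro _ ⟨a, ha, rfl⟩
      exact mem_map_encodeLabel.2 (hu a ha)

end ESU

/-! ### Walks through the components -/

namespace ESU

/-- `l` is the list of the labels on a walk from `p` to `q` in the labelled graph `T`. -/
inductive Walk (T : ℕ → ℕ → ℕ → Prop) : ℕ → List ℕ → ℕ → Prop
  | nil (p : ℕ) : Walk T p [] p
  | cons {p a r : ℕ} {l : List ℕ} {q : ℕ} : T p a r → Walk T r l q → Walk T p (a :: l) q

section

variable {T : ℕ → ℕ → ℕ → Prop} {p q r : ℕ} {l l' : List ℕ}

theorem Walk.append (h : Walk T p l q) (h' : Walk T q l' r) : Walk T p (l ++ l') r := by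
  induction h with
  | nil => exact h'
  | cons h _ ih => exact .cons h (ih h')

theorem Walk.exists_of_append (h : Walk T p (l ++ l') r) : ∃ q, Walk T p l q ∧ Walk T q l' r := by
  induction l generalizing p with
  | nil => exact ⟨p, .nil p, h⟩
  | cons a l ih =>
    rcases h with _ | ⟨h1, h2⟩
    obtain ⟨q, hq, hq'⟩ := ih h2
    exact ⟨q, .cons h1 hq, hq'⟩

/-- The edges between the components. -/
def Cross (T : ℕ → ℕ → ℕ → Prop) (ids : ℕ → ℕ) (i a j : ℕ) : Prop :=
  ∃ p q, T p a q ∧ ids p = i ∧ ids q = j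

/-- The components of a graph, numbered by `ids` in topological order; `U` is the set of states. -/
structure Components (T : ℕ → ℕ → ℕ → Prop) (ids : ℕ → ℕ) (U : ℕ → Prop) : Prop where
  source : ∀ {p a q}, T p a q → U p
  target : ∀ {p a q}, T p a q → U q
  le : ∀ {p a q}, T p a q → ids p ≤ ids q
  connected : ∀ {p q}, U p → U q → ids p = ids q → ∃ l, Walk T p l q

variable {ids : ℕ → ℕ} {U : ℕ → Prop} {N : ℕ → Prop} {sg n : ℕ}

/-- Inside of a component, all its letters can be read. -/
theorem Components.exists_walk (hC : Components T ids U) (hN : ∀ a, N a → a ≤ sg) {i : ℕ} (hp : U p)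
    (hq : U q) (hpi : ids p = i) (hqi : ids q = i) :
    ∃ l, Walk T p l q ∧ ∀ a, N a → Cross T ids i a i → a ∈ l := by
  suffices ∀ k, ∀ p, U p → ids p = i →
      ∃ l, Walk T p l q ∧ ∀ a < k, Cross T ids i a i → a ∈ l by
    obtain ⟨l, hl, h⟩ := this (sg + 1) p hp hpi
    exact ⟨l, hl, fun a ha => h a (Nat.lt_succ_of_le (hN a ha))⟩
  intro k
  induction k with
  | zero =>
    intro p hp hpi
    obtain ⟨l, hl⟩ := hC.connected hp hq (hpi.trans hqi.symm)
    exact ⟨l, hl, by simp⟩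
  | succ k ih =>
    intro p hp hpi
    by_cases hk : Cross T ids i k i
    · obtain ⟨x, y, hT, hx, hy⟩ := hk
      obtain ⟨l₁, h₁⟩ := hC.connected hp (hC.source hT) (hpi.trans hx.symm)
      obtain ⟨l₂, h₂, hl₂⟩ := ih y (hC.target hT) hy
      refine ⟨l₁ ++ k :: l₂, h₁.append (.cons hT h₂), fun a ha hc => ?_⟩
      rcases Nat.lt_succ_iff_lt_or_eq.1 ha with ha | rfl
      · simp [hl₂ a ha hc]
      · simp
    · obtain ⟨l, hl, h⟩ := ih p hp hpi
      refine ⟨l, hl, fun a ha hc => ?_⟩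
      rcases Nat.lt_succ_iff_lt_or_eq.1 ha with ha | rfl
      · exact h a ha hc
      · exact absurd hc hk

/-- All letters of the components of a chain, and one letter for each crossing, can be read. -/
theorem Components.exists_walk_chain (hC : Components T ids U) (hN : ∀ a, N a → a ≤ sg)
    {c g : ℕ → ℕ} {s d : ℕ} (hsd : s ≤ d)
    (hg : ∀ t, s ≤ t → t < d → Cross T ids (c t) (g t) (c (t + 1))) (hp : U p) (hq : U q)
    (hps : ids p = c s) (hqd : ids q = c d) :
    ∃ l, Walk T p l q ∧ (∀ a, N a → ∀ t, s ≤ t → t ≤ d → Cross T ids (c t) a (c t) → a ∈ l) ∧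
      ∀ t, s ≤ t → t < d → g t ∈ l := by
  induction d, hsd using Nat.le_induction generalizing q with
  | base =>
    obtain ⟨l, hl, h⟩ := hC.exists_walk hN hp hq hps hqd
    refine ⟨l, hl, fun a ha t h1 h2 hc => ?_, fun t h1 h2 => by omega⟩
    obtain rfl : t = s := by omega
    exact h a ha hc
  | succ d hsd ih =>
    obtain ⟨x, y, hT, hx, hy⟩ := hg d hsd (by omega)
    obtain ⟨l₁, h₁, hl₁, hl₁'⟩ := ih (fun t h1 h2 => hg t h1 (by omega)) (hC.source hT) hx
    obtain ⟨l₂, h₂, hl₂⟩ := hC.exists_walk hN (hC.target hT) hq hy hqd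
    refine ⟨l₁ ++ g d :: l₂, h₁.append (.cons hT h₂), fun a ha t h1 h2 hc => ?_, fun t h1 h2 => ?_⟩
    · rcases h2.lt_or_eq with h2 | rfl
      · simp [hl₁ a ha t h1 (by omega) hc]
      · simp [hl₂ a ha hc]
    · rcases Nat.lt_succ_iff_lt_or_eq.1 h2 with h2 | rfl
      · simp [hl₁' t h1 h2]
      · simp

/-- A chain that covers the needed letters has a walk that contains them. -/
theorem Components.exists_walk_of_covers (hC : Components T ids U) (hN : ∀ a, N a → a ≤ sg)
    {c : ℕ → ℕ} {s d : ℕ} (hsd : s ≤ d) (hc : IsChain (Cross T ids) c s d)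
    (hcov : Covers (Cross T ids) N c s d) (hp : U p) (hq : U q)
    (hps : ids p = c s) (hqd : ids q = c d) : ∃ l, Walk T p l q ∧ ∀ a, N a → a ∈ l := by
  classical
  obtain ⟨f, hf, hfE⟩ := hcov
  have : ∀ t, ∃ b, (s ≤ t → t < d → Cross T ids (c t) b (c (t + 1))) ∧
      ∀ a, Missing (Cross T ids) N c s d a → f a = t → a = b := by
    intro t
    by_cases ht : ∃ a, Missing (Cross T ids) N c s d a ∧ f a = t
    · obtain ⟨a, ha, rfl⟩ := ht
      exact ⟨a, fun _ _ => (hfE a ha).2.2, fun b hb h => hf hb ha h⟩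
    · push Not at ht
      by_cases htt : s ≤ t ∧ t < d
      · obtain ⟨b, hb⟩ := (hc t htt.1 htt.2).2
        exact ⟨b, fun _ _ => hb, fun a ha h => absurd h (ht a ha)⟩
      · exact ⟨0, fun h1 h2 => absurd ⟨h1, h2⟩ htt, fun a ha h => absurd h (ht a ha)⟩
  choose g hg hfg using this
  obtain ⟨l, hl, h1, h2⟩ := hC.exists_walk_chain hN hsd (fun t => hg t) hp hq hps hqd
  refine ⟨l, hl, fun a ha => ?_⟩
  by_cases hm : Missing (Cross T ids) N c s d a
  · rw [hfg _ a hm rfl]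
    exact h2 _ (hfE a hm).1 (hfE a hm).2.1
  · simp only [Missing, not_and, not_forall, not_not] at hm
    obtain ⟨t, h3, h4, h5⟩ := hm ha
    exact h1 a ha t h3 h4 h5

theorem Components.exists_arches_of_greedy (hC : Components T ids U) (hN : ∀ a, N a → a ≤ sg)
    {c : ℕ → ℕ} {q₀ d : ℕ} (hq₀ : U q₀) (h0 : c 0 = ids q₀) (hc : IsChain (Cross T ids) c 0 d) :
    (∃ p, U p ∧ ids p = c (greedy (Cross T ids) N c d).1) ∧
    ∀ p, U p → ids p = c (greedy (Cross T ids) N c d).1 →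
      ∃ l, Walk T q₀ l p ∧ Arches {a | N a} (greedy (Cross T ids) N c d).2 l := by
  induction d with
  | zero =>
    refine ⟨⟨q₀, hq₀, h0.symm⟩, fun p hp hpi => ?_⟩
    obtain ⟨l, hl⟩ := hC.connected hq₀ hp (h0.symm.trans hpi.symm)
    exact ⟨l, hl, trivial⟩
  | succ d ih =>
    obtain ⟨⟨x, hx, hxi⟩, ih⟩ := ih fun t h1 h2 => hc t h1 (by omega)
    rw [greedy]
    split_ifs with h
    · refine ⟨?_, fun p hp hpi => ?_⟩
      · obtain ⟨-, a, y, z, hT, -, hz⟩ := hc d (Nat.zero_le _) (by omega)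
        exact ⟨z, hC.target hT, hz⟩
      · obtain ⟨l, hl, hl'⟩ := ih x hx hxi
        obtain ⟨l₂, h₂, h₂'⟩ := hC.exists_walk_of_covers hN
          ((greedy_fst_le c d).trans (Nat.le_succ d)) (fun t _ h2 => hc t (Nat.zero_le _) h2) h hx hp
          hxi hpi
        exact ⟨l ++ l₂, hl.append h₂, hl'.append h₂'⟩
    · exact ⟨⟨x, hx, hxi⟩, ih⟩

/-- The components on a walk form a chain, and each crossing reads one letter. -/
theorem Components.exists_chain (hC : Components T ids U) (h : Walk T p l q) {c : ℕ → ℕ} {d : ℕ}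
    (hd : c d = ids p) : ∃ (c' : ℕ → ℕ) (d' : ℕ) (g : ℕ → ℕ), d ≤ d' ∧ (∀ t ≤ d, c' t = c t) ∧
      IsChain (Cross T ids) c' d d' ∧ c' d' = ids q ∧
      (∀ t, d ≤ t → t < d' → Cross T ids (c' t) (g t) (c' (t + 1))) ∧
      ∀ a ∈ l, (∃ t, d ≤ t ∧ t ≤ d' ∧ Cross T ids (c' t) a (c' t)) ∨
        ∃ t, d ≤ t ∧ t < d' ∧ g t = a := by
  induction h generalizing c d with
  | nil =>
    exact ⟨c, d, fun _ => 0, le_rfl, fun _ _ => rfl, fun t h1 h2 => by omega, hd,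
      fun t h1 h2 => by omega, by simp⟩
  | @cons p a r l q hT _ ih =>
    rcases (hC.le hT).lt_or_eq with hlt | heq
    · obtain ⟨c', d', g, h1, h2, h3, h4, h5, h6⟩ :=
        ih (c := Function.update c (d + 1) (ids r)) (d := d + 1) (by simp)
      have hcd : c' d = ids p := by rw [h2 d (by omega), Function.update_of_ne (by omega), hd]
      have hcd' : c' (d + 1) = ids r := by simp [h2 (d + 1) le_rfl]
      have hcr : Cross T ids (c' d) a (c' (d + 1)) := by
        rw [hcd, hcd']
        exact ⟨p, r, hT, rfl, rfl⟩
      refine ⟨c', d', Function.update g d a, by omega, fun t ht => ?_, fun t ht ht' => ?_, h4,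
        fun t ht ht' => ?_, fun b hb => ?_⟩
      · rw [h2 t (by omega), Function.update_of_ne (by omega)]
      · rcases ht.eq_or_lt with rfl | ht
        · exact ⟨by omega, a, hcr⟩
        · exact h3 t ht ht'
      · rcases ht.eq_or_lt with rfl | ht
        · simpa using hcr
        · rw [Function.update_of_ne (by omega)]
          exact h5 t ht ht'
      · rcases List.mem_cons.1 hb with rfl | hb
        · exact .inr ⟨d, le_rfl, h1, by simp⟩
        · rcases h6 b hb with ⟨t, ht, h⟩ | ⟨t, ht, ht', h⟩
          · exact .inl ⟨t, by omega, h⟩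
          · exact .inr ⟨t, by omega, ht', by rwa [Function.update_of_ne (by omega)]⟩
    · obtain ⟨c', d', g, h1, h2, h3, h4, h5, h6⟩ := ih (hd.trans heq)
      refine ⟨c', d', g, h1, h2, h3, h4, h5, fun b hb => ?_⟩
      rcases List.mem_cons.1 hb with rfl | hb
      · refine .inl ⟨d, le_rfl, h1, p, r, hT, ?_, ?_⟩
        · rw [h2 d le_rfl, hd]
        · rw [h2 d le_rfl, hd, heq]
      · exact h6 b hb

theorem greedy_eq_or_lt {E : ℕ → ℕ → ℕ → Prop} (c : ℕ → ℕ) {d e : ℕ} (h : d ≤ e) :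
    greedy E N c e = greedy E N c d ∨ (greedy E N c d).2 < (greedy E N c e).2 := by
  induction e, h using Nat.le_induction with
  | base => exact .inl rfl
  | succ e h ih =>
    rw [greedy]
    split_ifs
    · right
      rcases ih with ih | ih
      · simp [ih]
      · exact ih.trans (Nat.lt_succ_self _)
    · exact ih

theorem greedy_succ_le {E : ℕ → ℕ → ℕ → Prop} {c : ℕ → ℕ} {d e : ℕ} (h : d < e)
    (hcov : Covers E N c d e) : (greedy E N c d).2 + 1 ≤ (greedy E N c e).2 := by
  obtain ⟨e, rfl⟩ := Nat.exists_eq_add_one_of_ne_zero (show e ≠ 0 by omega)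
  rcases greedy_eq_or_lt c (Nat.lt_succ_iff.1 h) with heq | hlt
  · rw [greedy, heq, if_pos (hcov.mono (greedy_fst_le c d))]
  · exact Nat.succ_le_of_lt (hlt.trans_le (greedy_snd_mono c (Nat.le_succ e)))

theorem Components.exists_greedy (hC : Components T ids U)
    (hno : ∀ i, ¬ ∀ a, N a → Cross T ids i a i) {k : ℕ} (h : Walk T p l q)
    (hl : Arches {a | N a} k l) {c : ℕ → ℕ} {d : ℕ} (hd : c d = ids p)
    (hc : IsChain (Cross T ids) c 0 d) :
    ∃ c' d', d ≤ d' ∧ (∀ t ≤ d, c' t = c t) ∧ IsChain (Cross T ids) c' 0 d' ∧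
      (greedy (Cross T ids) N c d).2 + k ≤ (greedy (Cross T ids) N c' d').2 := by
  induction k generalizing p l c d with
  | zero => exact ⟨c, d, le_rfl, fun _ _ => rfl, hc, le_rfl⟩
  | succ k ih =>
    obtain ⟨u, v, rfl, hu, hv⟩ := hl
    obtain ⟨r, hr, hr'⟩ := h.exists_of_append
    obtain ⟨c', d', g, h1, h2, h3, h4, h5, h6⟩ := hC.exists_chain hr hd
    have hcov : Covers (Cross T ids) N c' d d' := by
      have : ∀ a, ∃ t, Missing (Cross T ids) N c' d d' a → d ≤ t ∧ t < d' ∧ g t = a := by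
        intro a
        by_cases ha : Missing (Cross T ids) N c' d d' a
        · rcases h6 a (hu a ha.1) with ⟨t, h7, h8, h9⟩ | ⟨t, h7⟩
          · exact absurd h9 (ha.2 t h7 h8)
          · exact ⟨t, fun _ => h7⟩
        · exact ⟨0, fun h => absurd h ha⟩
      choose f hf using this
      refine ⟨f, fun a ha b hb hab => ?_, fun a ha => ?_⟩
      · rw [← (hf a ha).2.2, ← (hf b hb).2.2, hab]
      · obtain ⟨h7, h8, h9⟩ := hf a ha
        have := h5 _ h7 h8
        rw [h9] at this
        exact ⟨h7, h8, this⟩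
    have hc' : IsChain (Cross T ids) c' 0 d' := by
      intro t _ ht
      by_cases htd : t < d
      · rw [h2 t (by omega), h2 (t + 1) (by omega)]
        exact hc t (Nat.zero_le _) htd
      · exact h3 t (by omega) ht
    have hlt : d < d' := by
      refine lt_of_le_of_ne h1 fun h => hno (c' d) fun a ha => ?_
      subst h
      obtain ⟨f, -, hf⟩ := hcov
      by_contra hE
      have := hf a ⟨ha, fun t h7 h8 => by
        obtain rfl : t = d := by omega
        exact hE⟩
      omega
    have hgr : (greedy (Cross T ids) N c d).2 + 1 ≤ (greedy (Cross T ids) N c' d').2 := by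
      rw [greedy_congr fun t ht => (h2 t ht).symm]
      exact greedy_succ_le hlt hcov
    obtain ⟨c'', d'', h7, h8, h9, h10⟩ := ih hr' hv h4 hc'
    exact ⟨c'', d'', by omega, fun t ht => (h8 t (by omega)).trans (h2 t ht), h9, by omega⟩

/-- If no component contains all needed letters, then the walks with `k` arches correspond to the
chains with `k` arches. -/
theorem Components.exists_arches_iff_wins (hC : Components T ids U) (hN : ∀ a, N a → a ≤ sg)
    (hno : ∀ i, ¬ ∀ a, N a → Cross T ids i a i) {q₀ k : ℕ} (hq₀ : U q₀) (hk : 1 ≤ k) :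
    (∃ l q, Walk T q₀ l q ∧ Arches {a | N a} k l) ↔
      Wins (Cross T ids) N k (fun _ => ids q₀) 0 (ids q₀ + 1) := by
  constructor
  · rintro ⟨l, q, hl, ha⟩
    obtain ⟨c, d, -, h2, h3, h4⟩ := hC.exists_greedy hno hl ha (c := fun _ => ids q₀) (d := 0) rfl
      fun t _ h => by omega
    have hd := greedy_snd_le (E := Cross T ids) (N := N) c d
    have hlt : 0 < d := by omega
    refine ⟨c, d, hlt, h2, ?_, h3, by omega⟩
    have := (h3 0 le_rfl hlt).1
    rw [h2 0 le_rfl] at this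
    omega
  · rintro ⟨c, d, -, h1, -, h2, h3⟩
    obtain ⟨⟨p, hp, hpi⟩, h⟩ := hC.exists_arches_of_greedy hN hq₀ (h1 0 le_rfl) h2
    obtain ⟨l, hl, ha⟩ := h p hp hpi
    exact ⟨l, p, hl, ha.anti h3⟩

/-- A component that contains all needed letters has walks with any number of arches. -/
theorem Components.exists_arches_of_single (hC : Components T ids U) (hN : ∀ a, N a → a ≤ sg)
    {q₀ i : ℕ} (hi : ∀ a, N a → Cross T ids i a i)
    (hreach : ∀ q, U q → ∃ l, Walk T q₀ l q) (k : ℕ) :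
    ∃ l q, Walk T q₀ l q ∧ Arches {a | N a} k l := by
  by_cases hne : ∃ a, N a
  · obtain ⟨a, ha⟩ := hne
    obtain ⟨p, q, hT, hp, -⟩ := hi a ha
    have hU := hC.source hT
    obtain ⟨l, hl, h⟩ := hC.exists_walk hN hU hU hp hp
    suffices ∃ l, Walk T q₀ l p ∧ Arches {a | N a} k l by
      obtain ⟨l, h⟩ := this
      exact ⟨l, p, h⟩
    induction k with
    | zero =>
      obtain ⟨l, hl⟩ := hreach p hU
      exact ⟨l, hl, trivial⟩
    | succ k ih =>
      obtain ⟨l', hl', ha'⟩ := ih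
      exact ⟨l' ++ l, hl'.append hl, ha'.append fun a ha => h a ha (hi a ha)⟩
  · refine ⟨[], q₀, .nil _, arches_of_sublist fun z hz _ => ?_⟩
    rcases z with _ | ⟨a, z⟩
    · simp
    · exact absurd ⟨a, hz a (by simp)⟩ hne

theorem not_wins_of_le {E : ℕ → ℕ → ℕ → Prop} {k v : ℕ} (hE : ∀ i a j, E i a j → j < n) (hk : n ≤ k)
    {c : ℕ → ℕ} : ¬ Wins E N k c 0 v := by
  rintro ⟨c', e, he, -, -, hc, hge⟩
  have hle : ∀ t ≤ e, t ≤ c' t := by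
    intro t
    induction t with
    | zero => exact fun _ => Nat.zero_le _
    | succ t ih =>
      intro ht
      have := ih (by omega)
      have := (hc t (Nat.zero_le _) ht).1
      omega
  obtain ⟨e, rfl⟩ := Nat.exists_eq_add_one_of_ne_zero he.ne'
  obtain ⟨-, a, ha⟩ := hc e (Nat.zero_le _) (Nat.lt_succ_self e)
  have h1 := hE _ _ _ ha
  have h2 := hle _ le_rfl
  have h3 := greedy_snd_le (E := E) (N := N) c' (e + 1)
  omega

end
end ESU

/-! ### The components of an automaton -/

namespace ESU

open WordRAM

section

variable {n v u : ℕ} {R : ℕ → ℕ → Prop}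

theorem rank_lt (h : R v v) (hv : v < n) : rank n R v < n := by
  classical
  rw [rank]
  conv_rhs => rw [← Finset.card_range n]
  refine Finset.card_lt_card (Finset.filter_ssubset.2 ⟨v, Finset.mem_range.2 hv, ?_⟩)
  rintro (h1 | ⟨-, h1⟩)
  · exact h1.false
  · exact h1 v le_rfl rfl h

theorem rank_lt_rank (h : R v v) (hv : v < n) (hlt : reachCount n R u < reachCount n R v) :
    rank n R v < rank n R u := by
  classical
  refine Finset.card_lt_card (Finset.ssubset_iff_of_subset ?_ |>.2 ⟨v, ?_, ?_⟩)
  · intro p hp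
    simp only [Finset.mem_filter] at hp ⊢
    exact ⟨hp.1, .inl (by omega)⟩
  · simp only [Finset.mem_filter, Finset.mem_range]
    exact ⟨hv, .inl hlt⟩
  · simp only [Finset.mem_filter, not_and]
    rintro - (h1 | ⟨-, h1⟩)
    · exact h1.false
    · exact h1 v le_rfl rfl h

theorem rank_lt_rank_of_first (hc : reachCount n R u = reachCount n R v) {q : ℕ} (hqn : q < n)
    (hq : reachCount n R q = reachCount n R v) (hvq : R v q)
    (hu : ∀ q' ≤ q, reachCount n R q' = reachCount n R v → ¬ R u q') :
    rank n R v < rank n R u := by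
  classical
  refine Finset.card_lt_card (Finset.ssubset_iff_of_subset ?_ |>.2 ⟨q, ?_, ?_⟩)
  · intro p hp
    simp only [Finset.mem_filter, hc] at hp ⊢
    refine ⟨hp.1, hp.2.imp_right fun h => ⟨h.1, fun q' hq' => hu q' ?_⟩⟩
    by_contra hlt
    exact h.2 q (by omega) hq hvq
  · simp only [Finset.mem_filter, Finset.mem_range, hc]
    exact ⟨hqn, .inr ⟨hq, hu⟩⟩
  · simp only [Finset.mem_filter, not_and]
    rintro - (h1 | ⟨-, h1⟩)
    · omega
    · exact h1 q le_rfl hq hvq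

theorem reachCount_le (htrans : ∀ v u t, R v u → R u t → R v t) (h : R v u) : reachCount n R u ≤ reachCount n R v := by
  classical
  exact Finset.card_le_card fun p hp => by
    simp only [Finset.mem_filter] at hp ⊢
    exact ⟨hp.1, htrans _ _ _ h hp.2⟩

theorem reach_symm (hrefl : ∀ v, R v v) (htrans : ∀ v u t, R v u → R u t → R v t)
    (hv : v < n) (h : R v u) (hc : reachCount n R u = reachCount n R v) : R u v := by
  classical
  have : (Finset.range n).filter (R u) = (Finset.range n).filter (R v) :=
    Finset.eq_of_subset_of_card_le (fun p hp => by
      simp only [Finset.mem_filter] at hp ⊢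
      exact ⟨hp.1, htrans _ _ _ h hp.2⟩) hc.ge
  have hm : v ∈ (Finset.range n).filter (R v) :=
    Finset.mem_filter.2 ⟨Finset.mem_range.2 hv, hrefl v⟩
  rw [← this] at hm
  exact (Finset.mem_filter.1 hm).2

theorem rank_le_rank (hrefl : ∀ v, R v v) (htrans : ∀ v u t, R v u → R u t → R v t)
    (hv : v < n) (h : R v u) : rank n R v ≤ rank n R u := by
  classical
  rcases (reachCount_le htrans h (n := n)).lt_or_eq with hlt | heq
  · exact (rank_lt_rank (hrefl v) hv hlt).le
  · have hs := reach_symm hrefl htrans hv h heq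
    refine Finset.card_le_card fun p hp => ?_
    simp only [Finset.mem_filter, heq] at hp ⊢
    exact ⟨hp.1, hp.2.imp_right fun h' => ⟨h'.1, fun q hq hqc hr => h'.2 q hq hqc (htrans _ _ _ h hr)⟩⟩

theorem reach_of_rank_eq (hrefl : ∀ v, R v v) (htrans : ∀ v u t, R v u → R u t → R v t)
    (hv : v < n) (hu : u < n) (h : rank n R v = rank n R u) : R v u := by
  classical
  have hc : reachCount n R v = reachCount n R u := by
    rcases lt_trichotomy (reachCount n R v) (reachCount n R u) with h1 | h1 | h1
    · exact absurd h (rank_lt_rank (hrefl u) hu h1).ne'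
    · exact h1
    · exact absurd h (rank_lt_rank (hrefl v) hv h1).ne
  have key : ∀ x y, x < n → reachCount n R y = reachCount n R x → rank n R x = rank n R y →
      ∀ q, q < n → reachCount n R q = reachCount n R x → R x q →
      ∃ q' ≤ q, reachCount n R q' = reachCount n R x ∧ R y q' := by
    intro x y hx hxy hr q hqn hq hxq
    by_contra hcon
    push Not at hcon
    exact hr.not_lt (rank_lt_rank_of_first hxy hqn hq hxq hcon)
  have ex : ∀ x, ∃ q, reachCount n R q = reachCount n R x ∧ R x q := fun x => ⟨x, rfl, hrefl x⟩
  have hle : ∀ x, Nat.find (ex x) ≤ x := fun x => Nat.find_min' _ ⟨rfl, hrefl x⟩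
  have hle' : ∀ x y, x < n → reachCount n R y = reachCount n R x → rank n R x = rank n R y →
      Nat.find (ex y) ≤ Nat.find (ex x) := by
    intro x y hx hxy hr
    have hs := Nat.find_spec (ex x)
    obtain ⟨q', h1, h2, h3⟩ := key x y hx hxy hr _ ((hle x).trans_lt hx) hs.1 hs.2
    exact (Nat.find_min' _ ⟨h2.trans hxy.symm, h3⟩).trans h1
  have heq := (hle' u v hu hc h.symm).antisymm (hle' v u hv hc.symm h)
  have h1 := Nat.find_spec (ex v)
  have h2 := Nat.find_spec (ex u)
  rw [← heq] at h2
  exact htrans _ _ _ h1.2 (reach_symm hrefl htrans hu h2.2 h2.1)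

end

/-- The labelled graph with the edges `src e → dst e`, `e < m`. -/
def Step (m : ℕ) (src lab dst : ℕ → ℕ) (p a q : ℕ) : Prop :=
  ∃ e < m, src e = p ∧ lab e = a ∧ dst e = q

/-- The states on the walks from `q₀` to a final state. -/
def Useful (n m : ℕ) (src dst : ℕ → ℕ) (q₀ : ℕ) (F : ℕ → Prop) (v : ℕ) : Prop :=
  Rch m src dst q₀ v ∧ ∃ f < n, Rch m src dst v f ∧ F f

/-- The edges on the walks from `q₀` to a final state. -/
def UsefulStep (n m : ℕ) (src lab dst : ℕ → ℕ) (q₀ : ℕ) (F : ℕ → Prop) (p a q : ℕ) : Prop :=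
  Useful n m src dst q₀ F p ∧ Useful n m src dst q₀ F q ∧ Step m src lab dst p a q

section

variable {n m q₀ : ℕ} {src lab dst ids : ℕ → ℕ} {F : ℕ → Prop}

theorem rch_iff_exists_walk {p q : ℕ} :
    Rch m src dst p q ↔ ∃ l, Walk (Step m src lab dst) p l q := by
  constructor
  · intro h
    induction h using Relation.ReflTransGen.head_induction_on with
    | refl => exact ⟨[], .nil _⟩
    | head h _ ih =>
      obtain ⟨e, he, h1, h2⟩ := h
      obtain ⟨l, hl⟩ := ih
      exact ⟨lab e :: l, .cons ⟨e, he, h1, rfl, h2⟩ hl⟩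
  · rintro ⟨l, h⟩
    induction h with
    | nil => exact .refl
    | cons h _ ih =>
      obtain ⟨e, he, h1, -, h2⟩ := h
      exact .head ⟨e, he, h1, h2⟩ ih

theorem rch_lt (hdst : ∀ e < m, dst e < n) {p q : ℕ} (hp : p < n) (h : Rch m src dst p q) : q < n := by
  induction h with
  | refl => exact hp
  | tail _ h _ =>
    obtain ⟨e, he, -, rfl⟩ := h
    exact hdst e he

theorem Walk.mono {T T' : ℕ → ℕ → ℕ → Prop} {p q : ℕ} {l : List ℕ} (h : Walk T p l q)
    (hT : ∀ p a q, T p a q → T' p a q) : Walk T' p l q := by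
  induction h with
  | nil => exact .nil _
  | cons h _ ih => exact .cons (hT _ _ _ h) ih

theorem Walk.target_of {T : ℕ → ℕ → ℕ → Prop} {U : ℕ → Prop} {p q : ℕ} {l : List ℕ}
    (h : Walk T p l q) (hT : ∀ p a q, T p a q → U q) (hp : U p) : U q := by
  induction h with
  | nil => exact hp
  | cons h _ ih => exact ih (hT _ _ _ h)

theorem Walk.exists_edge {T : ℕ → ℕ → ℕ → Prop} {p q a : ℕ} {l : List ℕ} (h : Walk T p l q)
    (ha : a ∈ l) : ∃ p q, T p a q := by
  induction h with
  | nil => simp at ha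
  | cons h _ ih =>
    rcases List.mem_cons.1 ha with rfl | ha
    · exact ⟨_, _, h⟩
    · exact ih ha

theorem Walk.usefulStep {p q : ℕ} {l : List ℕ} (h : Walk (Step m src lab dst) p l q)
    (hp : Rch m src dst q₀ p) (hq : ∃ f < n, Rch m src dst q f ∧ F f) :
    Walk (UsefulStep n m src lab dst q₀ F) p l q := by
  induction h with
  | nil => exact .nil _
  | @cons p a r l q h hw ih =>
    obtain ⟨e, he, h1, h2, h3⟩ := id h
    have hr := hp.tail ⟨e, he, h1, h3⟩
    have hrq : Rch m src dst r q := rch_iff_exists_walk.2 ⟨l, hw⟩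
    obtain ⟨f, hf, hqf, hF⟩ := id hq
    exact .cons ⟨⟨hp, f, hf, (hrq.trans hqf).head ⟨e, he, h1, h3⟩, hF⟩, ⟨hr, f, hf, hrq.trans hqf, hF⟩,
      h⟩ (ih hr hq)

theorem exists_walk_of_useful {p q : ℕ} (hp : Rch m src dst q₀ p) (hq : Useful n m src dst q₀ F q)
    (h : Rch m src dst p q) : ∃ l, Walk (UsefulStep n m src lab dst q₀ F) p l q := by
  obtain ⟨l, hl⟩ := rch_iff_exists_walk.1 h
  exact ⟨l, hl.usefulStep hp hq.2⟩

open Classical in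
theorem components_of_rank (hq₀ : q₀ < n) (hdst : ∀ e < m, dst e < n)
    (hids : ∀ v < n, ids v = if Useful n m src dst q₀ F v then rank n (Rch m src dst) v else n) :
    Components (UsefulStep n m src lab dst q₀ F) ids (Useful n m src dst q₀ F) := by
  have hlt : ∀ {v}, Useful n m src dst q₀ F v → v < n := fun h => rch_lt hdst hq₀ h.1
  have hrefl : ∀ v, Rch m src dst v v := fun _ => .refl
  have htr : ∀ v u t, Rch m src dst v u → Rch m src dst u t → Rch m src dst v t :=
    fun _ _ _ h h' => h.trans h'
  refine ⟨fun h => h.1, fun h => h.2.1, fun {p a q} h => ?_, fun {p q} hp hq h => ?_⟩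
  · rw [hids _ (hlt h.1), hids _ (hlt h.2.1), if_pos h.1, if_pos h.2.1]
    obtain ⟨e, he, h1, -, h2⟩ := h.2.2
    exact rank_le_rank hrefl htr (hlt h.1) (.single ⟨e, he, h1, h2⟩)
  · rw [hids _ (hlt hp), hids _ (hlt hq), if_pos hp, if_pos hq] at h
    exact exists_walk_of_useful hp.1 hq (reach_of_rank_eq hrefl htr (hlt hp) (hlt hq) h)

open Classical in
theorem cross_iff_edge (hsrc : ∀ e < m, src e < n) (hdst : ∀ e < m, dst e < n)
    (hids : ∀ v < n, ids v = if Useful n m src dst q₀ F v then rank n (Rch m src dst) v else n)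
    {i a j : ℕ} : Cross (UsefulStep n m src lab dst q₀ F) ids i a j ↔
      i < n ∧ Edge n m src lab dst ids i a j := by
  have hlt : ∀ {v}, v < n → (ids v < n ↔ Useful n m src dst q₀ F v) := fun {v} h => by
    rw [hids v h]
    split_ifs with hU
    · exact ⟨fun _ => hU, fun _ => rank_lt .refl h⟩
    · simp [hU]
  constructor
  · rintro ⟨p, q, ⟨hp, hq, e, he, rfl, rfl, rfl⟩, rfl, rfl⟩
    exact ⟨(hlt (hsrc e he)).2 hp, (hlt (hdst e he)).2 hq, e, he, rfl, rfl, rfl⟩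
  · rintro ⟨hi, hj, e, he, rfl, rfl, rfl⟩
    exact ⟨_, _, ⟨(hlt (hsrc e he)).1 hi, (hlt (hdst e he)).1 hj, e, he, rfl, rfl, rfl⟩, rfl, rfl⟩

/-- The letters that occur on accepting walks are those of the useful edges. -/
theorem exists_accepting_iff {a : ℕ} :
    (∃ l, ∃ f < n, Walk (Step m src lab dst) q₀ l f ∧ F f ∧ a ∈ l) ↔
      ∃ p q, UsefulStep n m src lab dst q₀ F p a q := by
  constructor
  · rintro ⟨l, f, hf, hl, hF, ha⟩
    exact (hl.usefulStep .refl ⟨f, hf, .refl, hF⟩).exists_edge ha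
  · rintro ⟨p, q, ⟨hp, -⟩, ⟨-, f, hf, hqf, hF⟩, hs⟩
    obtain ⟨l, hl⟩ := rch_iff_exists_walk.1 hp
    obtain ⟨l', hl'⟩ := rch_iff_exists_walk.1 hqf
    exact ⟨l ++ a :: l', f, hf, hl.append (.cons hs hl'), hF, by simp⟩

theorem exists_accepting_arches_iff {S : Set ℕ} {k : ℕ} :
    (∃ l, ∃ f < n, Walk (Step m src lab dst) q₀ l f ∧ F f ∧ Arches S k l) ↔
      Useful n m src dst q₀ F q₀ ∧
        ∃ l q, Walk (UsefulStep n m src lab dst q₀ F) q₀ l q ∧ Arches S k l := by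
  constructor
  · rintro ⟨l, f, hf, hl, hF, ha⟩
    exact ⟨⟨.refl, f, hf, rch_iff_exists_walk.2 ⟨l, hl⟩, hF⟩, l, f,
      hl.usefulStep .refl ⟨f, hf, .refl, hF⟩, ha⟩
  · rintro ⟨hU, l, q, hl, ha⟩
    have hq : Useful n m src dst q₀ F q := hl.target_of (fun _ _ _ h => h.2.1) hU
    obtain ⟨-, f, hf, hqf, hF⟩ := hq
    obtain ⟨l', hl'⟩ := rch_iff_exists_walk.1 hqf
    exact ⟨l ++ l', f, hf, (hl.mono fun _ _ _ h => h.2.2).append hl', hF, ha.append_right _⟩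

end

theorem encodeLabel_injective {k : ℕ} :
    Function.Injective (NFAData.encodeLabel : Option (Fin k) → ℕ) := by
  rintro (_ | a) (_ | b) h
  · rfl
  · simp [NFAData.encodeLabel] at h
  · simp [NFAData.encodeLabel] at h
  · rw [Fin.ext (Nat.succ.inj h)]

theorem NFAData.mem_edges {A : NFAData} {x : ℕ × ℕ × ℕ} :
    x ∈ A.edges (List.finRange A.n) ↔ ∃ p : Fin A.n, ∃ e ∈ A.trans p, A.encodeEdge p e = x := by
  simp [NFAData.edges]

/-- The automaton has been stored as a labelled graph. -/
theorem Stored.step_iff {A : NFAData} {s : St Var Mem} (h : Stored (A.edges (List.finRange A.n)) s)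
    {p a q : ℕ} : Step A.m (s.mem .src) (s.mem .lab) (s.mem .dst) p a q ↔
      ∃ (p' q' : Fin A.n) (o : Option (Fin A.σ)), p'.val = p ∧ q'.val = q ∧
        NFAData.encodeLabel o = a ∧ q' ∈ A.toεNFA.step p' o := by
  constructor
  · rintro ⟨e, he, rfl, rfl, rfl⟩
    rw [← A.length_edges] at he
    obtain ⟨h1, h2, h3⟩ := h e _ (List.getElem?_eq_getElem he)
    obtain ⟨p, ⟨o, q⟩, hx, hpx⟩ := NFAData.mem_edges.1 (List.getElem_mem he)
    rw [h1, h2, h3, ← hpx]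
    exact ⟨p, q, o, rfl, rfl, rfl, hx⟩
  · rintro ⟨p, q, o, rfl, rfl, rfl, hx⟩
    have hm : A.encodeEdge p (o, q) ∈ A.edges (List.finRange A.n) :=
      NFAData.mem_edges.2 ⟨p, (o, q), hx, rfl⟩
    obtain ⟨e, he, hee⟩ := List.getElem_of_mem hm
    obtain ⟨h1, h2, h3⟩ := h e _ (List.getElem?_eq_getElem he)
    rw [hee] at h1 h2 h3
    exact ⟨e, by rwa [← A.length_edges], h1, h2, h3⟩

theorem Stored.bounds {A : NFAData} {s : St Var Mem} (h : Stored (A.edges (List.finRange A.n)) s)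
    {e : ℕ} (he : e < A.m) : s.mem .src e < A.n ∧ s.mem .lab e ≤ A.σ ∧ s.mem .dst e < A.n := by
  obtain ⟨p, q, o, h1, h2, h3, -⟩ := h.step_iff.1 ⟨e, he, rfl, rfl, rfl⟩
  refine ⟨h1 ▸ p.isLt, h3 ▸ ?_, h2 ▸ q.isLt⟩
  rcases o with _ | a
  · exact Nat.zero_le _
  · exact a.isLt

theorem Stored.walk_iff {A : NFAData} {s : St Var Mem} (h : Stored (A.edges (List.finRange A.n)) s)
    {p : Fin A.n} {l : List ℕ} {q : ℕ} :
    Walk (Step A.m (s.mem .src) (s.mem .lab) (s.mem .dst)) p l q ↔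
      ∃ (q' : Fin A.n) (l' : List (Option (Fin A.σ))), q'.val = q ∧ l'.map NFAData.encodeLabel = l ∧
        A.toεNFA.IsPath p q' l' := by
  constructor
  · intro hw
    generalize hx : p.val = x at hw
    induction hw generalizing p with
    | nil => exact ⟨p, [], hx, rfl, .nil _⟩
    | cons hs _ ih =>
      obtain ⟨p', r, o, h1, h2, h3, h4⟩ := h.step_iff.1 hs
      obtain rfl : p' = p := Fin.ext (h1.trans hx.symm)
      obtain ⟨q', l', h5, h6, h7⟩ := ih h2
      exact ⟨q', o :: l', h5, by simp [h3, h6], .cons _ _ _ _ _ h4 h7⟩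
  · rintro ⟨q, l, rfl, rfl, hp⟩
    induction hp with
    | nil => exact .nil _
    | cons t p q o l hs _ ih => exact .cons (h.step_iff.2 ⟨p, t, o, rfl, rfl, rfl, hs⟩) ih

/-- The problem in terms of the labelled graph. -/
theorem Stored.isExistsUniversal_iff {A : NFAData} {s : St Var Mem}
    (h : Stored (A.edges (List.finRange A.n)) s)
    (hfin : ∀ q : Fin A.n, s.mem .fin q = (A.final q).toNat) {k : ℕ} :
    IsExistsUniversal k A.toεNFA.accepts ↔ ∃ l, ∃ f < A.n,
      Walk (Step A.m (s.mem .src) (s.mem .lab) (s.mem .dst)) A.initial l f ∧ s.mem .fin f = 1 ∧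
      Arches {a | a ≠ 0 ∧ ∃ p q, UsefulStep A.n A.m (s.mem .src) (s.mem .lab) (s.mem .dst) A.initial
        (fun f => s.mem .fin f = 1) p a q} k l := by
  have hacc : ∀ x, x ∈ A.toεNFA.accepts ↔ ∃ l : List (Option (Fin A.σ)), ∃ f < A.n,
      l.reduceOption = x ∧ Walk (Step A.m (s.mem .src) (s.mem .lab) (s.mem .dst)) A.initial
        (l.map NFAData.encodeLabel) f ∧ s.mem .fin f = 1 := by
    intro x
    rw [εNFA.mem_accepts_iff_exists_path]
    constructor
    · rintro ⟨p, f, l, rfl, hf, hl, hp⟩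
      have hf' : A.final f = true := hf
      exact ⟨l, f, f.isLt, hl, h.walk_iff.2 ⟨f, l, rfl, rfl, hp⟩, by simp [hfin, hf']⟩
    · rintro ⟨l, f, hf, hl, hw, h1⟩
      obtain ⟨f', l', rfl, hl', hp⟩ := h.walk_iff.1 hw
      obtain rfl := (encodeLabel_injective.list_map hl').symm
      refine ⟨_, f', l, rfl, ?_, hl, hp⟩
      rw [hfin] at h1
      have : A.final f' = true := by cases hb : A.final f' <;> simp [hb] at h1 ⊢
      exact this
  have hS : {a | a ≠ 0 ∧ ∃ p q, UsefulStep A.n A.m (s.mem .src) (s.mem .lab) (s.mem .dst) A.initial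
      (fun f => s.mem .fin f = 1) p a q} =
      (fun a : Fin A.σ => a.val + 1) '' minAlphabet A.toεNFA.accepts := by
    ext a
    simp only [Set.mem_ofPred_eq, ← exists_accepting_iff, Set.mem_image, minAlphabet]
    constructor
    · rintro ⟨h0, l, f, hf, hl, h1, ha⟩
      obtain ⟨f', l', rfl, rfl, hp⟩ := h.walk_iff.1 hl
      obtain ⟨o, ho, rfl⟩ := List.mem_map.1 ha
      rcases o with _ | b
      · exact absurd rfl h0
      · exact ⟨b, ⟨_, (hacc _).2 ⟨l', f', hf, rfl, hl, h1⟩, List.reduceOption_mem_iff.2 ho⟩, rfl⟩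
    · rintro ⟨b, ⟨x, hx, hb⟩, rfl⟩
      obtain ⟨l, f, hf, rfl, hw, h1⟩ := (hacc x).1 hx
      exact ⟨Nat.succ_ne_zero _, _, f, hf, hw, h1, mem_map_encodeLabel.2 hb⟩
  rw [hS]
  constructor
  · rintro ⟨x, hx, hu⟩
    rw [isUniversal_iff (S := minAlphabet A.toεNFA.accepts) fun a ha => ⟨x, hx, ha⟩] at hu
    obtain ⟨l, f, hf, rfl, hw, h1⟩ := (hacc x).1 hx
    exact ⟨_, f, hf, hw, h1, arches_map_encodeLabel.2 hu⟩
  · rintro ⟨l, f, hf, hw, h1, ha⟩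
    obtain ⟨f', l', rfl, rfl, hp⟩ := h.walk_iff.1 hw
    have hx := (hacc l'.reduceOption).2 ⟨l', f', hf, rfl, hw, h1⟩
    exact ⟨_, hx, (isUniversal_iff (S := minAlphabet A.toεNFA.accepts) fun a ha => ⟨_, hx, ha⟩).2 (arches_map_encodeLabel.1 ha)⟩

end ESU

/-! ### The whole program -/

namespace ESU

open WordRAM

theorem Grouped.congr {n m : ℕ} {E E' : ℕ → ℕ → ℕ → Prop} {off sl sv : ℕ → ℕ}
    (h : Grouped n m E off sl sv) (hE : ∀ i < n, ∀ a j, E i a j ↔ E' i a j) :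
    Grouped n m E' off sl sv :=
  ⟨h.mono, h.zero, h.le, fun i hi a j => (h.mem i hi a j).trans (hE i hi a j)⟩

section

variable {w n m sg q₀ k : ℕ} {src lab dst : ℕ → ℕ} {F : ℕ → Prop} {s : St Var Mem}

theorem solve_does (hG : Graph w n m src dst s) (hlab : s.mem .lab = lab)
    (hle : ∀ e < m, lab e ≤ sg) (hsg : s.reg .sg = sg) (hsgw : sg < 2 ^ w)
    (hq : s.reg .q0 = q₀) (hq₀ : q₀ < n)
    (hsize : ∀ v < n, s.mem .size v = reachCount n (Rch m src dst) v)
    (hco : ∀ v < n, s.mem .co v = 1 ↔ ∃ q < n, Rch m src dst v q ∧ F q)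
    (hlose : s.reg .lose ≠ 0) (hU : Useful n m src dst q₀ F q₀) (hk : 1 ≤ k)
    (hkk : s.reg .nd = 1 → s.reg .kk = k) (hnd : s.reg .nd ≠ 1 → n ≤ k) :
    Does w solve s ((n * (n * (4 * m + 15) + 12) + 2) + ((n * (4 * m + 12) + 8) +
      ((n * (m * 7 + 5) + 4) + ((sg * 3 + m * 3 + 5) + ((n * (100 * (n * (n + m + sg)) + 7) + 2) +
      (2 ^ n * (800 * (n * (n + m + sg))) + 1 + 1)))))) fun s' => s'.reg .lose = 0 ↔
      ∃ l q, Walk (UsefulStep n m src lab dst q₀ F) q₀ l q ∧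
        Arches {a | a ≠ 0 ∧ ∃ p q, UsefulStep n m src lab dst q₀ F p a q} k l := by
  classical
  refine Does.seq (ranks_does hG hsize) ?_ le_rfl
  rintro s₁ ha₁ hid₁
  refine Does.seq (trim_does (hG.agree ha₁) ((ha₁.1 .q0 rfl).trans hq) hq₀) ?_ le_rfl
  rintro s₂ ha₂ hid₂
  have hG₂ := (hG.agree ha₁).agree ha₂
  set ids := s₂.mem .ids with hids
  have hid : ∀ v < n, ids v = if Useful n m src dst q₀ F v then rank n (Rch m src dst) v else n := by
    intro v hv
    rw [hid₂ v hv, hid₁ v hv, ha₁.2 .co rfl]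
    simp only [hco v hv]
    exact if_congr Iff.rfl rfl rfl
  have hC := components_of_rank hq₀ hG.dst_lt (lab := lab) hid
  set E := Cross (UsefulStep n m src lab dst q₀ F) ids with hE
  have hcross : ∀ i a j, E i a j ↔ i < n ∧ Edge n m src lab dst ids i a j := fun i a j =>
    cross_iff_edge hG.src_lt hG.dst_lt hid
  set N : ℕ → Prop := fun a => a ≠ 0 ∧ ∃ p q, UsefulStep n m src lab dst q₀ F p a q with hNdef
  have hN : ∀ a, N a ↔ a ≠ 0 ∧ ∃ i < n, ∃ j, E i a j := by
    refine fun a => and_congr_right fun _ => ⟨?_, ?_⟩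
    · rintro ⟨p, q, h⟩
      exact ⟨ids p, ((hcross (ids p) a (ids q)).1 ⟨p, q, h, rfl, rfl⟩).1, ids q, p, q, h, rfl, rfl⟩
    · rintro ⟨-, -, -, p, q, h, -⟩
      exact ⟨p, q, h⟩
  have hlabel : ∀ i a j, E i a j → a ≤ sg := by
    rintro i a j ⟨p, q, ⟨-, -, e, he, -, rfl, -⟩, -⟩
    exact hle e he
  have hNle : ∀ a, N a → a ≤ sg := fun a ha => by
    obtain ⟨-, i, -, j, h⟩ := (hN a).1 ha
    exact hlabel i a j h
  refine Does.seq (group_does hG₂ ((ha₂.2 .lab rfl).trans ((ha₁.2 .lab rfl).trans hlab)) rfl) ?_ le_rfl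
  rintro s₃ ha₃ ⟨hgr, hg⟩
  have hgr' : Grouped n m E (s₃.mem .off) (s₃.mem .sl) (s₃.mem .sv) :=
    hgr.congr fun i hi a j => ((hcross i a j).trans (and_iff_right hi)).symm
  have hsg₃ : s₃.reg .sg = sg :=
    (ha₃.1 .sg rfl).trans ((ha₂.1 .sg rfl).trans ((ha₁.1 .sg rfl).trans hsg))
  refine Does.seq (needed_does hG.one_lt hgr' hg hsg₃ hsgw hG.m_lt) ?_ le_rfl
  rintro s₄ ha₄ hneed
  have hnet : Net w n m sg E N s₄ :=
    { one_lt := hG.one_lt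
      n_lt := hG.n_lt
      m_lt := hG.m_lt
      sg_lt := hsgw
      reg_n := ((hG₂.agree ha₃).agree ha₄).reg_n
      reg_sg := (ha₄.1 .sg rfl).trans hsg₃
      grouped := by rw [ha₄.2 .off rfl, ha₄.2 .sl rfl, ha₄.2 .sv rfl]; exact hgr'
      label_le := hlabel
      target_lt := fun i a j h => ((hcross i a j).1 h).2.1
      need := fun a ha => (hneed a ha).trans (hN a).symm
      needed := fun a ha => ⟨Nat.one_le_iff_ne_zero.2 ha.1, hNle a ha⟩ }
  refine Does.seq (single_does hnet) ?_ le_rfl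
  rintro s₅ ha₅ hsingle
  have hlose₄ : s₄.reg .lose ≠ 0 := by
    rwa [ha₄.1 .lose rfl, ha₃.1 .lose rfl, ha₂.1 .lose rfl, ha₁.1 .lose rfl]
  rw [or_iff_right hlose₄] at hsingle
  refine Does.ite (fun h => Does.straight rfl (Nat.zero_le _) ?_) (fun h => ?_) le_rfl
  · have h0 : s₅.reg .lose = 0 := by simpa using h
    obtain ⟨i, -, hi⟩ := hsingle.1 h0
    exact iff_of_true h0 (hC.exists_arches_of_single hNle hi
      (fun q hq => exists_walk_of_useful .refl hq hq.1) k)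
  have h0 : s₅.reg .lose ≠ 0 := by simpa using h
  have hno : ∀ i, ¬ ∀ a, N a → E i a i := by
    intro i hi
    by_cases hne : ∃ a, N a
    · obtain ⟨a, ha⟩ := hne
      exact h0 (hsingle.2 ⟨i, ((hcross i a i).1 (hi a ha)).1, hi⟩)
    · exact h0 (hsingle.2 ⟨q₀, hq₀, fun a ha => absurd ⟨a, ha⟩ hne⟩)
  have hwins := hC.exists_arches_iff_wins hNle hno hU hk
  have hnd₅ : s₅.reg .nd = s.reg .nd := by
    rw [ha₅.1 .nd rfl, ha₄.1 .nd rfl, ha₃.1 .nd rfl, ha₂.1 .nd rfl, ha₁.1 .nd rfl]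
  have h1 : 1 % 2 ^ w = 1 := Nat.mod_eq_of_lt hG.one_lt
  refine Does.ite (fun h => ?_) (fun h => Does.straight rfl (Nat.zero_le _) ?_) le_rfl
  · have hnd1 : s.reg .nd = 1 := by simpa [h1, hnd₅] using h
    refine (search_does (hnet.agree ha₅) (k := k) ?_ hk (i₀ := ids q₀) ?_ ?_ h0).mono le_rfl
      fun s' _ h => h.trans hwins.symm
    · rw [ha₅.1 .kk rfl, ha₄.1 .kk rfl, ha₃.1 .kk rfl, ha₂.1 .kk rfl, ha₁.1 .kk rfl, hkk hnd1]
    · rw [ha₅.1 .q0 rfl, ha₄.1 .q0 rfl, ha₃.1 .q0 rfl, ha₂.1 .q0 rfl, ha₁.1 .q0 rfl, hq,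
        ha₅.2 .ids rfl, ha₄.2 .ids rfl, ha₃.2 .ids rfl]
    · rw [hid _ hq₀, if_pos hU]
      exact rank_lt .refl hq₀
  · have hnd1 : s.reg .nd ≠ 1 := by simpa [h1, hnd₅] using h
    exact iff_of_false h0 (hwins.not.2 (not_wins_of_le hnet.target_lt (hnd hnd1)))

end

/-- A bound for the number of steps of the program. -/
def cost (n m sg : ℕ) : ℕ := 2000 * (2 ^ n * (n * (n + m + sg)))

theorem main_does {w : ℕ} {x : Instance} {s : St Var Mem} (hx : problem.valid w x)
    (hinp : s.mem .inp = fun i => (x.input w).getD i 0) :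
    Does w main s (cost x.A.n x.A.m x.A.σ) fun s' => s'.reg .lose = 0 ↔ problem.yes x := by
  obtain ⟨hσ, -, hlen, hword⟩ := id hx
  have hn0 : 0 < x.A.n := (Nat.zero_le _).trans_lt x.A.initial.isLt
  have hn : x.A.n < 2 ^ w :=
    hword _ (by simp [problem, Instance.input, NFAData.encode])
  have hsgw : x.A.σ < 2 ^ w :=
    hword _ (by simp [problem, Instance.input, NFAData.encode])
  have hw : 1 < 2 ^ w := by omega
  have h1 : 1 % 2 ^ w = 1 := Nat.mod_eq_of_lt hw
  set n := x.A.n with hndef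
  set m := x.A.m with hmdef
  set sg := x.A.σ with hsgdef
  have hT : (8 * m + 8 * n + 20) + (((n * (n * (4 * m + 13) + 13) + 2) +
      (((n * (n * (4 * m + 15) + 12) + 2) + ((n * (4 * m + 12) + 8) +
      ((n * (m * 7 + 5) + 4) + ((sg * 3 + m * 3 + 5) + ((n * (100 * (n * (n + m + sg)) + 7) + 2) +
      (2 ^ n * (800 * (n * (n + m + sg))) + 1 + 1)))))) + 1 + 1)) + 1) ≤ cost n m sg := by
    have hp : n + 1 ≤ 2 ^ n := Nat.lt_two_pow_self
    unfold cost
    generalize 2 ^ n = p at *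
    have e0 : n * (n + m + sg) = n * n + n * m + n * sg := by ring
    have e1 : n ≤ n * n := Nat.le_mul_of_pos_left n hn0
    have e2 : m ≤ n * m := Nat.le_mul_of_pos_left m hn0
    have e3 : sg ≤ n * sg := Nat.le_mul_of_pos_left sg hn0
    have e4 : n * (n * (n + m + sg)) ≤ p * (n * (n + m + sg)) := Nat.mul_le_mul_right _ (by omega)
    have e5 : 1 * (n * (n + m + sg)) ≤ p * (n * (n + m + sg)) := Nat.mul_le_mul_right _ (by omega)
    have e6 : n * (n * m) ≤ n * (n * (n + m + sg)) := by gcongr; omega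
    have e7 : n * n ≤ n * (n + m + sg) := by gcongr; omega
    nlinarith
  refine Does.mono (Does.seq (parse_does hx hinp) ?_ le_rfl) hT fun _ _ h => h
  rintro s₁ - ⟨hn₁, hsg₁, hq₁, hm₁, hnd₁, hkk₁, hfin₁, hst₁, hmw⟩
  refine Does.set_seq ?_
  refine Does.of_state (P := fun s₂ => s₂.mem = s₁.mem ∧ (∀ r, r ≠ .lose → s₂.reg r = s₁.reg r) ∧
    s₂.reg .lose = 1) ?_ ?_
  · refine ⟨rfl, fun r hr => by simp [hr], by simp [h1]⟩
  rintro s₂ ⟨hmem, hreg, hlose⟩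
  have hst : Stored (x.A.edges (List.finRange x.A.n)) s₂ := by rw [Stored, hmem]; exact hst₁
  have hfin : ∀ q : Fin x.A.n, s₂.mem .fin q = (x.A.final q).toNat := by rw [hmem]; exact hfin₁
  have hG : Graph w n m (s₂.mem .src) (s₂.mem .dst) s₂ :=
    ⟨hw, hn, hmw, (hreg .n (by decide)).trans hn₁, (hreg .m (by decide)).trans hm₁, rfl, rfl,
      fun e he => (hst.bounds he).1, fun e he => (hst.bounds he).2.2⟩
  refine Does.seq (sizes_does hG) ?_ le_rfl
  rintro s₃ ha₃ hsz
  have hq₃ : s₃.reg .q0 = x.A.initial :=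
    (ha₃.1 .q0 rfl).trans ((hreg .q0 (by decide)).trans hq₁)
  have hnd₃ : s₃.reg .nd = (Nat.digits (2 ^ w) x.k).length :=
    (ha₃.1 .nd rfl).trans ((hreg .nd (by decide)).trans hnd₁)
  have hkk₃ : ∀ d l, Nat.digits (2 ^ w) x.k = d :: l → s₃.reg .kk = d := fun d l h =>
    (ha₃.1 .kk rfl).trans ((hreg .kk (by decide)).trans (hkk₁ d l h))
  have hlose₃ : s₃.reg .lose = 1 := (ha₃.1 .lose rfl).trans hlose
  have hyes : problem.yes x ↔ _ :=
    (hst.isExistsUniversal_iff hfin (k := x.k)).trans exists_accepting_arches_iff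
  have hi := x.A.initial.isLt
  have hco : s₃.mem .co x.A.initial = 1 ↔ Useful n m (s₂.mem .src) (s₂.mem .dst) x.A.initial
      (fun f => s₂.mem .fin f = 1) x.A.initial :=
    ((hsz _ hi).2).trans (and_iff_right .refl).symm
  refine Does.ite (fun h => ?_) (fun h => Does.straight rfl (Nat.zero_le _) ?_) le_rfl
  swap
  · have hU := hco.not.1 (by simpa [h1, hq₃] using h)
    exact iff_of_false (by simp [Cmd.denote, hlose₃]) fun h => hU (hyes.1 h).1
  have hU := hco.1 (by simpa [h1, hq₃] using h)
  refine Does.ite (fun h => Does.straight rfl ?_ ?_) (fun h => ?_) le_rfl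
  · simp only [Cmd.size]; omega
  · have hk : x.k = 0 := by
      have : (Nat.digits (2 ^ w) x.k).length = 0 := by simpa [hnd₃] using h
      simpa [Nat.digits_eq_nil_iff_eq_zero] using List.length_eq_zero_iff.1 this
    refine iff_of_true (by simp) (hyes.2 ⟨hU, [], _, .nil _, ?_⟩)
    rw [hk]
    trivial
  have hnd0 : (Nat.digits (2 ^ w) x.k).length ≠ 0 := by simpa [hnd₃] using h
  have hk0 : x.k ≠ 0 := by
    rintro hk0
    simp [hk0] at hnd0
  refine (solve_does (k := x.k) (lab := s₂.mem .lab) (F := fun f => s₂.mem .fin f = 1)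
    (hG.agree ha₃) (ha₃.2 .lab rfl) (fun e he => (hst.bounds he).2.1)
    ((ha₃.1 .sg rfl).trans ((hreg .sg (by decide)).trans hsg₁)) hsgw hq₃ hi
    (fun v hv => (hsz v hv).1) (fun v hv => (hsz v hv).2) (by rw [hlose₃]; exact one_ne_zero) hU
    (Nat.one_le_iff_ne_zero.2 hk0) (fun h => ?_) (fun h => ?_)).mono le_rfl fun s' _ h =>
      h.trans ((and_iff_right hU).symm.trans hyes.symm)
  · rw [hnd₃] at h
    obtain ⟨d, hd⟩ := List.length_eq_one_iff.1 h
    rw [hkk₃ d [] hd, ← Nat.ofDigits_digits (2 ^ w) x.k, hd]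
    simp
  · rw [hnd₃] at h
    refine hn.le.trans ?_
    by_contra hlt
    have := (Nat.digits_length_le_iff hw (k := 1) x.k).2 (by simpa using hlt)
    omega

/-- The program for the word RAM. -/
def program : Program := main.toProgram Var.ctorIdx Mem.ctorIdx .lose

theorem Var.ctorIdx_injective : Function.Injective Var.ctorIdx :=
  Function.LeftInverse.injective Var.ofNat_ctorIdx

theorem Mem.ctorIdx_injective : Function.Injective Mem.ctorIdx :=
  Function.LeftInverse.injective Mem.ofNat_ctorIdx

theorem program_halts {w : ℕ} {x : Instance} (hx : problem.valid w x) :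
    ∃ (t : ℕ) (answer : Bool), HaltsAfter program w (x.input w) t answer ∧
      (answer = true ↔ problem.yes x) ∧ t ≤ main.unit * cost x.A.n x.A.m x.A.σ + 2 := by
  obtain ⟨t, s', he, ht, hs'⟩ := main_does (w := w) (x := x)
    (s := ⟨fun _ => 0, fun a i => if a.ctorIdx = 0 then (x.input w).getD i 0 else 0⟩) hx
    (by funext i; rfl)
  obtain ⟨t', ht', hh⟩ := he.haltsAfter Var.ctorIdx_injective Mem.ctorIdx_injective .lose
    (input := x.input w) ⟨fun _ => rfl, fun a => rfl⟩
  exact ⟨t', _, hh, by simpa using hs', ht'.trans (by gcongr)⟩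

theorem cost_le {n m sg : ℕ} (hn : 1 ≤ n) (hsg : 1 ≤ sg) :
    (cost n m sg : ℝ) ≤ 6000 * (2 ^ n * n * (m + n * sg * Real.sqrt n)) := by
  have h1 : (1 : ℝ) ≤ n := by exact_mod_cast hn
  have h2 : (1 : ℝ) ≤ sg := by exact_mod_cast hsg
  have h3 : (1 : ℝ) ≤ Real.sqrt n := Real.one_le_sqrt.2 h1
  have h4 : (n : ℝ) * sg ≤ n * sg * Real.sqrt n := le_mul_of_one_le_right (by positivity) h3
  have h5 : (n : ℝ) ≤ n * sg := le_mul_of_one_le_right (by positivity) h2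
  have h6 : (sg : ℝ) ≤ n * sg := le_mul_of_one_le_left (by positivity) h1
  have h7 : (n + m + sg : ℝ) ≤ 3 * (m + n * sg * Real.sqrt n) := by
    have : (0 : ℝ) ≤ m := by positivity
    linarith
  calc (cost n m sg : ℝ) = 2000 * (2 ^ n * (n * (n + m + sg))) := by
        unfold cost
        push_cast
        ring
    _ ≤ 2000 * (2 ^ n * (n * (3 * (m + n * sg * Real.sqrt n)))) := by gcongr
    _ = _ := by ring

theorem Instance.length_input (w : ℕ) (x : Instance) : x.A.m ≤ (x.input w).length := by
  have h : ((List.finRange x.A.n).map fun q => (x.A.encodeState q).length).sum =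
      ∑ q, (x.A.encodeState q).length := by
    rw [← List.sum_ofFn, List.ofFn_eq_map]
  have h2 : x.A.m ≤ ∑ q, (x.A.encodeState q).length :=
    Finset.sum_le_sum fun q _ => by
      simp [NFAData.encodeState, List.length_flatMap]
      omega
  simp only [Instance.input, NFAData.encode, List.length_append, List.length_cons,
    List.length_flatMap, h]
  omega

theorem primrec_cost : Primrec fun n => main.unit * cost n 1 1 + 2 := by
  have hpow : Primrec fun n : ℕ => 2 ^ n :=
    (Primrec.nat_rec₁ 1 (Primrec.nat_mul.comp Primrec.snd (Primrec.const 2)).to₂).of_eq fun n => by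
      induction n with
      | zero => rfl
      | succ n ih => simp [pow_succ, ← ih]
  have hmul := Primrec.nat_mul
  have hadd := Primrec.nat_add
  unfold cost
  exact hadd.comp (hmul.comp (Primrec.const _) (hmul.comp (Primrec.const _) (hmul.comp hpow
    (hmul.comp Primrec.id (hadd.comp (hadd.comp Primrec.id (Primrec.const _)) (Primrec.const _))))))
    (Primrec.const _)

end ESU

theorem mainTheorem1 :
    (∃ (P : WordRAM.Program) (C : ℝ), ESU.problem.DecidedBy P fun _ x =>
      C * (2 ^ x.A.n * x.A.n * (x.A.m + x.A.n * x.A.σ * Real.sqrt x.A.n))) ∧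
    ESU.problem.IsFPT (fun x => x.A.n) := by
  have hn (x : ESU.Instance) : 1 ≤ x.A.n := (Nat.zero_le _).trans_lt x.A.initial.isLt
  refine ⟨⟨ESU.program, ESU.main.unit * 6000 + 2, fun w x hx => ?_⟩,
    ESU.program, fun n => ESU.main.unit * ESU.cost n 1 1 + 2, 1, ESU.primrec_cost.to_comp,
    fun w x hx => ?_⟩
  · obtain ⟨t, a, h, hyes, ht⟩ := ESU.program_halts hx
    refine ⟨t, a, h, hyes, ?_⟩
    set B : ℝ := 2 ^ x.A.n * x.A.n * (x.A.m + x.A.n * x.A.σ * Real.sqrt x.A.n)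
    have h1 : (ESU.cost x.A.n x.A.m x.A.σ : ℝ) ≤ 6000 * B := ESU.cost_le (hn x) hx.1
    have h2 : (1 : ℝ) ≤ B := by
      have h3 : (1 : ℝ) ≤ x.A.n := by exact_mod_cast hn x
      have h4 : (1 : ℝ) ≤ x.A.σ := by exact_mod_cast hx.1
      have h5 : (1 : ℝ) ≤ Real.sqrt x.A.n := Real.one_le_sqrt.2 h3
      have h6 : (1 : ℝ) ≤ 2 ^ x.A.n := one_le_pow₀ one_le_two
      have h7 : (1 : ℝ) ≤ x.A.m + x.A.n * x.A.σ * Real.sqrt x.A.n :=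
        (one_le_mul_of_one_le_of_one_le (one_le_mul_of_one_le_of_one_le h3 h4) h5).trans
          (le_add_of_nonneg_left (by positivity))
      exact one_le_mul_of_one_le_of_one_le (one_le_mul_of_one_le_of_one_le h6 h3) h7
    calc (t : ℝ) ≤ ESU.main.unit * ESU.cost x.A.n x.A.m x.A.σ + 2 := by exact_mod_cast ht
      _ ≤ ESU.main.unit * (6000 * B) + 2 * B := by gcongr; linarith
      _ = _ := by ring
  · obtain ⟨t, a, h, hyes, ht⟩ := ESU.program_halts hx
    refine ⟨t, a, h, hyes, ?_⟩
    have h1 := x.length_input w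
    have h2 := hx.2.1
    have h0 : 1 ≤ (x.input w).length := hx.1.trans h2
    set l := (x.input w).length
    have hcost : ESU.cost x.A.n x.A.m x.A.σ ≤ ESU.cost x.A.n 1 1 * l := by
      have : x.A.n ≤ x.A.n * l := Nat.le_mul_of_pos_right _ h0
      calc ESU.cost x.A.n x.A.m x.A.σ ≤ 2000 * (2 ^ x.A.n * (x.A.n * (x.A.n * l + l + l))) := by
            unfold ESU.cost
            gcongr
        _ = _ := by unfold ESU.cost; ring
    have : t ≤ (ESU.main.unit * ESU.cost x.A.n 1 1 + 2) * l := by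
      calc t ≤ ESU.main.unit * (ESU.cost x.A.n 1 1 * l) + 2 * l :=
            ht.trans (add_le_add (Nat.mul_le_mul_left _ hcost) (by omega))
        _ = _ := by ring
    simp only [pow_one]
    exact_mod_cast this
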